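/- Let $\mathcal C$ be a small category. Let $P(\mathcal C,\mathrm{Grpd})$ be the category of presheaves of small groupoids on $\mathcal C$. Let $\mathrm{Grpd}/\mathcal C$ be the category of categories fibered in groupoids over $\mathcal C$: the full subcategory of $\mathrm{Cat}/\mathcal C$ (morphisms are functors strictly over $\mathcal C$) on those $F:\mathcal E\to\mathcal C$ such that (1) for every $f:Y\to F(X')$ in $\mathcal C$ there is $f':Y'\to X'$ in $\mathcal E$ with $F(f')=f$, and (2) for $f':Y'\to X'$, $g':Z'\to X'$ in $\mathcal E$ and $h:F(Y')\to F(Z')$ with $F(g')h=F(f')$ there is a unique $h':Y'\to Z'$ with $g'h'=f'$ and $F(h')=h$. *Notation.* For $\mathcal E,\mathcal E'\in\mathrm{Grpd}/\mathcal C$ let $\mathrm{Grpd}_{\mathcal C}(\mathcal E,\mathcal E')$ be the groupoid of functors $\mathcal E\to\mathcal E'$ over $\mathcal C$ and natural transformations over $\mathrm{id}_{\mathcal C}$. Let $\Delta^i$ be the groupoid with objects $0,\dots,i$ and exactly one morphism between any two objects. The maps $\partial\Delta^i\to\Delta^i$ of groupoids are $\emptyset\to\Delta^0$ for $i=0$,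 the inclusion of the discrete groupoid $\{0,1\}\to\Delta^1$ for $i=1$, and the projection $\Delta^2\times B\mathbb Z\to\Delta^2$ for $i=2$, where $B\mathbb Z$ is the group $\mathbb Z$ viewed as a groupoid with one object. A functor of groupoids is called a weak equivalence if it is an equivalence of categories, and a fibration if it has the right lifting property with respect to the inclusion $\Delta^0\to\Delta^1$ of a vertex. For a groupoid $G$, $\mathcal E\otimes G$ denotes $\mathcal E\times G$ with its projection to $\mathcal C$, and $X\otimes G$ denotes the presheaf $Y\mapsto \mathrm{Hom}_{\mathcal C}(Y,X)\times G$, for $X\in\mathcal C$, where $\mathrm{Hom}_{\mathcal C}(Y,X)$ is viewed as a discrete groupoid. Model categories are required to have all small limits and colimits and functorial factorizations. **(a)** There is a left proper, cofibrantly generated model structure on $\mathrm{Grpd}/\mathcal C$ in which $f$ is a weak equivalence (respectively a fibration) if and only if $\mathrm{Grpd}_{\mathcal C}(\mathcal C/X,f)$ is one for all $X\in\mathcal C$, and the cofibrations are the maps with the left lifting property with respect to trivial fibrations. The weak equivalences are exactly the fiberwise equivalences, that is, the functors over $\mathcal C$ which induce equivalences $\mathcal E_X\to\mathcal E'_X$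 of fiber categories for all $X\in\mathcal C$. The maps $\mathcal C/X\to\mathcal C/X\otimes\Delta^1$ ($X\in\mathcal C$) induced by the vertex inclusion form a set of generating trivial cofibrations, and the maps $\mathcal C/X\otimes\partial\Delta^i\to\mathcal C/X\otimes\Delta^i$ ($X\in\mathcal C$, $i=0,1,2$) form a set of generating cofibrations. With the nerves of the groupoids $\mathrm{Grpd}_{\mathcal C}(\mathcal E,\mathcal E')$ as simplicial mapping spaces, it is a simplicial model category. **(b)** There is a left proper, cofibrantly generated model structure on $P(\mathcal C,\mathrm{Grpd})$ in which $f$ is a weak equivalence (respectively a fibration) if and only if $f(X)$ is one for all $X\in\mathcal C$, and the cofibrations are the maps with the left lifting property with respect to trivial fibrations. The maps $X\to X\otimes\Delta^1$ ($X\in\mathcal C$) induced by the vertex inclusion form a set of generating trivial cofibrations, and the maps $X\otimes\partial\Delta^i\to X\otimes\Delta^i$ ($X\in\mathcal C$, $i=0,1,2$) form a set of generating cofibrations. **(c)** Let $\Gamma:\mathrm{Grpd}/\mathcal C\to P(\mathcal C,\mathrm{Grpd})$ be the functor $\Gamma\mathcal E(X)=\mathrm{Grpd}_{\mathcal C}(\mathcal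 C/X,\mathcal E)$. Let $p:P(\mathcal C,\mathrm{Grpd})\to\mathrm{Grpd}/\mathcal C$ be the functor which sends $F$ to the category over $\mathcal C$ whose objects are the pairs $(X,a)$ with $X\in\mathcal C$ and $a\in F(X)$, whose morphisms $(X,a)\to(Y,b)$ are the pairs $(f,\alpha)$ with $f:X\to Y$ in $\mathcal C$ and $\alpha:a\to F(f)(b)$ in $F(X)$, and in which $(g,\beta)\circ(f,\alpha)=(g\circ f,\,F(f)(\beta)\circ\alpha)$. Then $p$ is left adjoint to $\Gamma$, and the adjunction $(p,\Gamma)$ is a Quillen equivalence between the model structures in (a) and (b). -/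

import Mathlib

open CategoryTheory CategoryTheory.Limits HomotopicalAlgebra Opposite
open scoped MonoidalCategory

universe w v u

/-! ### Model categories -/

section ModelCategories

/-- A model category is left proper if every pushout of a weak equivalence along a cofibration is
a weak equivalence. -/
def IsLeftProper (M : Type w) [Category.{v} M] [ModelCategory M] : Prop :=
  ∀ {A B X Y : M} (f : A ⟶ X) (i : A ⟶ B) (j : X ⟶ Y) (g : B ⟶ Y), IsPushout f i j g →
    weakEquivalences M f → cofibrations M i → weakEquivalences M g

/-- `I` is a set of generating cofibrations and `J` is a set of generating trivial cofibrations: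
both permit the small object argument (in particular, they are essentially small), the trivial
fibrations are the maps with the right lifting property with respect to `I`, and the fibrations
are the maps with the right lifting property with respect to `J`. -/
structure IsCofibrantlyGeneratedBy (M : Type w) [Category.{v} M] [ModelCategory M]
    (I J : MorphismProperty M) : Prop where
  small_I : MorphismProperty.HasSmallObjectArgument.{v} I
  small_J : MorphismProperty.HasSmallObjectArgument.{v} J
  trivialFibrations_eq : trivialFibrations M = I.rlp
  fibrations_eq : fibrations M = J.rlp

/-- The strong form of the first and the last axiom of model categories: all small limits and
colimits exist and the two factorizations can be chosen functorially. -/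
structure IsStrongModelCategory (M : Type w) [Category.{v} M] [ModelCategory M] : Prop where
  hasLimits : HasLimits M
  hasColimits : HasColimits M
  factorization_trivialCofibrations :
    MorphismProperty.HasFunctorialFactorization (trivialCofibrations M) (fibrations M)
  factorization_trivialFibrations :
    MorphismProperty.HasFunctorialFactorization (cofibrations M) (trivialFibrations M)

/-- An adjunction `L ⊣ R` between model categories is a Quillen adjunction if `L` preserves
cofibrations and trivial cofibrations. -/
structure IsQuillenAdjunction {M : Type w} [Category.{v} M] [ModelCategory M]
    {N : Type w} [Category.{v} N] [ModelCategory N] {L : M ⥤ N} {R : N ⥤ M}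
    (_adj : L ⊣ R) : Prop where
  map_cofibrations {X Y : M} (f : X ⟶ Y) : cofibrations M f → cofibrations N (L.map f)
  map_trivialCofibrations {X Y : M} (f : X ⟶ Y) :
    trivialCofibrations M f → trivialCofibrations N (L.map f)

/-- A Quillen adjunction `L ⊣ R` is a Quillen equivalence if for all cofibrant `X` and fibrant
`Y`, a map `L X ⟶ Y` is a weak equivalence if and only if its adjunct `X ⟶ R Y` is. -/
structure IsQuillenEquivalence {M : Type w} [Category.{v} M] [ModelCategory M]
    {N : Type w} [Category.{v} N] [ModelCategory N] {L : M ⥤ N} {R : N ⥤ M}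
    (adj : L ⊣ R) : Prop extends IsQuillenAdjunction adj where
  weakEquivalence_iff (X : M) (Y : N) [IsCofibrant X] [IsFibrant Y] (f : L.obj X ⟶ Y) :
    weakEquivalences N f ↔ weakEquivalences M (adj.homEquiv X Y f)

/-- `η : K ⟶ sHom X T` exhibits `T` as the tensor `X ⊗ K` of an object `X` of a simplicial
category with a simplicial set `K`: it induces isomorphisms `sHom T Y ≅ (sHom X Y) ^ K`, that is,
bijections from maps `L ⟶ sHom T Y` to maps `K ⊗ L ⟶ sHom X Y`. -/
def IsSimplicialTensor {M : Type w} [Category.{v} M] [SimplicialCategory M] {K : SSet.{v}}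
    {X T : M} (η : K ⟶ SimplicialCategory.sHom X T) : Prop :=
  ∀ (Y : M) (L : SSet.{v}), Function.Bijective
    (fun β : L ⟶ SimplicialCategory.sHom T Y ↦ (η ⊗ₘ β) ≫ SimplicialCategory.sHomComp X T Y)

/-- `ε : K ⟶ sHom P Y` exhibits `P` as the cotensor `Y ^ K` of an object `Y` of a simplicial
category with a simplicial set `K`: it induces isomorphisms `sHom X P ≅ (sHom X Y) ^ K`, that is,
bijections from maps `L ⟶ sHom X P` to maps `L ⊗ K ⟶ sHom X Y`. -/
def IsSimplicialCotensor {M : Type w} [Category.{v} M] [SimplicialCategory M] {K : SSet.{v}}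
    {P Y : M} (ε : K ⟶ SimplicialCategory.sHom P Y) : Prop :=
  ∀ (X : M) (L : SSet.{v}), Function.Bijective
    (fun β : L ⟶ SimplicialCategory.sHom X P ↦ (β ⊗ₘ ε) ≫ SimplicialCategory.sHomComp X P Y)

/-- The map `Map(B, X) ⟶ Map(A, X) ×_{Map(A, Y)} Map(B, Y)` of simplicial sets induced by
`i : A ⟶ B` and `p : X ⟶ Y`. -/
noncomputable def pullbackHom {M : Type w} [Category.{v} M] [SimplicialCategory M]
    {A B X Y : M} (i : A ⟶ B) (p : X ⟶ Y) :
    SimplicialCategory.sHom B X ⟶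
      pullback (eHomWhiskerLeft SSet.{v} A p) (eHomWhiskerRight SSet.{v} i Y) :=
  pullback.lift (eHomWhiskerRight SSet.{v} i X) (eHomWhiskerLeft SSet.{v} B p)
    (eHom_whisker_exchange SSet.{v} i p).symm

/-- A simplicial model category: a model category which is a simplicial category with tensors and
cotensors by simplicial sets, such that for every cofibration `i` and fibration `p` the
map `pullbackHom i p` is a Kan fibration (right lifting property against the horn inclusions),
which is a trivial one (right lifting property against the boundary inclusions) if
`i` or `p` is a weak equivalence. -/
structure IsSimplicialModelCategory (M : Type w) [Category.{v} M] [ModelCategory M]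
    [SimplicialCategory M] : Prop where
  exists_tensor (X : M) (K : SSet.{v}) :
    ∃ (T : M) (η : K ⟶ SimplicialCategory.sHom X T), IsSimplicialTensor η
  exists_cotensor (Y : M) (K : SSet.{v}) :
    ∃ (P : M) (ε : K ⟶ SimplicialCategory.sHom P Y), IsSimplicialCotensor ε
  fibration {A B X Y : M} (i : A ⟶ B) (p : X ⟶ Y) : cofibrations M i → fibrations M p →
    SSet.modelCategoryQuillen.J.rlp (pullbackHom i p)
  trivialFibration {A B X Y : M} (i : A ⟶ B) (p : X ⟶ Y) : cofibrations M i → fibrations M p →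
    (weakEquivalences M i ∨ weakEquivalences M p) →
    SSet.modelCategoryQuillen.I.rlp (pullbackHom i p)

end ModelCategories

/-! ### Groupoids -/

section Groupoids

/-- The groupoid `Δⁿ` with `n + 1` objects and a unique morphism between any two of them. -/
structure SimplexGroupoid (n : ℕ) : Type u where
  vertex : Fin (n + 1)

instance (n : ℕ) : Groupoid.{u} (SimplexGroupoid.{u} n) where
  Hom _ _ := PUnit.{u + 1}
  id _ := PUnit.unit
  comp _ _ := PUnit.unit
  inv _ := PUnit.unit

/-- `Δⁿ` as an object of the category of groupoids. -/
abbrev simplexGrpd (n : ℕ) : Grpd.{u, u} := Grpd.of (SimplexGroupoid.{u} n)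

/-- The functor to `Δⁿ` with given values on objects. -/
def toSimplexGroupoid {A : Type u} [Category.{u} A] {n : ℕ} (f : A → Fin (n + 1)) :
    A ⥤ SimplexGroupoid.{u} n where
  obj a := ⟨f a⟩
  map _ := PUnit.unit

/-- The inclusion `Δ⁰ ⟶ Δ¹` of a vertex. -/
def vertexInclusion : simplexGrpd.{u} 0 ⟶ simplexGrpd.{u} 1 :=
  toSimplexGroupoid (A := SimplexGroupoid.{u} 0) (fun _ ↦ 0)

/-- The maps `∂Δⁱ ⟶ Δⁱ` of groupoids for `i = 0, 1, 2`: the map from the empty groupoid to the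
point, the inclusion of the two objects in `Δ¹`, and the projection `Δ² × Bℤ ⟶ Δ²`, where
`Δ² × Bℤ` is (isomorphic to) the fundamental groupoid of the boundary of the `2`-simplex. -/
def boundaryInclusion : Fin 3 → Arrow Grpd.{u, u} :=
  ![Arrow.mk (X := Grpd.of (Discrete PEmpty.{u + 1})) (Y := simplexGrpd.{u} 0)
      (toSimplexGroupoid (A := Discrete PEmpty.{u + 1}) (fun _ ↦ 0)),
    Arrow.mk (X := Grpd.of (Discrete (ULift.{u} (Fin 2)))) (Y := simplexGrpd.{u} 1)
      (toSimplexGroupoid (A := Discrete (ULift.{u} (Fin 2))) (fun x ↦ x.as.down)),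
    Arrow.mk
      (X := Grpd.of (SimplexGroupoid.{u} 2 × SingleObj (ULift.{u} (Multiplicative ℤ))))
      (Y := simplexGrpd.{u} 2)
      (CategoryTheory.Prod.fst (SimplexGroupoid.{u} 2) (SingleObj (ULift.{u} (Multiplicative ℤ))))]

/-- The weak equivalences of groupoids are the equivalences of categories. -/
def grpdWeakEquivalences : MorphismProperty Grpd.{u, u} :=
  fun G H f ↦ Functor.IsEquivalence (C := G) (D := H) f

/-- The fibrations of groupoids are the functors with the right lifting property with respect to
`Δ⁰ ⟶ Δ¹`. -/
def grpdFibrations : MorphismProperty Grpd.{u, u} :=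
  (MorphismProperty.ofHoms (fun _ : Unit ↦ vertexInclusion.{u})).rlp

end Groupoids

/-! ### Categories fibered in groupoids -/

section FiberedInGroupoids

variable (C : Type u) [SmallCategory C]

/-- A functor `p : E ⥤ C` makes `E` a category fibered in groupoids over `C` if morphisms of `C`
can be lifted to `E` with given target, and if for `f' : Y' ⟶ X'` and `g' : Z' ⟶ X'` in `E`
every factorization of `p f'` through `p g'` lifts uniquely to a factorization of `f'`
through `g'`. -/
structure IsFiberedInGroupoids {C : Type u} [SmallCategory C] {E : Type u} [SmallCategory E]
    (p : E ⥤ C) : Prop where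
  exists_lift {Y : C} (X' : E) (f : Y ⟶ p.obj X') :
    ∃ (Y' : E) (f' : Y' ⟶ X'), p.IsHomLift f f'
  existsUnique_fac {X' Y' Z' : E} (f' : Y' ⟶ X') (g' : Z' ⟶ X') (h : p.obj Y' ⟶ p.obj Z')
    (_ : h ≫ p.map g' = p.map f') : ∃! h' : Y' ⟶ Z', h' ≫ g' = f' ∧ p.map h' = h

/-- `Grpd/C`: the full subcategory of `Cat/C` of categories fibered in groupoids over `C`.
Here `BasedCategory C` is the category of small categories with a functor to `C`, with the functors
(strictly) over `C` as morphisms. -/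
abbrev GrpdOver : Type (u + 1) :=
  ObjectProperty.FullSubcategory
    (fun E : BasedCategory.{u, u} C ↦ IsFiberedInGroupoids E.p)

variable {C}

/-- In a category fibered in groupoids, the morphisms over an identity are isomorphisms. -/
lemma IsFiberedInGroupoids.isIso {E : Type u} [SmallCategory E] {p : E ⥤ C}
    (hp : IsFiberedInGroupoids p) {X : C} {a b : E} (φ : a ⟶ b) (hφ : p.IsHomLift (𝟙 X) φ) :
    IsIso φ := by
  have hiso : IsIso (p.map φ) := by
    rw [IsHomLift.fac' p (𝟙 X) φ]
    infer_instance
  obtain ⟨ψ, ⟨h1, h2⟩, -⟩ := hp.existsUnique_fac (𝟙 b) φ (inv (p.map φ)) (by simp)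
  refine ⟨ψ, ?_, h1⟩
  refine (hp.existsUnique_fac φ φ (𝟙 _) (by simp)).unique ⟨?_, ?_⟩ ⟨by simp, by simp⟩
  · rw [Category.assoc, h1, Category.comp_id]
  · rw [p.map_comp, h2, IsIso.hom_inv_id]

/-- Natural transformations over the identity of `C` between functors to a category fibered in
groupoids are isomorphisms. -/
lemma isIso_basedNatTrans {A : BasedCategory.{u, u} C} {E : GrpdOver C}
    {F G : BasedFunctor A E.obj} (α : F ⟶ G) : IsIso α := by
  have : ∀ a, IsIso (α.toNatTrans.app a) := fun a ↦ E.property.isIso _ (α.isHomLift' a)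
  have : IsIso (C := A.obj ⥤ E.obj.obj) α.toNatTrans := NatIso.isIso_of_isIso_app _
  exact BasedNatIso.isIso_of_toNatTrans_isIso α

/-- The mapping groupoid `Grpd(A, E)` of functors `A ⥤ E` over `C` and natural
transformations over the identity of `C`. -/
noncomputable instance mappingGroupoid (A : BasedCategory.{u, u} C) (E : GrpdOver C) :
    Groupoid.{u} (BasedFunctor A E.obj) :=
  { BasedNatTrans.homCategory A E.obj with
    inv := fun α ↦ haveI := isIso_basedNatTrans α; CategoryTheory.inv α
    inv_comp := fun α ↦ haveI := isIso_basedNatTrans α; IsIso.inv_hom_id α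
    comp_inv := fun α ↦ haveI := isIso_basedNatTrans α; IsIso.hom_inv_id α }

/-- Composition of functors over `C` and of natural transformations between them. -/
def basedCompFunctor (A B D : BasedCategory.{u, u} C) :
    BasedFunctor A B × BasedFunctor B D ⥤ BasedFunctor A D where
  obj F := BasedFunctor.comp F.1 F.2
  map {F G} α := BasedCategory.whiskerRight α.1 F.2 ≫ BasedCategory.whiskerLeft G.1 α.2
  map_id F := by
    apply BasedNatTrans.ext
    apply NatTrans.ext
    funext a
    exact (Category.comp_id _).trans (F.2.toFunctor.map_id _)
  map_comp {F G H} α β := by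
    apply BasedNatTrans.ext
    apply NatTrans.ext
    funext a
    change F.2.map (α.1.toNatTrans.app a ≫ β.1.toNatTrans.app a) ≫
      α.2.toNatTrans.app (H.1.obj a) ≫ β.2.toNatTrans.app (H.1.obj a) =
      (F.2.map (α.1.toNatTrans.app a) ≫ α.2.toNatTrans.app (G.1.obj a)) ≫
      G.2.map (β.1.toNatTrans.app a) ≫ β.2.toNatTrans.app (H.1.obj a)
    simp

lemma basedFunctor_ext {A B : BasedCategory.{u, u} C} {F G : BasedFunctor A B}
    (h : F.toFunctor = G.toFunctor) : F = G := by
  obtain ⟨F, _⟩ := F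
  obtain ⟨G, _⟩ := G
  cases h
  rfl

/-- The slice `C/X` as a category over `C`. -/
abbrev slice (X : C) : BasedCategory.{u, u} C := BasedCategory.ofFunctor (Over.forget X)

/-- The functor `C/X ⥤ C/Y` over `C` given by composition with `f : X ⟶ Y`. -/
abbrev sliceMap {X Y : C} (f : X ⟶ Y) : BasedFunctor (slice X) (slice Y) where
  toFunctor := Over.map f

lemma isFiberedInGroupoids_slice (X : C) : IsFiberedInGroupoids (Over.forget X) where
  exists_lift {Y} X' f := by
    let f' : Over.mk (f ≫ X'.hom) ⟶ X' := Over.homMk f rfl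
    exact ⟨Over.mk (f ≫ X'.hom), f', IsHomLift.map (Over.forget X) f'⟩
  existsUnique_fac {X' Y' Z'} f' g' h w := by
    replace w : (show Y'.left ⟶ Z'.left from h) ≫ g'.left = f'.left := w
    refine ⟨Over.homMk h ?_, ⟨?_, rfl⟩, fun k hk ↦ ?_⟩
    · rw [← Over.w f', ← Over.w g', ← w, Category.assoc]
    · ext
      exact w
    · ext
      exact hk.2

lemma sliceMap_id (X : C) : sliceMap (𝟙 X) = BasedFunctor.id (slice X) := by
  exact basedFunctor_ext (Over.mapId_eq X)

lemma sliceMap_comp {X Y Z : C} (f : X ⟶ Y) (g : Y ⟶ Z) :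
    sliceMap (f ≫ g) = BasedFunctor.comp (sliceMap f) (sliceMap g) := by
  exact basedFunctor_ext (Over.mapComp_eq f g)

/-- Precomposition with a functor over `C`, on mapping groupoids. -/
def precomp {A B : BasedCategory.{u, u} C} (F : BasedFunctor A B) (E : GrpdOver C) :
    BasedFunctor B E.obj ⥤ BasedFunctor A E.obj where
  obj s := BasedFunctor.comp F s
  map α := BasedCategory.whiskerLeft F α
  map_id _ := rfl
  map_comp _ _ := rfl

/-- Postcomposition with a functor over `C`, on mapping groupoids. -/
def postcomp (A : BasedCategory.{u, u} C) {E E' : GrpdOver C} (F : E ⟶ E') :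
    BasedFunctor A E.obj ⥤ BasedFunctor A E'.obj where
  obj s := BasedFunctor.comp s F.hom
  map α := BasedCategory.whiskerRight α F.hom
  map_id _ := BasedNatTrans.ext _ _ (NatTrans.ext (funext fun _ ↦ F.hom.toFunctor.map_id _))
  map_comp _ _ :=
    BasedNatTrans.ext _ _ (NatTrans.ext (funext fun _ ↦ F.hom.toFunctor.map_comp _ _))

lemma isHomLift_fst_comp {E G : Type u} [SmallCategory E] [SmallCategory G] (p : E ⥤ C)
    {X Y : C} {a b : E} (f : X ⟶ Y) (φ : a ⟶ b) (h : p.IsHomLift f φ) (x : G) :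
    (CategoryTheory.Prod.fst E G ⋙ p).IsHomLift f
      ((φ, 𝟙 x) : ((a, x) : E × G) ⟶ (b, x)) :=
  IsHomLift.of_fac _ f _ (IsHomLift.domain_eq p f φ) (IsHomLift.codomain_eq p f φ)
    (IsHomLift.fac p f φ)

/-- The functor `E_X ⥤ E'_X` between the fiber categories over `X` (objects over `X` and morphisms
over `𝟙 X`) induced by a functor over `C`. -/
def fiberFunctor {E E' : GrpdOver C} (F : E ⟶ E') (X : C) :
    E.obj.p.Fiber X ⥤ E'.obj.p.Fiber X :=
  Functor.Fiber.inducedFunctor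
    (F := (Functor.Fiber.fiberInclusion : E.obj.p.Fiber X ⥤ E.obj.obj) ⋙ F.hom.toFunctor)
    (by rw [Functor.assoc, F.hom.w, Functor.Fiber.fiberInclusion_comp_eq_const])

/-- The tensor `E ⊗ G = E ×_C (C × G)` of a category over `C` with a groupoid, that is, the
category `E × G` over `C`. -/
def tensor (E : GrpdOver C) (G : Grpd.{u, u}) : GrpdOver C where
  obj := BasedCategory.ofFunctor (CategoryTheory.Prod.fst E.obj.obj G ⋙ E.obj.p)
  property :=
    { exists_lift := fun X' f ↦ by
        obtain ⟨Y', f', hf⟩ := E.property.exists_lift X'.1 f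
        exact ⟨(Y', X'.2), (f', 𝟙 X'.2), isHomLift_fst_comp E.obj.p f f' hf X'.2⟩
      existsUnique_fac := fun {X' Y' Z'} f' g' h w ↦ by
        obtain ⟨k, ⟨h1, h2⟩, h3⟩ := E.property.existsUnique_fac f'.1 g'.1 h w
        refine ⟨(k, f'.2 ≫ Groupoid.inv g'.2), ⟨?_, h2⟩, ?_⟩
        · refine Prod.ext h1 ?_
          change (f'.2 ≫ Groupoid.inv g'.2) ≫ g'.2 = f'.2
          simp
        · rintro ⟨l, m⟩ ⟨h4, h5⟩
          refine Prod.ext (h3 l ⟨congr_arg Prod.fst h4, h5⟩) ?_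
          have h6 : m ≫ g'.2 = f'.2 := congr_arg Prod.snd h4
          simp [← h6] }

/-- The functor `E ⊗ G ⥤ E ⊗ H` induced by a functor `G ⥤ H`. -/
def tensorMap (E : GrpdOver C) {G H : Grpd.{u, u}} (f : G ⟶ H) : tensor E G ⟶ tensor E H where
  hom :=
    { toFunctor := Functor.prod (𝟭 E.obj.obj) f
      w := rfl }

/-- `C/X` as a category fibered in groupoids over `C`. -/
abbrev sliceGrpdOver (X : C) : GrpdOver C where
  obj := slice X
  property := isFiberedInGroupoids_slice X

variable (C)

/-- The functor `Γ : Grpd/C ⥤ P(C, Grpd)` given by `Γ E (X) = Grpd(C/X, E)`, functorial in `X` by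
precomposition with `C/X ⥤ C/Y` and in `E` by postcomposition. -/
noncomputable def sectionsFunctor : GrpdOver C ⥤ (Cᵒᵖ ⥤ Grpd.{u, u}) where
  obj E :=
    { obj := fun X ↦ Grpd.of (BasedFunctor (slice X.unop) E.obj)
      map := fun f ↦ precomp (sliceMap f.unop) E
      map_id := fun X ↦ by
        rw [unop_id, sliceMap_id]
        rfl
      map_comp := fun f g ↦ by
        rw [unop_comp, sliceMap_comp]
        rfl }
  map F :=
    { app := fun X ↦ postcomp (slice X.unop) F
      naturality := fun _ _ _ ↦ rfl }
  map_id _ := rfl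
  map_comp _ _ := rfl

variable {C}

/-- The category `p F` for a presheaf of groupoids `F`: its objects are the pairs `(X, a)`
with `a ∈ F(X)`. -/
structure TotalCat (F : Cᵒᵖ ⥤ Grpd.{u, u}) : Type u where
  base : C
  fiber : F.obj (op base)

namespace TotalCat

variable {F F' : Cᵒᵖ ⥤ Grpd.{u, u}}

/-- The restriction functor `F(Y) ⥤ F(X)` along `f : X ⟶ Y`. -/
abbrev res (F : Cᵒᵖ ⥤ Grpd.{u, u}) {X Y : C} (f : X ⟶ Y) : F.obj (op Y) ⥤ F.obj (op X) :=
  F.map f.op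

/-- Morphisms `(X, a) ⟶ (Y, b)` in `p F`: pairs of `f : X ⟶ Y` in `C` and a morphism `a ⟶ F(f)(b)`
in `F(X)`. -/
structure Hom (x y : TotalCat F) : Type u where
  base : x.base ⟶ y.base
  fiber : x.fiber ⟶ (res F base).obj y.fiber

lemma res_id_obj {X : C} (a : F.obj (op X)) : (res F (𝟙 X)).obj a = a :=
  Functor.congr_obj (F.map_id (op X)) a

lemma res_comp_obj {X Y Z : C} (f : X ⟶ Y) (g : Y ⟶ Z) (a : F.obj (op Z)) :
    (res F (f ≫ g)).obj a = (res F f).obj ((res F g).obj a) :=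
  Functor.congr_obj (F.map_comp g.op f.op) a

lemma Hom.ext' {x y : TotalCat F} {f g : Hom x y} (h : f.base = g.base)
    (h' : f.fiber ≫ eqToHom (by rw [h]) = g.fiber) : f = g := by
  obtain ⟨f, α⟩ := f
  obtain ⟨g, β⟩ := g
  obtain rfl : f = g := h
  simp at h'
  rw [h']

lemma res_id_map {X : C} {a b : F.obj (op X)} (α : a ⟶ b) :
    (res F (𝟙 X)).map α = eqToHom (res_id_obj a) ≫ α ≫ eqToHom (res_id_obj b).symm :=
  Functor.congr_hom (F.map_id (op X)) α

lemma res_comp_map {X Y Z : C} (f : X ⟶ Y) (g : Y ⟶ Z) {a b : F.obj (op Z)} (α : a ⟶ b) :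
    (res F (f ≫ g)).map α = eqToHom (res_comp_obj f g a) ≫ (res F f).map ((res F g).map α) ≫
      eqToHom (res_comp_obj f g b).symm :=
  Functor.congr_hom (F.map_comp g.op f.op) α

/-- The composition of `(f, α)` and `(g, β)` is `(g ∘ f, F(f)(β) ∘ α)`; the use of `eqToHom` takes
care of the equality `F(g ∘ f)(c) = F(f)(F(g)(c))`. -/
instance : Category.{u} (TotalCat F) where
  Hom := Hom
  id x := ⟨𝟙 x.base, eqToHom (res_id_obj x.fiber).symm⟩
  comp {_ _ z} f g := ⟨f.base ≫ g.base,
    f.fiber ≫ (res F f.base).map g.fiber ≫ eqToHom (res_comp_obj f.base g.base z.fiber).symm⟩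
  id_comp f := Hom.ext' (Category.id_comp _) (by simp [res_id_map])
  comp_id f := Hom.ext' (Category.comp_id _) (by simp [eqToHom_map])
  assoc f g h := Hom.ext' (Category.assoc _ _ _) (by simp [res_comp_map, eqToHom_map])

lemma id_fiber (x : TotalCat F) :
    Hom.fiber (𝟙 x : x ⟶ x) = eqToHom (res_id_obj x.fiber).symm := rfl

lemma comp_fiber {x y z : TotalCat F} (f : x ⟶ y) (g : y ⟶ z) :
    Hom.fiber (f ≫ g) = Hom.fiber f ≫ (res F (Hom.base f)).map (Hom.fiber g) ≫
      eqToHom (res_comp_obj (Hom.base f) (Hom.base g) z.fiber).symm := rfl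

variable (F) in
/-- The projection `p F ⥤ C`. -/
@[simps]
def proj : TotalCat F ⥤ C where
  obj x := x.base
  map f := f.base

/-- The functor `F(X) ⥤ F'(X)` underlying a morphism `φ : F ⟶ F'`. -/
abbrev app (φ : F ⟶ F') (X : C) : F.obj (op X) ⥤ F'.obj (op X) := φ.app (op X)

lemma app_res_obj (φ : F ⟶ F') {X Y : C} (f : X ⟶ Y) (a : F.obj (op Y)) :
    (app φ X).obj ((res F f).obj a) = (res F' f).obj ((app φ Y).obj a) :=
  Functor.congr_obj (φ.naturality f.op) a

lemma app_res_map (φ : F ⟶ F') {X Y : C} (f : X ⟶ Y) {a b : F.obj (op Y)} (α : a ⟶ b) :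
    (app φ X).map ((res F f).map α) = eqToHom (app_res_obj φ f a) ≫
      (res F' f).map ((app φ Y).map α) ≫ eqToHom (app_res_obj φ f b).symm :=
  Functor.congr_hom (φ.naturality f.op) α

/-- The functor `p F ⥤ p F'` induced by a morphism `φ : F ⟶ F'`. -/
def map (φ : F ⟶ F') : TotalCat F ⥤ TotalCat F' where
  obj x := ⟨x.base, (app φ x.base).obj x.fiber⟩
  map {x y} f := ⟨f.base,
    (app φ x.base).map f.fiber ≫ eqToHom (app_res_obj φ f.base y.fiber)⟩
  map_id x := Hom.ext' rfl (by simp [id_fiber, eqToHom_map])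
  map_comp f g := Hom.ext' rfl (by simp [comp_fiber, app_res_map, eqToHom_map])

lemma map_comp_fiber {F'' : Cᵒᵖ ⥤ Grpd.{u, u}} (φ : F ⟶ F') (ψ : F' ⟶ F'') {x y : TotalCat F}
    (f : x ⟶ y) : Hom.fiber ((map (φ ≫ ψ)).map f) ≫ eqToHom rfl =
      Hom.fiber ((map ψ).map ((map φ).map f)) := by
  refine (Category.comp_id _).trans ?_
  change _ =
    (app ψ x.base).map ((app φ x.base).map f.fiber ≫ eqToHom (app_res_obj φ f.base y.fiber)) ≫
      eqToHom (app_res_obj ψ f.base _)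
  rw [Functor.map_comp, eqToHom_map, Category.assoc, eqToHom_trans]
  rfl

lemma comp_map_eqToHom_eq_iff {G H : Type u} [Groupoid.{u} G] [Groupoid.{u} H] (R : G ⥤ H)
    {a b : H} {c d : G} (β : c ⟶ d) (e : R.obj d = b) (δ : a ⟶ R.obj c) (α : a ⟶ b) :
    δ ≫ R.map β ≫ eqToHom e = α ↔ δ = α ≫ eqToHom e.symm ≫ R.map (Groupoid.inv β) := by
  subst e
  constructor
  · rintro rfl
    simp
  · rintro rfl
    simp

lemma isFiberedInGroupoids_proj (F : Cᵒᵖ ⥤ Grpd.{u, u}) : IsFiberedInGroupoids (proj F) where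
  exists_lift {Y} x f := by
    let f' : (⟨Y, (res F f).obj x.fiber⟩ : TotalCat F) ⟶ x := ⟨f, 𝟙 _⟩
    exact ⟨_, f', IsHomLift.map (proj F) f'⟩
  existsUnique_fac {x y z} f g h w := by
    obtain ⟨f, α⟩ := f
    obtain ⟨g, β⟩ := g
    obtain rfl : h ≫ g = f := w
    refine ⟨⟨h, α ≫ eqToHom (res_comp_obj h g x.fiber) ≫ (res F h).map (Groupoid.inv β)⟩,
      ⟨Hom.ext' rfl ?_, rfl⟩, ?_⟩
    · exact (Category.comp_id _).trans
        ((comp_map_eqToHom_eq_iff (res F h) β (res_comp_obj h g x.fiber).symm _ α).2 rfl)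
    · rintro ⟨k, δ⟩ ⟨h1, rfl⟩
      exact Hom.ext' rfl ((Category.comp_id _).trans
        ((comp_map_eqToHom_eq_iff (res F k) β (res_comp_obj k g x.fiber).symm δ α).1
          (eq_of_heq (Hom.mk.inj h1).2)))

end TotalCat

variable (C) in
/-- The functor `p : P(C, Grpd) ⥤ Grpd/C` which sends `F` to `p F`. -/
def totalFunctor : (Cᵒᵖ ⥤ Grpd.{u, u}) ⥤ GrpdOver C where
  obj F :=
    { obj := BasedCategory.ofFunctor (TotalCat.proj F)
      property := TotalCat.isFiberedInGroupoids_proj F }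
  map {F F'} φ :=
    { hom :=
      { toFunctor := TotalCat.map φ
        w := rfl } }
  map_id F := by
    apply InducedCategory.hom_ext
    exact basedFunctor_ext (Functor.hext (fun _ ↦ rfl) fun _ _ _ ↦
      heq_of_eq (TotalCat.Hom.ext' rfl
        ((Category.comp_id _).trans (Category.comp_id _))))
  map_comp φ ψ := by
    apply InducedCategory.hom_ext
    exact basedFunctor_ext (Functor.hext (fun _ ↦ rfl) fun _ _ _ ↦
      heq_of_eq (TotalCat.Hom.ext' rfl (TotalCat.map_comp_fiber φ ψ _)))

/-- Precomposition with `f : Z ⟶ Y`, as a functor between discrete groupoids of morphisms. -/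
def discretePrecomp (X : C) {Y Z : C} (f : Z ⟶ Y) : Discrete (Y ⟶ X) ⥤ Discrete (Z ⟶ X) :=
  Discrete.functor fun g ↦ Discrete.mk (f ≫ g)

lemma discretePrecomp_id (X Y : C) : discretePrecomp X (𝟙 Y) = 𝟭 _ :=
  CategoryTheory.Functor.ext (fun x ↦ Discrete.ext (Category.id_comp x.as))
    fun _ _ _ ↦ Subsingleton.elim _ _

lemma discretePrecomp_comp (X : C) {Y Z W : C} (f : Z ⟶ Y) (g : W ⟶ Z) :
    discretePrecomp X (g ≫ f) = discretePrecomp X f ⋙ discretePrecomp X g :=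
  CategoryTheory.Functor.ext (fun x ↦ Discrete.ext (Category.assoc g f x.as))
    fun _ _ _ ↦ Subsingleton.elim _ _

/-- The tensor `X ⊗ G` of a representable presheaf `X`, considered as a presheaf of discrete
groupoids, with a groupoid `G`: its value at `Y` is `Hom(Y, X) × G`. -/
def yonedaTensor (X : C) (G : Grpd.{u, u}) : Cᵒᵖ ⥤ Grpd.{u, u} where
  obj Y := Grpd.of (Discrete (Y.unop ⟶ X) × G)
  map f := Functor.prod (discretePrecomp X f.unop) (𝟭 G)
  map_id Y := by
    rw [unop_id, discretePrecomp_id]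
    rfl
  map_comp f g := by
    rw [unop_comp, discretePrecomp_comp]
    rfl

/-- The morphism `X ⊗ G ⟶ X ⊗ H` induced by a functor `G ⥤ H`. -/
def yonedaTensorMap (X : C) {G H : Grpd.{u, u}} (f : G ⟶ H) :
    yonedaTensor X G ⟶ yonedaTensor X H where
  app Y := Functor.prod (𝟭 (Discrete (Y.unop ⟶ X))) f
  naturality _ _ _ := rfl

/-- Composition of simplices of mapping groupoids. -/
def nerveComp (A B D : BasedCategory.{u, u} C) :
    nerve (BasedFunctor A B) ⊗ nerve (BasedFunctor B D) ⟶ nerve (BasedFunctor A D) where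
  app _ := ↾fun x ↦ Functor.prod' x.1 x.2 ⋙ basedCompFunctor A B D
  naturality _ _ _ := rfl

/-- The map of simplicial sets from a point which is given by an object of a category. -/
def nervePoint {A : Type u} [SmallCategory A] (a : A) : 𝟙_ SSet.{u} ⟶ nerve A where
  app Δ := ↾fun _ ↦ (Functor.const (Fin (Δ.unop.len + 1))).obj a
  naturality _ _ _ := rfl

/-- The simplicial category structure on `Grpd/C`: the simplicial set of maps from `E` to `E'` is
the nerve of the mapping groupoid `Grpd(E, E')`. -/
instance : SimplicialCategory (GrpdOver C) where
  Hom E E' := nerve (BasedFunctor E.obj E'.obj)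
  id E := nervePoint (BasedFunctor.id E.obj)
  comp E E' E'' := nerveComp E.obj E'.obj E''.obj
  id_comp E E' := by
    ext Δ x
    refine CategoryTheory.Functor.hext (fun i ↦ rfl) fun i j k ↦ heq_of_eq ?_
    apply BasedNatTrans.ext
    apply NatTrans.ext
    funext a
    change (x.obj i).map (𝟙 a) ≫ (x.map k).toNatTrans.app a = (x.map k).toNatTrans.app a
    simp
  comp_id E E' := by
    ext Δ x
    refine CategoryTheory.Functor.hext (fun i ↦ rfl) fun i j k ↦ heq_of_eq ?_
    apply BasedNatTrans.ext
    apply NatTrans.ext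
    funext a
    exact Category.comp_id _
  assoc E₁ E₂ E₃ E₄ := by
    ext Δ x
    refine CategoryTheory.Functor.hext (fun i ↦ rfl) fun i j k ↦ heq_of_eq ?_
    apply BasedNatTrans.ext
    apply NatTrans.ext
    funext a
    change (x.2.2.obj i).map ((x.2.1.obj i).map ((x.1.map k).toNatTrans.app a) ≫
        (x.2.1.map k).toNatTrans.app ((x.1.obj j).obj a)) ≫
        (x.2.2.map k).toNatTrans.app ((x.2.1.obj j).obj ((x.1.obj j).obj a)) =
      (x.2.2.obj i).map ((x.2.1.obj i).map ((x.1.map k).toNatTrans.app a)) ≫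
        (x.2.2.obj i).map ((x.2.1.map k).toNatTrans.app ((x.1.obj j).obj a)) ≫
          (x.2.2.map k).toNatTrans.app ((x.2.1.obj j).obj ((x.1.obj j).obj a))
    exact (congrArg (· ≫ _) (Functor.map_comp _ _ _)).trans (Category.assoc _ _ _)
  homEquiv {E E'} :=
    { toFun := fun f ↦ nervePoint f.hom
      invFun := fun g ↦ ⟨(g.app (op (SimplexCategory.mk 0)) PUnit.unit).obj 0⟩
      left_inv := fun f ↦ rfl
      right_inv := fun g ↦ by
        ext Δ ⟨⟩
        have h := congr($(g.naturality (SimplexCategory.const Δ.unop (SimplexCategory.mk 0) 0).op)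
          PUnit.unit)
        refine Eq.trans ?_ h.symm
        refine CategoryTheory.Functor.hext (fun i ↦ rfl) fun i j k ↦ heq_of_eq ?_
        exact ((g.app (op (SimplexCategory.mk 0)) PUnit.unit).map_id 0).symm }
  homEquiv_id _ := rfl
  homEquiv_comp f g := by
    ext Δ x
    refine CategoryTheory.Functor.hext (fun i ↦ rfl) fun i j k ↦ heq_of_eq ?_
    apply BasedNatTrans.ext
    apply NatTrans.ext
    funext a
    change 𝟙 (g.hom.obj (f.hom.obj a)) = g.hom.map (𝟙 (f.hom.obj a)) ≫ 𝟙 _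
    simp

variable (C)

/-- Weak equivalences of `Grpd/C`: the functors over `C` which induce equivalences between all
fibers. -/
def fiberwiseEquivalences : MorphismProperty (GrpdOver C) :=
  fun _ _ F ↦ ∀ X : C, (fiberFunctor F X).IsEquivalence

/-- Maps `F` in `Grpd/C` such that `Grpd(C/X, F)` has the property `W` for all `X`. -/
def sectionwise (W : MorphismProperty Grpd.{u, u}) : MorphismProperty (GrpdOver C) :=
  fun _ _ F ↦ ∀ X : C, W (((sectionsFunctor C).map F).app (op X))

/-- Maps `φ` of presheaves of groupoids such that `φ(X)` has the property `W` for all `X`. -/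
def objectwise (W : MorphismProperty Grpd.{u, u}) : MorphismProperty (Cᵒᵖ ⥤ Grpd.{u, u}) :=
  fun _ _ φ ↦ ∀ X : C, W (φ.app (op X))

/-- The maps `C/X ⊗ ∂Δⁱ ⟶ C/X ⊗ Δⁱ` for `X` in `C` and `i = 0, 1, 2`. -/
def fiberedGeneratingCofibrations : MorphismProperty (GrpdOver C) :=
  MorphismProperty.ofHoms fun j : C × Fin 3 ↦
    tensorMap (sliceGrpdOver j.1) (boundaryInclusion.{u} j.2).hom

/-- The maps `C/X = C/X ⊗ Δ⁰ ⟶ C/X ⊗ Δ¹` for `X` in `C`. -/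
def fiberedGeneratingTrivialCofibrations : MorphismProperty (GrpdOver C) :=
  MorphismProperty.ofHoms fun X : C ↦ tensorMap (sliceGrpdOver X) vertexInclusion.{u}

/-- The maps `X ⊗ ∂Δⁱ ⟶ X ⊗ Δⁱ` for `X` in `C` and `i = 0, 1, 2`. -/
def presheafGeneratingCofibrations : MorphismProperty (Cᵒᵖ ⥤ Grpd.{u, u}) :=
  MorphismProperty.ofHoms fun j : C × Fin 3 ↦ yonedaTensorMap j.1 (boundaryInclusion.{u} j.2).hom

/-- The maps `X = X ⊗ Δ⁰ ⟶ X ⊗ Δ¹` for `X` in `C`. -/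
def presheafGeneratingTrivialCofibrations : MorphismProperty (Cᵒᵖ ⥤ Grpd.{u, u}) :=
  MorphismProperty.ofHoms fun X : C ↦ yonedaTensorMap X vertexInclusion.{u}

end FiberedInGroupoids

/-! Both model structures are transferred from groupoids. There the trivial fibrations are the fully
faithful functors that are surjective on objects, and lifting against the maps `∂Δⁱ → Δⁱ` detects
them: `i = 0` gives surjectivity on objects, `i = 1` fullness and `i = 2` faithfulness
(`boundaryInclusion_rlp_iff`). Sections over `C/X` and evaluation at `X` have the left adjoints `G ↦
C/X ⊗ G` and `G ↦ X ⊗ G` (`tensorAdjunction`, `yonedaTensorAdjunction`), which carry the generating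
maps over, and the small object argument gives the factorizations. By `exists_detectedModelCategory`
it remains to see that maps with the left lifting property with respect to fibrations are weak
equivalences. Over `C` this is Quillen's path object argument (`llp_detectedFibrations_le`): all
objects are fibrant, and the vertical arrows of `E` are the objects of a path object, so such a map
is a homotopy equivalence. For presheaves the claim is deduced from the one over `C` by means of
`p`.

The comparison rests on the 2-Yoneda lemma: evaluation at the identity of `X` is an equivalence from
sections of `E` over `C/X` to the fiber `E_X` (`evalSlice`). Hence sectionwise equivalences are
fiberwise equivalences, and the unit `F → Γ p F` is an objectwise equivalence because `F(X) → (p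
F)_X` is one (`objectwise_unitHom`). So `p` preserves and reflects weak equivalences, and `Γ` does
so by definition of the weak equivalences. This gives the Quillen equivalence.

For left properness over `C`, an equivalence has a homotopy inverse whose two homotopies are
compatible with each other. Homotopies extend along cofibrations because the source map of the path
object is a trivial fibration, so a homotopy inverse of the pushout can be glued together
(`sectionwise_grpdWeakEquivalences_of_isPushout`). For presheaves the statement is pulled back along
`p`.

For the simplicial structure, nerves of groupoids see a simplicial set only through its fundamental
groupoid, so tensors and cotensors with groupoids suffice. Lifting problems for `pullbackHom` are
problems about functors between mapping groupoids: these are fully faithful in the trivial case, and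
lift arrows in general because cofibrations are injective on objects.

Limits and colimits are the remaining point, since categories fibered in groupoids are not closed
under limits of categories over `C`. A limit consists of those compatible families of objects for
which iterated compatible lifts exist; colimits follow from the adjoint functor theorem. In these
constructions categories are handled through their sets of arrows, which avoids transport along
equalities of objects. -/

/-! ### Categories in terms of their arrows -/

section Arrows

/-- The type of all arrows of a category. -/
structure Arr (E : Type w) [Category.{v} E] : Type (max w v) where
  {src tgt : E}
  hom : src ⟶ tgt

namespace Arr

variable {E : Type*} [Category* E] {D : Type*} [Category* D] {D' : Type*} [Category* D']

/-- The identity arrow of an object. -/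
def id (x : E) : Arr E := ⟨𝟙 x⟩

/-- `IsComp f g h` holds if `f` and `g` are composable, with composition `h`. -/
inductive IsComp : Arr E → Arr E → Arr E → Prop
  | mk {x y z : E} (f : x ⟶ y) (g : y ⟶ z) : IsComp ⟨f⟩ ⟨g⟩ ⟨f ≫ g⟩

lemma mk_inj {x y : E} {f g : x ⟶ y} : (⟨f⟩ : Arr E) = ⟨g⟩ ↔ f = g := by simp

lemma id_inj {x y : E} (h : Arr.id x = Arr.id y) : x = y := congrArg Arr.src h

lemma exists_eq_mk (f : Arr E) {x y : E} (hx : f.src = x) (hy : f.tgt = y) :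
    ∃ φ : x ⟶ y, f = ⟨φ⟩ := by
  obtain ⟨f⟩ := f
  subst hx hy
  exact ⟨f, rfl⟩

lemma isComp_mk {x y z : E} (f : x ⟶ y) (g : y ⟶ z) (h : x ⟶ z) :
    IsComp ⟨f⟩ ⟨g⟩ ⟨h⟩ ↔ f ≫ g = h := by
  constructor
  · generalize hf : (⟨f⟩ : Arr E) = f', hg : (⟨g⟩ : Arr E) = g', hh : (⟨h⟩ : Arr E) = h'
    rintro ⟨f', g'⟩
    simp only [Arr.mk.injEq] at hf hg hh
    obtain ⟨rfl, rfl, hf⟩ := hf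
    obtain ⟨-, rfl, hg⟩ := hg
    obtain ⟨-, -, hh⟩ := hh
    cases hf
    cases hg
    cases hh
    rfl
  · rintro rfl
    exact .mk f g

lemma IsComp.tgt_eq_src {f g h : Arr E} (H : IsComp f g h) : f.tgt = g.src := by
  cases H; rfl

lemma IsComp.src_eq {f g h : Arr E} (H : IsComp f g h) : h.src = f.src := by
  cases H; rfl

lemma IsComp.tgt_eq {f g h : Arr E} (H : IsComp f g h) : h.tgt = g.tgt := by
  cases H; rfl

lemma exists_isComp {f g : Arr E} (H : f.tgt = g.src) : ∃ h, IsComp f g h := by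
  obtain ⟨f⟩ := f
  obtain ⟨g⟩ := g
  dsimp only at H
  subst H
  exact ⟨_, .mk f g⟩

lemma IsComp.unique {f g h h' : Arr E} (H : IsComp f g h) (H' : IsComp f g h') : h = h' := by
  cases H
  obtain ⟨h'⟩ := h'
  obtain rfl := H'.src_eq
  obtain rfl := H'.tgt_eq
  rw [isComp_mk] at H'
  rw [H']

lemma id_isComp (f : Arr E) : IsComp (Arr.id f.src) f f := (isComp_mk _ _ _).2 (Category.id_comp _)

lemma isComp_id (f : Arr E) : IsComp f (Arr.id f.tgt) f := (isComp_mk _ _ _).2 (Category.comp_id _)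

lemma IsComp.assoc {a b c ab bc x : Arr E} (h₁ : IsComp a b ab) (h₂ : IsComp b c bc)
    (h₃ : IsComp ab c x) : IsComp a bc x := by
  obtain ⟨a, b⟩ := h₁
  obtain ⟨c⟩ := c
  obtain rfl := h₂.tgt_eq_src
  obtain ⟨bc⟩ := bc
  obtain rfl := h₂.src_eq
  obtain rfl := h₂.tgt_eq
  obtain ⟨x⟩ := x
  obtain rfl := h₃.src_eq
  obtain rfl := h₃.tgt_eq
  rw [isComp_mk] at h₂ h₃ ⊢
  rw [← h₂, ← h₃, Category.assoc]

/-- The map on arrows induced by a functor. -/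
def map (F : E ⥤ D) (f : Arr E) : Arr D := ⟨F.map f.hom⟩

@[simp] lemma map_src (F : E ⥤ D) (f : Arr E) : (map F f).src = F.obj f.src := rfl
@[simp] lemma map_tgt (F : E ⥤ D) (f : Arr E) : (map F f).tgt = F.obj f.tgt := rfl
@[simp] lemma id_src (x : E) : (Arr.id x).src = x := rfl
@[simp] lemma id_tgt (x : E) : (Arr.id x).tgt = x := rfl

@[simp]
lemma map_id (F : E ⥤ D) (x : E) : map F (Arr.id x) = Arr.id (F.obj x) := by
  simp [map, Arr.id]

lemma map_comp (F : E ⥤ D) (G : D ⥤ D') (f : Arr E) : map (F ⋙ G) f = map G (map F f) := rfl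

lemma IsComp.map {f g h : Arr E} (H : IsComp f g h) (F : E ⥤ D) :
    IsComp (map F f) (map F g) (map F h) := by
  obtain ⟨f, g⟩ := H
  exact (isComp_mk _ _ _).2 (F.map_comp f g).symm

/-- Source and target of the image are part of the data being compared, so functors can be shown
equal without any `eqToHom`. -/
lemma functor_ext {F G : E ⥤ D} (h : ∀ f, map F f = map G f) : F = G := by
  have hobj (x : E) : F.obj x = G.obj x := congrArg Arr.src (h (Arr.id x))
  refine Functor.hext hobj fun x y f ↦ ?_
  have := h ⟨f⟩
  simp only [map, Arr.mk.injEq] at this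
  exact this.2.2

section OfArr

variable (φ : Arr E → Arr D) (hid : ∀ x, φ (Arr.id x) = Arr.id (φ (Arr.id x)).src)
  (hcomp : ∀ {f g h}, IsComp f g h → IsComp (φ f) (φ g) (φ h))

include hid hcomp

lemma src_of_preserves (f : Arr E) : (φ f).src = (φ (Arr.id f.src)).src := by
  have h := (hcomp (id_isComp f)).tgt_eq_src
  rw [hid] at h
  exact h.symm

omit hid in
lemma tgt_of_preserves (f : Arr E) : (φ f).tgt = (φ (Arr.id f.tgt)).src :=
  (hcomp (isComp_id f)).tgt_eq_src

lemma exists_hom {x y : E} (f : x ⟶ y) :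
    ∃ ψ : (φ (Arr.id x)).src ⟶ (φ (Arr.id y)).src, φ ⟨f⟩ = ⟨ψ⟩ :=
  exists_eq_mk _ (src_of_preserves φ hid hcomp ⟨f⟩) (tgt_of_preserves φ hcomp ⟨f⟩)

/-- The functor given by a map on arrows which preserves identities and compositions. -/
noncomputable def ofArr : E ⥤ D where
  obj x := (φ (Arr.id x)).src
  map f := (exists_hom φ hid hcomp f).choose
  map_id x := by
    rw [← mk_inj, ← (exists_hom φ hid hcomp (𝟙 x)).choose_spec]
    exact hid x
  map_comp f g := by
    have h := hcomp (.mk f g)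
    rw [(exists_hom φ hid hcomp f).choose_spec, (exists_hom φ hid hcomp g).choose_spec,
      (exists_hom φ hid hcomp (f ≫ g)).choose_spec, isComp_mk] at h
    exact h.symm

lemma map_ofArr (f : Arr E) : map (ofArr φ hid hcomp) f = φ f :=
  (exists_hom φ hid hcomp f.hom).choose_spec.symm

end OfArr

end Arr

variable {C : Type u} [SmallCategory C]

/-- With the next two lemmas, this translates the two axioms to and from statements about arrows
only, in which neither `IsHomLift` nor typed composition occurs. -/
lemma IsFiberedInGroupoids.exists_arr {E : Type u} [SmallCategory E] {p : E ⥤ C}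
    (hp : IsFiberedInGroupoids p) (x : E) (f : Arr C) (h : f.tgt = p.obj x) :
    ∃ b : Arr E, b.tgt = x ∧ Arr.map p b = f := by
  obtain ⟨f⟩ := f
  dsimp only at h
  subst h
  obtain ⟨y, g, hg⟩ := hp.exists_lift x f
  refine ⟨⟨g⟩, rfl, ?_⟩
  rw [IsHomLift.fac p f g]
  obtain rfl := IsHomLift.domain_eq p f g
  simp [Arr.map]

lemma IsFiberedInGroupoids.existsUnique_arr {E : Type u} [SmallCategory E] {p : E ⥤ C}
    (hp : IsFiberedInGroupoids p) (f g : Arr E) (hfg : f.tgt = g.tgt) (h : Arr C)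
    (H : Arr.IsComp h (Arr.map p g) (Arr.map p f)) :
    ∃! k : Arr E, Arr.IsComp k g f ∧ Arr.map p k = h := by
  obtain ⟨f⟩ := f
  obtain ⟨g⟩ := g
  dsimp only at hfg
  subst hfg
  obtain ⟨h, rfl⟩ := Arr.exists_eq_mk h H.src_eq.symm H.tgt_eq_src
  erw [Arr.isComp_mk] at H
  obtain ⟨k, ⟨h₁, h₂⟩, h₃⟩ := hp.existsUnique_fac f g h H
  refine ⟨⟨k⟩, ⟨(Arr.isComp_mk _ _ _).2 h₁, Arr.mk_inj.2 h₂⟩, ?_⟩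
  rintro ⟨l⟩ ⟨h₄, h₅⟩
  obtain rfl := h₄.src_eq
  obtain rfl := h₄.tgt_eq_src
  rw [Arr.isComp_mk] at h₄
  rw [h₃ l ⟨h₄, Arr.mk_inj.1 h₅⟩]

lemma IsFiberedInGroupoids.of_arr {E : Type u} [SmallCategory E] {p : E ⥤ C}
    (h₁ : ∀ (x : E) (f : Arr C), f.tgt = p.obj x → ∃ b : Arr E, b.tgt = x ∧ Arr.map p b = f)
    (h₂ : ∀ (f g : Arr E), f.tgt = g.tgt → ∀ (h : Arr C),
      Arr.IsComp h (Arr.map p g) (Arr.map p f) →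
      ∃! k : Arr E, Arr.IsComp k g f ∧ Arr.map p k = h) : IsFiberedInGroupoids p where
  exists_lift {Y} x f := by
    obtain ⟨⟨b⟩, rfl, hb⟩ := h₁ x ⟨f⟩ rfl
    simp only [Arr.map, Arr.mk.injEq] at hb
    obtain ⟨rfl, -, hb⟩ := hb
    cases hb
    exact ⟨_, b, .map b⟩
  existsUnique_fac {x y z} f g h w := by
    obtain ⟨⟨k⟩, ⟨H, h₃⟩, h₄⟩ := h₂ ⟨f⟩ ⟨g⟩ rfl ⟨h⟩ ((Arr.isComp_mk _ _ _).2 w)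
    obtain rfl := H.src_eq
    obtain rfl := H.tgt_eq_src
    exact ⟨k, ⟨(Arr.isComp_mk _ _ _).1 H, Arr.mk_inj.1 h₃⟩, fun l hl ↦
      Arr.mk_inj.1 (h₄ ⟨l⟩ ⟨(Arr.isComp_mk _ _ _).2 hl.1, Arr.mk_inj.2 hl.2⟩)⟩

namespace GrpdOver

/-- The arrow of `C` below an arrow of a category over `C`. -/
abbrev base {E : GrpdOver C} (f : Arr E.obj.obj) : Arr C := Arr.map E.obj.p f

/-- The map on arrows induced by a morphism of categories over `C`. -/
abbrev arrMap {E E' : GrpdOver C} (F : E ⟶ E') (f : Arr E.obj.obj) : Arr E'.obj.obj :=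
  Arr.map F.hom.toFunctor f

lemma base_arrMap {E E' : GrpdOver C} (F : E ⟶ E') (f : Arr E.obj.obj) :
    base (arrMap F f) = base f := by
  change Arr.map (F.hom.toFunctor ⋙ E'.obj.p) f = _
  rw [F.hom.w]

lemma arrMap_comp {E E' E'' : GrpdOver C} (F : E ⟶ E') (G : E' ⟶ E'') (f : Arr E.obj.obj) :
    arrMap (F ≫ G) f = arrMap G (arrMap F f) := rfl

lemma hom_ext {E E' : GrpdOver C} {F G : E ⟶ E'} (h : ∀ f, arrMap F f = arrMap G f) : F = G := by
  apply InducedCategory.hom_ext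
  exact basedFunctor_ext (Arr.functor_ext h)

/-- A morphism of categories over `C`, given by its action on arrows. -/
noncomputable def homOfArr {E E' : GrpdOver C} (φ : Arr E.obj.obj → Arr E'.obj.obj)
    (hid : ∀ x, φ (Arr.id x) = Arr.id (φ (Arr.id x)).src)
    (hcomp : ∀ {f g h}, Arr.IsComp f g h → Arr.IsComp (φ f) (φ g) (φ h))
    (hbase : ∀ f, base (φ f) = base f) : E ⟶ E' where
  hom :=
    { toFunctor := Arr.ofArr φ hid hcomp
      w := Arr.functor_ext fun f ↦ by
        rw [Arr.map_comp, Arr.map_ofArr]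
        exact hbase f }

lemma arrMap_homOfArr {E E' : GrpdOver C} (φ : Arr E.obj.obj → Arr E'.obj.obj) (hid hcomp hbase)
    (f : Arr E.obj.obj) : arrMap (homOfArr φ hid hcomp hbase) f = φ f :=
  Arr.map_ofArr φ hid hcomp f

end GrpdOver

variable (C) in
/-- A category fibered in groupoids over `C`, described by its set of arrows, with the identity
arrows of the sources and targets of arrows, and the composition as a ternary relation. -/
structure ArrData where
  A : Type u
  s : A → A
  t : A → A
  R : A → A → A → Prop
  p : A → Arr C
  s_s (a : A) : s (s a) = s a
  t_s (a : A) : t (s a) = s a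
  s_t (a : A) : s (t a) = t a
  exists_comp (a b : A) : t a = s b → ∃ c, R a b c
  t_eq_s {a b c : A} : R a b c → t a = s b
  comp_unique {a b c c' : A} : R a b c → R a b c' → c = c'
  s_comp {a b c : A} : R a b c → s c = s a
  t_comp {a b c : A} : R a b c → t c = t b
  id_comp (a : A) : R (s a) a a
  comp_id (a : A) : R a (t a) a
  assoc {a b c ab bc x : A} : R a b ab → R b c bc → R ab c x → R a bc x
  p_s (a : A) : p (s a) = Arr.id (p a).src
  p_comp {a b c : A} : R a b c → Arr.IsComp (p a) (p b) (p c)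
  exists_lift (a : A) (f : Arr C) : s a = a → f.tgt = (p a).src → ∃ b, t b = a ∧ p b = f
  existsUnique_fac (a b : A) (f : Arr C) : t a = t b → Arr.IsComp f (p b) (p a) →
    ∃! c, R c b a ∧ p c = f

namespace ArrData

variable (D : ArrData C)

/-- The objects: the identity arrows. -/
structure Obj : Type u where
  val : D.A
  s_eq : D.s val = val

variable {D}

/-- The arrows with given source and target. -/
@[ext]
structure Hom (x y : D.Obj) : Type u where
  val : D.A
  s_eq : D.s val = x.val
  t_eq : D.t val = y.val

lemma Obj.t_eq (x : D.Obj) : D.t x.val = x.val := by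
  rw [← x.s_eq, D.t_s]

lemma exists_homComp {x y z : D.Obj} (f : Hom x y) (g : Hom y z) :
    ∃ h : Hom x z, D.R f.val g.val h.val := by
  obtain ⟨c, hc⟩ := D.exists_comp f.val g.val (f.t_eq.trans g.s_eq.symm)
  exact ⟨⟨c, (D.s_comp hc).trans f.s_eq, (D.t_comp hc).trans g.t_eq⟩, hc⟩

noncomputable instance : Category.{u} D.Obj where
  Hom := Hom
  id x := ⟨x.val, x.s_eq, x.t_eq⟩
  comp f g := (exists_homComp f g).choose
  id_comp {x y} f := Hom.ext (D.comp_unique (exists_homComp _ _).choose_spec (by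
    have := D.id_comp f.val
    rwa [f.s_eq] at this))
  comp_id {x y} f := Hom.ext (D.comp_unique (exists_homComp _ _).choose_spec (by
    have := D.comp_id f.val
    rwa [f.t_eq] at this))
  assoc f g h := Hom.ext (D.comp_unique (D.assoc (exists_homComp f g).choose_spec
    (exists_homComp g h).choose_spec (exists_homComp _ h).choose_spec)
    (exists_homComp f _).choose_spec)

lemma comp_spec {x y z : D.Obj} (f : x ⟶ y) (g : y ⟶ z) :
    D.R (Hom.val f) (Hom.val g) (Hom.val (f ≫ g)) :=
  (exists_homComp f g).choose_spec

variable (D) in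
/-- The arrows of the category given by `D`. -/
def equiv : Arr D.Obj ≃ D.A where
  toFun f := Hom.val f.hom
  invFun a := ⟨(⟨a, rfl, rfl⟩ : Hom ⟨D.s a, D.s_s a⟩ ⟨D.t a, D.s_t a⟩)⟩
  left_inv := by
    rintro ⟨f⟩
    rename_i x y
    obtain ⟨x, hx⟩ := x
    obtain ⟨y, hy⟩ := y
    obtain ⟨f, h₁, h₂⟩ := f
    dsimp only at h₁ h₂
    subst h₁ h₂
    rfl
  right_inv a := rfl

lemma equiv_id (x : D.Obj) : D.equiv (Arr.id x) = x.val := rfl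

lemma s_equiv (f : Arr D.Obj) : D.s (D.equiv f) = f.src.val := Hom.s_eq f.hom

lemma t_equiv (f : Arr D.Obj) : D.t (D.equiv f) = f.tgt.val := Hom.t_eq f.hom

lemma equiv_src (f : Arr D.Obj) : D.equiv (Arr.id f.src) = D.s (D.equiv f) := (s_equiv f).symm

lemma Obj.ext' {x y : D.Obj} (h : x.val = y.val) : x = y := by
  obtain ⟨x, _⟩ := x
  obtain ⟨y, _⟩ := y
  dsimp only at h
  subst h
  rfl

lemma isComp_iff (f g h : Arr D.Obj) :
    Arr.IsComp f g h ↔ D.R (D.equiv f) (D.equiv g) (D.equiv h) := by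
  constructor
  · rintro ⟨f, g⟩
    exact comp_spec f g
  · intro H
    obtain ⟨h', hh'⟩ := Arr.exists_isComp (f := f) (g := g) (Obj.ext' (by
      rw [← t_equiv, ← s_equiv, D.t_eq_s H]))
    obtain rfl : h = h' := by
      apply D.equiv.injective
      apply D.comp_unique H
      obtain ⟨f, g⟩ := hh'
      exact comp_spec f g
    exact hh'

variable (D) in
/-- The projection to `C`. -/
noncomputable def proj : D.Obj ⥤ C :=
  Arr.ofArr (fun f ↦ D.p (D.equiv f))
    (fun x ↦ by
      rw [equiv_id]
      conv_lhs => rw [← x.s_eq, D.p_s])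
    (fun H ↦ D.p_comp ((isComp_iff _ _ _).1 H))

lemma map_proj (f : Arr D.Obj) : Arr.map D.proj f = D.p (D.equiv f) :=
  Arr.map_ofArr (fun f ↦ D.p (D.equiv f)) _ (fun H ↦ D.p_comp ((isComp_iff _ _ _).1 H)) f

variable (D) in
lemma isFiberedInGroupoids_proj : IsFiberedInGroupoids D.proj := by
  refine IsFiberedInGroupoids.of_arr (fun x f h ↦ ?_) (fun f g hfg h H ↦ ?_)
  · obtain ⟨b, h₁, h₂⟩ := D.exists_lift x.val f x.s_eq h
    refine ⟨D.equiv.symm b, ?_, ?_⟩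
    · apply Obj.ext'
      rw [← t_equiv, Equiv.apply_symm_apply, h₁]
    · rw [map_proj, Equiv.apply_symm_apply, h₂]
  · rw [map_proj, map_proj] at H
    obtain ⟨c, ⟨h₁, h₂⟩, h₃⟩ := D.existsUnique_fac (D.equiv f) (D.equiv g) h
      (by rw [t_equiv, t_equiv, hfg]) H
    refine ⟨D.equiv.symm c, ⟨?_, ?_⟩, ?_⟩
    · rwa [isComp_iff, Equiv.apply_symm_apply]
    · rw [map_proj, Equiv.apply_symm_apply, h₂]
    · rintro k ⟨h₄, h₅⟩
      rw [isComp_iff] at h₄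
      rw [map_proj] at h₅
      rw [← h₃ _ ⟨h₄, h₅⟩, Equiv.symm_apply_apply]

variable (D) in
/-- The category fibered in groupoids given by `D`. -/
noncomputable def toGrpdOver : GrpdOver C where
  obj := BasedCategory.ofFunctor D.proj
  property := D.isFiberedInGroupoids_proj

variable (D) in
/-- The arrows of `D.toGrpdOver`. -/
def arrEquiv : Arr D.toGrpdOver.obj.obj ≃ D.A := D.equiv

lemma base_eq (f : Arr D.toGrpdOver.obj.obj) : GrpdOver.base f = D.p (D.arrEquiv f) := map_proj f

lemma arrEquiv_src (f : Arr D.toGrpdOver.obj.obj) :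
    D.arrEquiv (Arr.id f.src) = D.s (D.arrEquiv f) := equiv_src f

lemma isComp_iff' (f g h : Arr D.toGrpdOver.obj.obj) :
    Arr.IsComp f g h ↔ D.R (D.arrEquiv f) (D.arrEquiv g) (D.arrEquiv h) := isComp_iff f g h

/-- Morphisms to `D.toGrpdOver` in terms of arrows. -/
noncomputable def homTo {E : GrpdOver C} (φ : Arr E.obj.obj → D.A)
    (hs : ∀ f, φ (Arr.id f.src) = D.s (φ f))
    (hcomp : ∀ {f g h}, Arr.IsComp f g h → D.R (φ f) (φ g) (φ h))
    (hbase : ∀ f, D.p (φ f) = GrpdOver.base f) : E ⟶ D.toGrpdOver :=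
  GrpdOver.homOfArr (fun f ↦ D.arrEquiv.symm (φ f))
    (fun x ↦ D.arrEquiv.injective (by
      rw [arrEquiv_src, Equiv.apply_symm_apply]
      exact hs (Arr.id x)))
    (fun H ↦ by
      rw [isComp_iff']
      simpa using hcomp H)
    (fun f ↦ by
      rw [base_eq, Equiv.apply_symm_apply, hbase])

lemma arrMap_homTo {E : GrpdOver C} (φ : Arr E.obj.obj → D.A) (hs hcomp hbase)
    (f : Arr E.obj.obj) :
    D.arrEquiv (GrpdOver.arrMap (homTo φ hs hcomp hbase) f) = φ f := by
  erw [GrpdOver.arrMap_homOfArr, Equiv.apply_symm_apply]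

/-- Morphisms from `D.toGrpdOver` in terms of arrows. -/
noncomputable def homFrom {E : GrpdOver C} (φ : D.A → Arr E.obj.obj)
    (hs : ∀ a, φ (D.s a) = Arr.id (φ a).src)
    (hcomp : ∀ {a b c}, D.R a b c → Arr.IsComp (φ a) (φ b) (φ c))
    (hbase : ∀ a, GrpdOver.base (φ a) = D.p a) : D.toGrpdOver ⟶ E :=
  GrpdOver.homOfArr (fun f ↦ φ (D.arrEquiv f))
    (fun x ↦ by
      rw [← hs]
      congr 1
      exact (arrEquiv_src (Arr.id x)))
    (fun H ↦ hcomp ((isComp_iff' _ _ _).1 H))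
    (fun f ↦ by rw [base_eq, hbase])

lemma arrMap_homFrom {E : GrpdOver C} (φ : D.A → Arr E.obj.obj) (hs hcomp hbase)
    (f : Arr D.toGrpdOver.obj.obj) :
    GrpdOver.arrMap (homFrom φ hs hcomp hbase) f = φ (D.arrEquiv f) :=
  GrpdOver.arrMap_homOfArr _ _ _ _ _

end ArrData

end Arrows

/-! ### Limits of categories fibered in groupoids -/

section LimitsOfGrpdOver

variable {C : Type u} [SmallCategory C] {J : Type u} [SmallCategory J] (F : J ⥤ GrpdOver C)

open GrpdOver

/-- The compatible families of arrows in a diagram of categories over `C`. -/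
@[ext]
structure LimArr where
  base : Arr C
  val (j : J) : Arr (F.obj j).obj.obj
  base_val (j : J) : GrpdOver.base (val j) = base
  compat {i j : J} (φ : i ⟶ j) : arrMap (F.map φ) (val i) = val j

namespace LimArr

variable {F}

/-- The identity of the source. -/
def s (a : LimArr F) : LimArr F where
  base := Arr.id a.base.src
  val j := Arr.id (a.val j).src
  base_val j := by
    rw [← a.base_val j]
    simp [GrpdOver.base]
  compat φ := by
    rw [← a.compat φ]
    simp [arrMap]

/-- The identity of the target. -/
def t (a : LimArr F) : LimArr F where
  base := Arr.id a.base.tgt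
  val j := Arr.id (a.val j).tgt
  base_val j := by
    rw [← a.base_val j]
    simp [GrpdOver.base]
  compat φ := by
    rw [← a.compat φ]
    simp [arrMap]

/-- Composition of compatible families of arrows. -/
structure IsComp (a b c : LimArr F) : Prop where
  base : Arr.IsComp a.base b.base c.base
  val (j : J) : Arr.IsComp (a.val j) (b.val j) (c.val j)

lemma IsComp.t_eq_s {a b c : LimArr F} (h : IsComp a b c) : t a = s b :=
  LimArr.ext (congrArg Arr.id h.base.tgt_eq_src)
    (funext fun j ↦ congrArg Arr.id (h.val j).tgt_eq_src)

lemma IsComp.s_eq {a b c : LimArr F} (h : IsComp a b c) : s c = s a :=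
  LimArr.ext (congrArg Arr.id h.base.src_eq)
    (funext fun j ↦ congrArg Arr.id (h.val j).src_eq)

lemma IsComp.t_eq {a b c : LimArr F} (h : IsComp a b c) : t c = t b :=
  LimArr.ext (congrArg Arr.id h.base.tgt_eq)
    (funext fun j ↦ congrArg Arr.id (h.val j).tgt_eq)

lemma IsComp.unique {a b c c' : LimArr F} (h : IsComp a b c) (h' : IsComp a b c') : c = c' :=
  LimArr.ext (h.base.unique h'.base) (funext fun j ↦ (h.val j).unique (h'.val j))

lemma exists_isComp {a b : LimArr F} (h : t a = s b) : ∃ c, IsComp a b c := by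
  have hb : a.base.tgt = b.base.src := Arr.id_inj (congrArg LimArr.base h)
  have hv (j : J) : (a.val j).tgt = (b.val j).src := Arr.id_inj (congrFun (congrArg LimArr.val h) j)
  obtain ⟨c, hc⟩ := Arr.exists_isComp hb
  choose d hd using fun j ↦ Arr.exists_isComp (hv j)
  refine ⟨⟨c, d, fun j ↦ ?_, fun {i j} φ ↦ ?_⟩, hc, hd⟩
  · refine ((hd j).map _).unique ?_
    change Arr.IsComp (GrpdOver.base (a.val j)) (GrpdOver.base (b.val j)) c
    rwa [a.base_val, b.base_val]
  · refine ((hd i).map _).unique ?_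
    change Arr.IsComp (arrMap (F.map φ) (a.val i)) (arrMap (F.map φ) (b.val i)) _
    rw [a.compat, b.compat]
    exact hd j

/-- A set of compatible families of objects is hereditary if it contains sources of compatible
families of lifts. -/
def IsHereditary (S : Set (LimArr F)) : Prop :=
  ∀ y ∈ S, ∀ f : Arr C, f.tgt = y.base.src → ∃ b : LimArr F, t b = y ∧ b.base = f ∧ s b ∈ S

/-- The elements of hereditary sets. -/
def Good (y : LimArr F) : Prop := ∃ S, IsHereditary S ∧ y ∈ S

/-- A union of hereditary sets is hereditary, so the good families form the largest such set. The
restriction is needed: lifts exist in each component, but they may not be choosable compatibly with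
the transition functors, so the limit among all categories over `C` can fail to be fibered. -/
lemma isHereditary_good : IsHereditary {y : LimArr F | Good y} := by
  rintro y ⟨S, hS, hy⟩ f hf
  obtain ⟨b, h₁, h₂, h₃⟩ := hS y hy f hf
  exact ⟨b, h₁, h₂, S, hS, h₃⟩

/-- The factorizations in the components are automatically compatible: a transition functor sends
one to a factorization of the required kind, which is unique. Lifts lack this uniqueness, and only
for them is goodness needed. -/
lemma existsUnique_fac (a b : LimArr F) (f : Arr C) (h : t a = t b)
    (H : Arr.IsComp f b.base a.base) : ∃! c : LimArr F, IsComp c b a ∧ c.base = f := by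
  have hv (j : J) : (a.val j).tgt = (b.val j).tgt := Arr.id_inj (congrFun (congrArg LimArr.val h) j)
  choose c hc hc' using fun j ↦ (F.obj j).property.existsUnique_arr (a.val j) (b.val j) (hv j) f (by
    change Arr.IsComp f (GrpdOver.base (b.val j)) (GrpdOver.base (a.val j))
    rwa [a.base_val, b.base_val])
  refine ⟨⟨f, c, fun j ↦ (hc j).2, fun {i j} φ ↦ ?_⟩, ⟨⟨H, fun j ↦ (hc j).1⟩, rfl⟩, ?_⟩
  · refine hc' j _ ⟨?_, ?_⟩
    · rw [← a.compat φ, ← b.compat φ]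
      exact (hc i).1.map _
    · exact (base_arrMap _ _).trans (hc i).2
  · rintro d ⟨h₁, h₂⟩
    exact LimArr.ext h₂ (funext fun j ↦ hc' j _ ⟨h₁.val j, (d.base_val j).trans h₂⟩)

end LimArr

/-- The limit of a diagram of categories fibered in groupoids: the objects are those compatible
families of objects which belong to a hereditary set of such families. -/
def limArrData : ArrData C where
  A := {a : LimArr F // LimArr.Good a.s ∧ LimArr.Good a.t}
  s a := ⟨a.1.s, a.2.1, a.2.1⟩
  t a := ⟨a.1.t, a.2.2, a.2.2⟩
  R a b c := LimArr.IsComp a.1 b.1 c.1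
  p a := a.1.base
  s_s _ := rfl
  t_s _ := rfl
  s_t _ := rfl
  exists_comp a b h := by
    obtain ⟨c, hc⟩ := LimArr.exists_isComp (congrArg Subtype.val h)
    exact ⟨⟨c, by rw [hc.s_eq]; exact a.2.1, by rw [hc.t_eq]; exact b.2.2⟩, hc⟩
  t_eq_s h := Subtype.ext h.t_eq_s
  comp_unique h h' := Subtype.ext (h.unique h')
  s_comp h := Subtype.ext h.s_eq
  t_comp h := Subtype.ext h.t_eq
  id_comp a := ⟨Arr.id_isComp _, fun _ ↦ Arr.id_isComp _⟩
  comp_id a := ⟨Arr.isComp_id _, fun _ ↦ Arr.isComp_id _⟩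
  assoc h₁ h₂ h₃ := ⟨h₁.base.assoc h₂.base h₃.base, fun j ↦ (h₁.val j).assoc (h₂.val j) (h₃.val j)⟩
  p_s _ := rfl
  p_comp h := h.base
  exists_lift a f ha hf := by
    have ha' : a.1.s = a.1 := congrArg Subtype.val ha
    have hg : LimArr.Good a.1 := by
      rw [← ha']
      exact a.2.1
    obtain ⟨b, h₁, h₂, h₃⟩ := LimArr.isHereditary_good a.1 hg f hf
    exact ⟨⟨b, h₃, h₁ ▸ hg⟩, Subtype.ext h₁, h₂⟩
  existsUnique_fac a b f h H := by
    obtain ⟨c, ⟨h₁, h₂⟩, h₃⟩ := LimArr.existsUnique_fac a.1 b.1 f (congrArg Subtype.val h) H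
    refine ⟨⟨c, by rw [← h₁.s_eq]; exact a.2.1, by rw [h₁.t_eq_s]; exact b.2.1⟩, ⟨h₁, h₂⟩, ?_⟩
    rintro ⟨d, hd⟩ ⟨h₄, h₅⟩
    exact Subtype.ext (h₃ d ⟨h₄, h₅⟩)

/-- The limit cone of a diagram of categories fibered in groupoids. -/
noncomputable def limArrCone : Cone F where
  pt := (limArrData F).toGrpdOver
  π :=
    { app j := ArrData.homFrom (fun a ↦ a.1.val j) (fun _ ↦ rfl) (fun h ↦ h.val j)
        (fun a ↦ a.1.base_val j)
      naturality i j φ := GrpdOver.hom_ext fun f ↦ by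
        rw [arrMap_comp, arrMap_comp]
        erw [ArrData.arrMap_homFrom, ArrData.arrMap_homFrom]
        exact (LimArr.compat _ φ).symm }

lemma arrMap_limArrCone (j : J) (f) :
    arrMap ((limArrCone F).π.app j) f = ((limArrData F).arrEquiv f).1.val j :=
  ArrData.arrMap_homFrom _ _ _ _ _

variable {F}

/-- The family of arrows given by an arrow of the point of a cone. -/
def LimArr.ofCone (c : Cone F) (f : Arr c.pt.obj.obj) : LimArr F where
  base := GrpdOver.base f
  val j := arrMap (c.π.app j) f
  base_val j := base_arrMap _ _
  compat φ := by
    rw [← arrMap_comp, c.w]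

lemma LimArr.ofCone_src (c : Cone F) (f : Arr c.pt.obj.obj) :
    LimArr.ofCone c (Arr.id f.src) = (LimArr.ofCone c f).s :=
  LimArr.ext (Arr.map_id _ _) (funext fun _ ↦ Arr.map_id _ _)

lemma LimArr.ofCone_tgt (c : Cone F) (f : Arr c.pt.obj.obj) :
    LimArr.ofCone c (Arr.id f.tgt) = (LimArr.ofCone c f).t :=
  LimArr.ext (Arr.map_id _ _) (funext fun _ ↦ Arr.map_id _ _)

/-- Lifts in the point of the cone induce compatible lifts in the diagram, so the families that come
from the cone form a hereditary set. Hence no cone is lost by restricting to good families. -/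
lemma LimArr.good_ofCone (c : Cone F) (x : c.pt.obj.obj) :
    LimArr.Good (LimArr.ofCone c (Arr.id x)) := by
  refine ⟨Set.range fun x ↦ LimArr.ofCone c (Arr.id x), ?_, x, rfl⟩
  rintro _ ⟨x, rfl⟩ f hf
  obtain ⟨b, rfl, hb⟩ := c.pt.property.exists_arr x f hf
  exact ⟨LimArr.ofCone c b, (LimArr.ofCone_tgt c b).symm, hb, b.src, LimArr.ofCone_src c b⟩

variable (F)

/-- The arrow of the limit given by an arrow of the point of a cone. -/
def LimArr.ofCone' (c : Cone F) (f : Arr c.pt.obj.obj) : (limArrData F).A :=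
  ⟨LimArr.ofCone c f, by rw [← LimArr.ofCone_src]; exact LimArr.good_ofCone c _,
    by rw [← LimArr.ofCone_tgt]; exact LimArr.good_ofCone c _⟩

/-- The cone `limArrCone F` is a limit cone. -/
noncomputable def isLimitLimArrCone : IsLimit (limArrCone F) where
  lift c := ArrData.homTo (D := limArrData F)
    (LimArr.ofCone' F c) (fun f ↦ Subtype.ext (LimArr.ofCone_src c f))
    (fun h ↦ ⟨h.map _, fun _ ↦ h.map _⟩) (fun _ ↦ rfl)
  fac c j := GrpdOver.hom_ext fun f ↦ by
    refine (arrMap_comp _ _ f).trans ((arrMap_limArrCone F j _).trans ?_)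
    erw [ArrData.arrMap_homTo]
    rfl
  uniq c m hm := GrpdOver.hom_ext fun f ↦ (limArrData F).arrEquiv.injective (by
    erw [ArrData.arrMap_homTo]
    refine Subtype.ext (LimArr.ext ?_ (funext fun j ↦ ?_))
    · exact (ArrData.base_eq _).symm.trans (base_arrMap m f)
    · rw [← arrMap_limArrCone, ← arrMap_comp, hm]
      rfl)

end LimitsOfGrpdOver

instance {C : Type u} [SmallCategory C] : HasLimits (GrpdOver C) where
  has_limits_of_shape _ _ := ⟨fun F ↦ ⟨⟨_, isLimitLimArrCone F⟩⟩⟩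

/-! ### Colimits of categories fibered in groupoids -/

section ColimitsOfGrpdOver

variable {C : Type u} [SmallCategory C] {J : Type u} [SmallCategory J] (F : J ⥤ GrpdOver C)

open GrpdOver

/-- Formal expressions for arrows in a category fibered in groupoids, in terms of the arrows of
a diagram of such categories. -/
inductive ArrTerm : Type u
  | gen (j : J) (a : Arr (F.obj j).obj.obj) : ArrTerm
  | src (a : ArrTerm) : ArrTerm
  | tgt (a : ArrTerm) : ArrTerm
  | comp (a b : ArrTerm) : ArrTerm
  | fac (a b : ArrTerm) (f : Arr C) : ArrTerm

namespace ArrTerm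

variable {F} {E E' : GrpdOver C} (h : F ⟶ (Functor.const J).obj E)
  (h' : F ⟶ (Functor.const J).obj E')

/-- The map on arrows given by a component of a cocone. -/
abbrev genMap (j : J) (a : Arr (F.obj j).obj.obj) : Arr E.obj.obj :=
  arrMap (E' := E) (h.app j) a

open Classical in
/-- The value of an expression in the point of a cocone (with a default value if the
expression does not make sense). -/
noncomputable def eval : ArrTerm F → Arr E.obj.obj
  | gen j a => genMap h j a
  | src a => Arr.id (eval a).src
  | tgt a => Arr.id (eval a).tgt
  | comp a b => if H : ∃ c, Arr.IsComp (eval a) (eval b) c then H.choose else eval a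
  | fac a b f => if H : ∃ c, Arr.IsComp c (eval b) (eval a) ∧ base c = f then H.choose else eval a

lemma eval_comp {a b : ArrTerm F} (H : (eval h a).tgt = (eval h b).src) :
    Arr.IsComp (eval h a) (eval h b) (eval h (comp a b)) := by
  have H' := Arr.exists_isComp H
  rw [eval, dif_pos H']
  exact H'.choose_spec

lemma eval_comp' {a b : ArrTerm F} (H : (eval h a).tgt ≠ (eval h b).src) :
    eval h (comp a b) = eval h a := by
  rw [eval, dif_neg]
  rintro ⟨c, hc⟩
  exact H hc.tgt_eq_src

lemma eval_fac {a b : ArrTerm F} {f : Arr C} (H : (eval h a).tgt = (eval h b).tgt)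
    (Hf : Arr.IsComp f (base (eval h b)) (base (eval h a))) :
    Arr.IsComp (eval h (fac a b f)) (eval h b) (eval h a) ∧ base (eval h (fac a b f)) = f := by
  have H' := (E.property.existsUnique_arr _ _ H f Hf).exists
  rw [eval, dif_pos H']
  exact H'.choose_spec

lemma eval_fac' {a b : ArrTerm F} {f : Arr C} (H : ¬ ((eval h a).tgt = (eval h b).tgt ∧
    Arr.IsComp f (base (eval h b)) (base (eval h a)))) :
    eval h (fac a b f) = eval h a := by
  rw [eval, dif_neg]
  rintro ⟨c, hc, rfl⟩
  exact H ⟨hc.tgt_eq, hc.map _⟩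

/-- No operation on expressions creates a new object. This is why no expressions for lifts are
needed: a lift with given target is taken in the `F.obj j` from which that target comes. -/
lemma exists_obj (a : ArrTerm F) :
    (∃ j x, Arr.id (eval h a).src = genMap h j (Arr.id x)) ∧
      (∃ j x, Arr.id (eval h a).tgt = genMap h j (Arr.id x)) := by
  induction a with
  | gen j a => exact ⟨⟨j, a.src, (Arr.map_id _ _).symm⟩, ⟨j, a.tgt, (Arr.map_id _ _).symm⟩⟩
  | src a ha => exact ⟨ha.1, ha.1⟩
  | tgt a ha => exact ⟨ha.2, ha.2⟩
  | comp a b ha hb =>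
    by_cases H : (eval h a).tgt = (eval h b).src
    · have := eval_comp h H
      rw [this.src_eq, this.tgt_eq]
      exact ⟨ha.1, hb.2⟩
    · rw [eval_comp' h H]
      exact ha
  | fac a b f ha hb =>
    by_cases H : (eval h a).tgt = (eval h b).tgt ∧ Arr.IsComp f (base (eval h b)) (base (eval h a))
    · have := (eval_fac h H.1 H.2).1
      rw [this.tgt_eq_src, ← this.src_eq]
      exact ⟨ha.1, hb.1⟩
    · rw [eval_fac' h H]
      exact ha

/-- The category fibered in groupoids which is generated by the arrows in the image of a cocone. -/
noncomputable def arrData : ArrData C where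
  A := Set.range (eval h)
  s a := ⟨Arr.id a.1.src, by
    obtain ⟨a, ha⟩ := a.2
    exact ⟨src a, by rw [← ha, eval]⟩⟩
  t a := ⟨Arr.id a.1.tgt, by
    obtain ⟨a, ha⟩ := a.2
    exact ⟨tgt a, by rw [← ha, eval]⟩⟩
  R a b c := Arr.IsComp a.1 b.1 c.1
  p a := base a.1
  s_s _ := rfl
  t_s _ := rfl
  s_t _ := rfl
  exists_comp := by
    rintro ⟨_, a, rfl⟩ ⟨_, b, rfl⟩ H
    exact ⟨⟨_, comp a b, rfl⟩, eval_comp h (Arr.id_inj (congrArg Subtype.val H))⟩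
  t_eq_s H := Subtype.ext (congrArg Arr.id H.tgt_eq_src)
  comp_unique H H' := Subtype.ext (H.unique H')
  s_comp H := Subtype.ext (congrArg Arr.id H.src_eq)
  t_comp H := Subtype.ext (congrArg Arr.id H.tgt_eq)
  id_comp _ := Arr.id_isComp _
  comp_id _ := Arr.isComp_id _
  assoc H₁ H₂ H₃ := H₁.assoc H₂ H₃
  p_s _ := Arr.map_id _ _
  p_comp H := H.map _
  exists_lift := by
    rintro ⟨_, a, rfl⟩ f H hf
    obtain ⟨⟨j, x, hx⟩, -⟩ := exists_obj h a
    have H' : Arr.id (eval h a).src = eval h a := congrArg Subtype.val H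
    obtain ⟨b, rfl, rfl⟩ := (F.obj j).property.exists_arr x f (by
      have hx' := congrArg Arr.src hx
      exact hf.trans ((congrArg E.obj.p.obj hx').trans
        (congrArg Arr.src (base_arrMap (E' := E) (h.app j) (Arr.id x)))))
    refine ⟨⟨genMap h j b, gen j b, rfl⟩, Subtype.ext ?_, base_arrMap (E' := E) _ _⟩
    exact ((Arr.map_id _ _).symm.trans hx.symm).trans H'
  existsUnique_fac := by
    rintro ⟨_, a, rfl⟩ ⟨_, b, rfl⟩ f H Hf
    have H' : (eval h a).tgt = (eval h b).tgt := Arr.id_inj (congrArg Subtype.val H)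
    refine ⟨⟨_, fac a b f, rfl⟩, eval_fac h H' Hf, ?_⟩
    rintro ⟨c, hc⟩ Hc
    exact Subtype.ext ((E.property.existsUnique_arr _ _ H' f Hf).unique Hc (eval_fac h H' Hf))

/-- The kernel of the evaluation of expressions. -/
def code : Set (ArrTerm F × ArrTerm F) := {x | eval h x.1 = eval h x.2}

variable {h h'} in
lemma eval_eq_iff_of_code_eq (H : code h = code h') (a b : ArrTerm F) :
    eval h a = eval h b ↔ eval h' a = eval h' b :=
  iff_of_eq (congrFun H (a, b))

variable {h h'} in
lemma tgt_eq_src_iff (H : code h = code h') (a b : ArrTerm F) :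
    (eval h a).tgt = (eval h b).src ↔ (eval h' a).tgt = (eval h' b).src :=
  ⟨fun e ↦ Arr.id_inj ((eval_eq_iff_of_code_eq H (tgt a) (src b)).1 (congrArg Arr.id e)),
    fun e ↦ Arr.id_inj ((eval_eq_iff_of_code_eq H (tgt a) (src b)).2 (congrArg Arr.id e))⟩

variable {h h'} in
lemma tgt_eq_tgt_iff (H : code h = code h') (a b : ArrTerm F) :
    (eval h a).tgt = (eval h b).tgt ↔ (eval h' a).tgt = (eval h' b).tgt :=
  ⟨fun e ↦ Arr.id_inj ((eval_eq_iff_of_code_eq H (tgt a) (tgt b)).1 (congrArg Arr.id e)),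
    fun e ↦ Arr.id_inj ((eval_eq_iff_of_code_eq H (tgt a) (tgt b)).2 (congrArg Arr.id e))⟩

-- On generators the base is that of the diagram. Whether a composition or factorization makes
-- sense, or the default value applies, can be read off from equations between expressions and from
-- the bases of smaller expressions, so equal codes give the same case distinctions.
variable {h h'} in
lemma base_eval_eq (H : code h = code h') (a : ArrTerm F) :
    base (eval h a) = base (eval h' a) := by
  induction a with
  | gen j a => exact (base_arrMap (E' := E) _ _).trans (base_arrMap (E' := E') _ _).symm
  | src a ha =>
    exact (Arr.map_id _ _).trans ((congrArg (fun f ↦ Arr.id (Arr.src f)) ha).trans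
      (Arr.map_id _ _).symm)
  | tgt a ha =>
    exact (Arr.map_id _ _).trans ((congrArg (fun f ↦ Arr.id (Arr.tgt f)) ha).trans
      (Arr.map_id _ _).symm)
  | comp a b ha hb =>
    by_cases e : (eval h a).tgt = (eval h b).src
    · refine ((eval_comp h e).map E.obj.p).unique ?_
      change Arr.IsComp (base _) (base _) _
      rw [ha, hb]
      exact (eval_comp h' ((tgt_eq_src_iff H a b).1 e)).map E'.obj.p
    · rw [eval_comp' h e, eval_comp' h' (fun e' ↦ e ((tgt_eq_src_iff H a b).2 e')), ha]
  | fac a b f ha hb =>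
    by_cases e : (eval h a).tgt = (eval h b).tgt ∧ Arr.IsComp f (base (eval h b)) (base (eval h a))
    · rw [(eval_fac h e.1 e.2).2, (eval_fac h' ((tgt_eq_tgt_iff H a b).1 e.1)
        (by rw [← ha, ← hb]; exact e.2)).2]
    · rw [eval_fac' h e, eval_fac' h' (by rwa [← ha, ← hb, ← tgt_eq_tgt_iff H]), ha]

variable {h} in
/-- An expression for an arrow of `arrData h`. -/
noncomputable def rep (x : (arrData h).A) : ArrTerm F := Exists.choose x.2

variable {h} in
lemma eval_rep (x : (arrData h).A) : eval h (rep x) = x.1 := Exists.choose_spec x.2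

variable {h h'} in
lemma eval_rep_eq (H : code h = code h') (x : (arrData h).A) (a : ArrTerm F) (hx : x.1 = eval h a) :
    eval h' (rep x) = eval h' a :=
  (eval_eq_iff_of_code_eq H _ _).1 ((eval_rep x).trans hx)

variable {h h'} in
/-- If two cocones satisfy the same equations, then the category generated by the image of
the first one maps to the second one. -/
noncomputable def homOfCodeEq (H : code h = code h') : (arrData h).toGrpdOver ⟶ E' :=
  ArrData.homFrom (D := arrData h) (fun x ↦ eval h' (rep x))
    (fun x ↦ eval_rep_eq H _ (src (rep x)) (congrArg (fun f ↦ Arr.id (Arr.src f)) (eval_rep x).symm))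
    (fun {x y z} (hxyz : Arr.IsComp x.1 y.1 z.1) ↦ by
      rw [← eval_rep x, ← eval_rep y] at hxyz
      have e := hxyz.tgt_eq_src
      rw [eval_rep_eq H z _ (hxyz.unique (eval_comp h e))]
      exact eval_comp h' ((tgt_eq_src_iff H _ _).1 e))
    (fun x ↦ (base_eval_eq H _).symm.trans (congrArg base (eval_rep x)))

/-- The arrow of `arrData h` given by an arrow in the diagram. -/
def genArr (j : J) (a : Arr (F.obj j).obj.obj) : (arrData h).A := ⟨genMap h j a, gen j a, rfl⟩

/-- The components of `cocone`. -/
noncomputable def coconeApp (j : J) : F.obj j ⟶ (arrData h).toGrpdOver :=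
  ArrData.homTo (D := arrData h) (genArr h j)
    (fun _ ↦ Subtype.ext (Arr.map_id _ _)) (fun H ↦ Arr.IsComp.map H _)
    (fun _ ↦ base_arrMap (E' := E) _ _)

lemma arrMap_coconeApp (j : J) (a : Arr (F.obj j).obj.obj) :
    (arrData h).arrEquiv (arrMap (coconeApp h j) a) = genArr h j a :=
  ArrData.arrMap_homTo (D := arrData h) _ _ _ _ _

/-- The cocone whose point is the category generated by the image of a cocone. -/
noncomputable def cocone : F ⟶ (Functor.const J).obj (arrData h).toGrpdOver where
  app j := coconeApp h j
  naturality i j φ := GrpdOver.hom_ext fun a ↦ (arrData h).arrEquiv.injective (by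
    refine (arrMap_coconeApp h j (arrMap (F.map φ) a)).trans
      (Eq.trans ?_ (arrMap_coconeApp h i a).symm)
    apply Subtype.ext
    exact congrArg (arrMap · a) (h.naturality φ))

variable {h h'} in
lemma cocone_homOfCodeEq (H : code h = code h') :
    cocone h ≫ (Functor.const J).map (homOfCodeEq H) = h' := by
  ext j : 2
  refine GrpdOver.hom_ext fun a ↦ ?_
  refine (arrMap_comp (coconeApp h j) (homOfCodeEq H) a).trans
    ((ArrData.arrMap_homFrom _ _ _ _ _).trans ?_)
  rw [arrMap_coconeApp]
  exact eval_rep_eq H _ (gen j a) rfl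

variable (F) in
/-- The possible kernels of evaluation maps. -/
abbrev Code : Type u :=
  {k : Set (ArrTerm F × ArrTerm F) // ∃ (E : GrpdOver C) (h : F ⟶ (Functor.const J).obj E),
    code h = k}

end ArrTerm

/-- The expressions form a type in `Type u`, and so do the codes. Each cocone factors through the
category generated by the image of one cocone chosen for its code. -/
lemma solutionSetCondition_const :
    SolutionSetCondition.{u} (Functor.const J : GrpdOver C ⥤ J ⥤ GrpdOver C) := fun F ↦
  ⟨ArrTerm.Code F, fun i ↦ (ArrTerm.arrData i.2.choose_spec.choose).toGrpdOver,
    fun i ↦ ArrTerm.cocone i.2.choose_spec.choose, fun _ h ↦ by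
      let i : ArrTerm.Code F := ⟨ArrTerm.code h, _, h, rfl⟩
      exact ⟨i, _, ArrTerm.cocone_homOfCodeEq i.2.choose_spec.choose_spec⟩⟩

end ColimitsOfGrpdOver

/-- Taking colimits is left adjoint to the constant diagram functor, and the adjoint functor theorem
provides this left adjoint. It uses the limits constructed above. -/
instance {C : Type u} [SmallCategory C] : HasColimits (GrpdOver C) where
  has_colimits_of_shape _ _ := hasColimitsOfShape_iff_isRightAdjoint_const.2
    (isRightAdjoint_of_preservesLimits_of_solutionSetCondition _ solutionSetCondition_const)

/-! ### Directed colimits of categories fibered in groupoids -/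

section DirectedColimits

variable {C : Type u} [SmallCategory C] {J : Type u} [LinearOrder J] (F : J ⥤ GrpdOver C)

open GrpdOver

namespace DirColim

variable {F}

/-- The transition map on arrows. -/
abbrev push {i j : J} (h : i ≤ j) (a : Arr (F.obj i).obj.obj) : Arr (F.obj j).obj.obj :=
  arrMap (F.map (homOfLE h)) a

lemma push_push {i j k : J} (h : i ≤ j) (h' : j ≤ k) (a : Arr (F.obj i).obj.obj) :
    push h' (push h a) = push (h.trans h') a := by
  rw [push, push, ← arrMap_comp, ← F.map_comp]
  rfl

lemma push_refl {i : J} (h : i ≤ i) (a : Arr (F.obj i).obj.obj) : push h a = a := by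
  have : F.map (homOfLE h) = 𝟙 _ := F.map_id i
  rw [push, this]
  rfl

variable (F) in
/-- Two arrows in a directed system are equivalent if they become equal at some stage. -/
def setoid : Setoid (Σ j, Arr (F.obj j).obj.obj) where
  r x y := ∃ (k : J) (hx : x.1 ≤ k) (hy : y.1 ≤ k), push hx x.2 = push hy y.2
  iseqv :=
    { refl x := ⟨x.1, le_rfl, le_rfl, rfl⟩
      symm := by
        rintro x y ⟨k, hx, hy, h⟩
        exact ⟨k, hy, hx, h.symm⟩
      trans := by
        rintro x y z ⟨k, hx, hy, h⟩ ⟨l, hy', hz, h'⟩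
        refine ⟨max k l, hx.trans (le_max_left _ _), hz.trans (le_max_right _ _), ?_⟩
        rw [← push_push hx (le_max_left k l), h, push_push, ← push_push hz (le_max_right k l), ← h',
          push_push] }

variable (F) in
/-- The colimit of the sets of arrows. -/
def ColimArr : Type u := Quotient (setoid F)

/-- The class of an arrow. -/
def mk (j : J) (a : Arr (F.obj j).obj.obj) : ColimArr F := Quotient.mk (setoid F) ⟨j, a⟩

lemma mk_eq_mk {i j : J} {a : Arr (F.obj i).obj.obj} {b : Arr (F.obj j).obj.obj} :
    mk i a = mk j b ↔ ∃ (k : J) (hi : i ≤ k) (hj : j ≤ k), push hi a = push hj b :=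
  Quotient.eq (r := setoid F)

lemma mk_push {i j : J} (h : i ≤ j) (a : Arr (F.obj i).obj.obj) : mk j (push h a) = mk i a :=
  mk_eq_mk.2 ⟨j, le_rfl, h, push_refl _ _⟩

lemma mk_eq_mk' {i : J} {a b : Arr (F.obj i).obj.obj} :
    mk i a = mk i b ↔ ∃ (k : J) (h : i ≤ k), push h a = push h b := by
  rw [mk_eq_mk]
  exact ⟨fun ⟨k, h, _, e⟩ ↦ ⟨k, h, e⟩, fun ⟨k, h, e⟩ ↦ ⟨k, h, h, e⟩⟩

lemma exists_mk (x : ColimArr F) : ∃ i a, x = mk i a := by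
  obtain ⟨⟨i, a⟩, rfl⟩ := Quotient.exists_rep x
  exact ⟨i, a, rfl⟩

/-- The boundedness hypothesis is automatic for finite families, which suffices for the axioms of
`ArrData`. For the family of all arrows of a category it is the presentability condition. -/
lemma exists_common {ι : Type*} (hι : ∀ f : ι → J, BddAbove (Set.range f)) (x : ι → ColimArr F) :
    ∃ (k : J) (a : ∀ _ : ι, Arr (F.obj k).obj.obj), ∀ i, x i = mk k (a i) := by
  choose f a ha using fun i ↦ exists_mk (x i)
  obtain ⟨k, hk⟩ := hι f
  exact ⟨k, fun i ↦ push (hk ⟨i, rfl⟩) (a i), fun i ↦ by rw [mk_push, ha]⟩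

/-- The map to a set given by a compatible family of maps. -/
def lift {X : Type*} (φ : ∀ j, Arr (F.obj j).obj.obj → X)
    (hφ : ∀ {i j : J} (h : i ≤ j) (a : Arr (F.obj i).obj.obj), φ j (push h a) = φ i a) :
    ColimArr F → X :=
  Quotient.lift (fun x ↦ φ x.1 x.2) (by
    rintro x y ⟨k, hx, hy, h⟩
    rw [← hφ hx, ← hφ hy, h])

lemma lift_mk {X : Type*} (φ : ∀ j, Arr (F.obj j).obj.obj → X) (hφ) (j : J)
    (a : Arr (F.obj j).obj.obj) : lift φ hφ (mk j a) = φ j a := rfl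

/-- The identity of the source. -/
def s : ColimArr F → ColimArr F :=
  lift (fun j a ↦ mk j (Arr.id a.src)) (fun h a ↦ by
    rw [← mk_push h (Arr.id a.src)]
    simp [push])

/-- The identity of the target. -/
def t : ColimArr F → ColimArr F :=
  lift (fun j a ↦ mk j (Arr.id a.tgt)) (fun h a ↦ by
    rw [← mk_push h (Arr.id a.tgt)]
    simp [push])

/-- The projection to `C`. -/
def p : ColimArr F → Arr C := lift (fun _ a ↦ base a) (fun _ _ ↦ base_arrMap _ _)

/-- The composition of arrows. -/
def R (x y z : ColimArr F) : Prop :=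
  ∃ k a b c, x = mk k a ∧ y = mk k b ∧ z = mk k c ∧ Arr.IsComp a b c

lemma push_isComp {i j : J} (h : i ≤ j) {a b c : Arr (F.obj i).obj.obj} (H : Arr.IsComp a b c) :
    Arr.IsComp (push h a) (push h b) (push h c) := H.map _

lemma R_mk_iff {k : J} (a b c : Arr (F.obj k).obj.obj) :
    R (mk k a) (mk k b) (mk k c) ↔
      ∃ (l : J) (h : k ≤ l), Arr.IsComp (push h a) (push h b) (push h c) := by
  constructor
  · rintro ⟨i, a', b', c', ha, hb, hc, H⟩
    obtain ⟨l₁, h₁, h₁', e₁⟩ := mk_eq_mk.1 ha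
    obtain ⟨l₂, h₂, h₂', e₂⟩ := mk_eq_mk.1 hb
    obtain ⟨l₃, h₃, h₃', e₃⟩ := mk_eq_mk.1 hc
    have g₁ : l₁ ≤ max l₁ (max l₂ l₃) := le_max_left _ _
    have g₂ : l₂ ≤ max l₁ (max l₂ l₃) := (le_max_left _ _).trans (le_max_right _ _)
    have g₃ : l₃ ≤ max l₁ (max l₂ l₃) := (le_max_right _ _).trans (le_max_right _ _)
    refine ⟨max l₁ (max l₂ l₃), h₁.trans g₁, ?_⟩
    rw [← push_push h₁ g₁ a, ← push_push h₂ g₂ b, ← push_push h₃ g₃ c, e₁, e₂, e₃,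
      push_push, push_push, push_push]
    exact push_isComp _ H
  · rintro ⟨l, h, H⟩
    exact ⟨l, _, _, _, (mk_push h a).symm, (mk_push h b).symm, (mk_push h c).symm, H⟩

lemma exists_tgt_eq_src {k : J} {a b : Arr (F.obj k).obj.obj} (h : t (mk k a) = s (mk k b)) :
    ∃ (l : J) (h : k ≤ l), (push h a).tgt = (push h b).src := by
  obtain ⟨l, hl, e⟩ := mk_eq_mk'.1 h
  exact ⟨l, hl, congrArg Arr.src e⟩

lemma exists_tgt_eq_tgt {k : J} {a b : Arr (F.obj k).obj.obj} (h : t (mk k a) = t (mk k b)) :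
    ∃ (l : J) (h : k ≤ l), (push h a).tgt = (push h b).tgt := by
  obtain ⟨l, hl, e⟩ := mk_eq_mk'.1 h
  exact ⟨l, hl, congrArg Arr.src e⟩

lemma isComp_t_eq_s {k : J} {a b c : Arr (F.obj k).obj.obj} (H : Arr.IsComp a b c) :
    t (mk k a) = s (mk k b) ∧ s (mk k c) = s (mk k a) ∧ t (mk k c) = t (mk k b) :=
  ⟨congrArg (fun x ↦ mk k (Arr.id x)) H.tgt_eq_src, congrArg (fun x ↦ mk k (Arr.id x)) H.src_eq,
    congrArg (fun x ↦ mk k (Arr.id x)) H.tgt_eq⟩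

variable [Nonempty J]

lemma bddAbove_range_of_finite {ι : Type*} [Finite ι] (f : ι → J) : BddAbove (Set.range f) :=
  (Set.finite_range f).bddAbove

lemma R_unique {x y z z' : ColimArr F} (h : R x y z) (h' : R x y z') : z = z' := by
  obtain ⟨k, a, ha⟩ := exists_common bddAbove_range_of_finite ![x, y, z, z']
  obtain rfl : x = mk k (a 0) := ha 0
  obtain rfl : y = mk k (a 1) := ha 1
  obtain rfl : z = mk k (a 2) := ha 2
  obtain rfl : z' = mk k (a 3) := ha 3
  obtain ⟨l, hl, H⟩ := (R_mk_iff _ _ _).1 h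
  obtain ⟨l', hl', H'⟩ := (R_mk_iff _ _ _).1 h'
  replace H := push_isComp (le_max_left l l') H
  replace H' := push_isComp (le_max_right l l') H'
  simp only [push_push] at H H'
  rw [← mk_push (hl.trans (le_max_left l l')) (a 2), ← mk_push (hl.trans (le_max_left l l')) (a 3),
    H.unique H']

lemma R_assoc {a b c ab bc x : ColimArr F} (h₁ : R a b ab) (h₂ : R b c bc) (h₃ : R ab c x) :
    R a bc x := by
  obtain ⟨k, a', ha⟩ := exists_common bddAbove_range_of_finite ![a, b, c, ab, bc, x]
  obtain rfl : a = mk k (a' 0) := ha 0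
  obtain rfl : b = mk k (a' 1) := ha 1
  obtain rfl : c = mk k (a' 2) := ha 2
  obtain rfl : ab = mk k (a' 3) := ha 3
  obtain rfl : bc = mk k (a' 4) := ha 4
  obtain rfl : x = mk k (a' 5) := ha 5
  obtain ⟨l₁, g₁, H₁⟩ := (R_mk_iff _ _ _).1 h₁
  obtain ⟨l₂, g₂, H₂⟩ := (R_mk_iff _ _ _).1 h₂
  obtain ⟨l₃, g₃, H₃⟩ := (R_mk_iff _ _ _).1 h₃
  replace H₁ := push_isComp (le_max_left l₁ (max l₂ l₃)) H₁
  replace H₂ := push_isComp ((le_max_left l₂ l₃).trans (le_max_right l₁ _)) H₂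
  replace H₃ := push_isComp ((le_max_right l₂ l₃).trans (le_max_right l₁ _)) H₃
  simp only [push_push] at H₁ H₂ H₃
  exact (R_mk_iff _ _ _).2 ⟨_, _, H₁.assoc H₂ H₃⟩

omit [Nonempty J] in
lemma p_R {x y z : ColimArr F} (h : R x y z) : Arr.IsComp (p x) (p y) (p z) := by
  obtain ⟨k, a, b, c, rfl, rfl, rfl, H⟩ := h
  exact H.map _

lemma existsUnique_fac (x y : ColimArr F) (f : Arr C) (h : t x = t y)
    (hf : Arr.IsComp f (p y) (p x)) : ∃! z, R z y x ∧ p z = f := by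
  obtain ⟨k, a, ha⟩ := exists_common bddAbove_range_of_finite ![x, y]
  obtain rfl : x = mk k (a 0) := ha 0
  obtain rfl : y = mk k (a 1) := ha 1
  obtain ⟨l, hl, e⟩ := exists_tgt_eq_tgt h
  obtain ⟨c, ⟨h₁, h₂⟩, -⟩ := (F.obj l).property.existsUnique_arr _ _ e f (by
    change Arr.IsComp f (base (push hl (a 1))) (base (push hl (a 0)))
    rwa [push, base_arrMap, push, base_arrMap])
  refine ⟨mk l c, ⟨⟨l, _, _, _, rfl, (mk_push hl _).symm, (mk_push hl _).symm, h₁⟩, h₂⟩, ?_⟩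
  rintro z ⟨h₃, h₄⟩
  obtain ⟨m, b, hb⟩ := exists_common bddAbove_range_of_finite
    ![mk k (a 0), mk k (a 1), mk l c, z]
  have hx : mk k (a 0) = mk m (b 0) := hb 0
  have hy : mk k (a 1) = mk m (b 1) := hb 1
  have hc : mk l c = mk m (b 2) := hb 2
  obtain rfl : z = mk m (b 3) := hb 3
  have h₅ : R (mk m (b 2)) (mk m (b 1)) (mk m (b 0)) := by
    rw [← hx, ← hy, ← hc]
    exact ⟨l, _, _, _, rfl, (mk_push hl _).symm, (mk_push hl _).symm, h₁⟩
  have h₆ : base (b 2) = f := (congrArg p hc.symm).trans h₂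
  rw [hx, hy] at h₃
  obtain ⟨n, g, H⟩ := (R_mk_iff _ _ _).1 h₃
  obtain ⟨n', g', H'⟩ := (R_mk_iff _ _ _).1 h₅
  replace H := push_isComp (le_max_left n n') H
  replace H' := push_isComp (le_max_right n n') H'
  simp only [push_push] at H H'
  have hm := g.trans (le_max_left n n')
  rw [hc, ← mk_push hm (b 2), ← mk_push hm (b 3)]
  congr 1
  -- Both candidates factor the same arrow at the stage `max n n'`, where a factorization with given
  -- base is unique.
  refine ((F.obj _).property.existsUnique_arr _ _ H.tgt_eq f ?_).unique ⟨H, ?_⟩ ⟨H', ?_⟩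
  · have : f = base (push hm (b 2)) := by
      rw [push, base_arrMap, h₆]
    rw [this]
    exact H'.map _
  · exact (base_arrMap _ _).trans h₄
  · exact (base_arrMap _ _).trans h₆

variable (F) in
/-- The colimit of a directed system of categories fibered in groupoids. -/
def arrData : ArrData C where
  A := ColimArr F
  s := s
  t := t
  R := R
  p := p
  s_s x := by obtain ⟨i, a, rfl⟩ := exists_mk x; rfl
  t_s x := by obtain ⟨i, a, rfl⟩ := exists_mk x; rfl
  s_t x := by obtain ⟨i, a, rfl⟩ := exists_mk x; rfl
  exists_comp x y h := by
    obtain ⟨k, a, ha⟩ := exists_common bddAbove_range_of_finite ![x, y]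
    obtain rfl : x = mk k (a 0) := ha 0
    obtain rfl : y = mk k (a 1) := ha 1
    obtain ⟨l, hl, e⟩ := exists_tgt_eq_src h
    obtain ⟨c, hc⟩ := Arr.exists_isComp e
    exact ⟨mk l c, l, _, _, _, (mk_push hl _).symm, (mk_push hl _).symm, rfl, hc⟩
  t_eq_s := by
    rintro _ _ _ ⟨k, a, b, c, rfl, rfl, rfl, H⟩
    exact (isComp_t_eq_s H).1
  comp_unique := R_unique
  s_comp := by
    rintro _ _ _ ⟨k, a, b, c, rfl, rfl, rfl, H⟩
    exact (isComp_t_eq_s H).2.1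
  t_comp := by
    rintro _ _ _ ⟨k, a, b, c, rfl, rfl, rfl, H⟩
    exact (isComp_t_eq_s H).2.2
  id_comp x := by
    obtain ⟨i, a, rfl⟩ := exists_mk x
    exact ⟨i, _, _, _, rfl, rfl, rfl, Arr.id_isComp a⟩
  comp_id x := by
    obtain ⟨i, a, rfl⟩ := exists_mk x
    exact ⟨i, _, _, _, rfl, rfl, rfl, Arr.isComp_id a⟩
  assoc := R_assoc
  p_s x := by
    obtain ⟨i, a, rfl⟩ := exists_mk x
    exact Arr.map_id _ _
  p_comp := p_R
  exists_lift x f hx hf := by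
    obtain ⟨i, a, rfl⟩ := exists_mk x
    obtain ⟨b, h₁, h₂⟩ := (F.obj i).property.exists_arr a.src f hf
    refine ⟨mk i b, ?_, h₂⟩
    rw [← hx]
    exact congrArg (fun x ↦ mk i (Arr.id x)) h₁
  existsUnique_fac := existsUnique_fac

/-- The morphisms to the colimit. -/
noncomputable def ι (j : J) : F.obj j ⟶ (arrData F).toGrpdOver :=
  ArrData.homTo (D := arrData F) (mk j) (fun _ ↦ rfl) (fun H ↦ ⟨j, _, _, _, rfl, rfl, rfl, H⟩)
    (fun _ ↦ rfl)

lemma arrMap_ι (j : J) (a : Arr (F.obj j).obj.obj) :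
    (arrData F).arrEquiv (arrMap (ι j) a) = mk j a :=
  ArrData.arrMap_homTo (D := arrData F) _ _ _ _ _

variable (F) in
/-- The colimit cocone of a directed system of categories fibered in groupoids. -/
noncomputable def cocone : Cocone F where
  pt := (arrData F).toGrpdOver
  ι :=
    { app j := ι j
      naturality i j φ := GrpdOver.hom_ext fun a ↦ (arrData F).arrEquiv.injective (by
        refine (arrMap_ι j (arrMap (F.map φ) a)).trans (Eq.trans ?_ (arrMap_ι i a).symm)
        exact mk_push (leOfHom φ) a) }

variable (F) in
/-- `DirColim.cocone F` is a colimit cocone. -/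
noncomputable def isColimit : IsColimit (cocone F) where
  desc c := ArrData.homFrom (D := arrData F)
    (lift (fun j a ↦ arrMap (c.ι.app j) a)
      (fun h a ↦ by rw [push, ← arrMap_comp, c.w]))
    (fun x ↦ by
      obtain ⟨i, a, rfl⟩ := exists_mk x
      exact Arr.map_id _ _)
    (by
      rintro _ _ _ ⟨k, a, b, c, rfl, rfl, rfl, H⟩
      exact H.map _)
    (fun x ↦ by
      obtain ⟨i, a, rfl⟩ := exists_mk x
      exact base_arrMap _ _)
  fac c j := GrpdOver.hom_ext fun a ↦ by
    refine (arrMap_comp (ι j) _ a).trans ((ArrData.arrMap_homFrom _ _ _ _ _).trans ?_)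
    rw [arrMap_ι]
    rfl
  uniq c m hm := GrpdOver.hom_ext fun a ↦ by
    refine Eq.trans ?_ (ArrData.arrMap_homFrom (D := arrData F) _ _ _ _ _).symm
    obtain ⟨a, rfl⟩ := (arrData F).arrEquiv.symm.surjective a
    rw [Equiv.apply_symm_apply]
    obtain ⟨i, a, rfl⟩ := exists_mk a
    rw [lift_mk, ← arrMap_ι, Equiv.symm_apply_apply, ← hm]
    rfl

end DirColim

open DirColim in
/-- Categories fibered in groupoids with few arrows are presentable. -/
lemma preservesColimit_coyoneda_of_bddAbove [Nonempty J] (A : GrpdOver C)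
    (hA : ∀ f : Arr A.obj.obj × Arr A.obj.obj × Arr A.obj.obj → J, BddAbove (Set.range f)) :
    PreservesColimit F (coyoneda.obj (op A)) := by
  have hA' (f : Arr A.obj.obj → J) : BddAbove (Set.range f) := by
    obtain ⟨k, hk⟩ := hA (fun x ↦ f x.1)
    refine ⟨k, ?_⟩
    rintro _ ⟨a, rfl⟩
    exact hk ⟨(a, a, a), rfl⟩
  refine preservesColimit_of_preserves_colimit_cocone (isColimit F)
    (Types.FilteredColimit.isColimitOf' _ _ (fun (φ : A ⟶ (arrData F).toGrpdOver) ↦ ?_)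
      (fun i (f : A ⟶ F.obj i) (g : A ⟶ F.obj i) (h : f ≫ ι i = g ≫ ι i) ↦ ?_))
  -- All arrows of `A` have representatives at one stage `k`, but identities and compositions are so
  -- far respected only in the colimit. Each single instance holds at some later stage, and at a
  -- common bound `m` the representatives form a functor. The triples in `hA` index the
  -- compositions.
  · obtain ⟨k, r, hr⟩ := exists_common hA' fun a ↦ (arrData F).arrEquiv (arrMap φ a)
    have hid (a : Arr A.obj.obj) : ∃ (l : J) (h : k ≤ l),
        ∃ y, push h (r (Arr.id a.src)) = Arr.id y := by
      have : mk k (r (Arr.id a.src)) = mk k (Arr.id (r (Arr.id a.src)).src) := by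
        rw [← hr]
        refine Eq.trans ?_ (congrArg s (hr (Arr.id a.src)))
        refine Eq.trans ?_ (ArrData.arrEquiv_src (D := arrData F) _)
        congr 1
        exact (Arr.map_id _ _)
      obtain ⟨l, h, e⟩ := mk_eq_mk'.1 this
      exact ⟨l, h, _, e.trans (Arr.map_id _ _)⟩
    have hcomp (x : Arr A.obj.obj × Arr A.obj.obj × Arr A.obj.obj) : ∃ (l : J) (h : k ≤ l),
        Arr.IsComp x.1 x.2.1 x.2.2 →
          Arr.IsComp (push h (r x.1)) (push h (r x.2.1)) (push h (r x.2.2)) := by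
      by_cases H : Arr.IsComp x.1 x.2.1 x.2.2
      · have := (ArrData.isComp_iff' (D := arrData F) _ _ _).1 (H.map φ.hom.toFunctor)
        erw [hr, hr, hr] at this
        obtain ⟨l, h, H'⟩ := (R_mk_iff _ _ _).1 this
        exact ⟨l, h, fun _ ↦ H'⟩
      · exact ⟨k, le_rfl, fun h ↦ (H h).elim⟩
    choose l₁ h₁ y e₁ using hid
    choose l₂ h₂ e₂ using hcomp
    obtain ⟨m₁, hm₁⟩ := hA' l₁
    obtain ⟨m₂, hm₂⟩ := hA l₂
    obtain ⟨m, hkm, g₁, g₂⟩ : ∃ m, k ≤ m ∧ m₁ ≤ m ∧ m₂ ≤ m :=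
      ⟨max k (max m₁ m₂), le_max_left _ _, (le_max_left _ _).trans (le_max_right _ _),
        (le_max_right _ _).trans (le_max_right _ _)⟩
    obtain ⟨ψ, hψ⟩ : ∃ ψ : A ⟶ F.obj m, ∀ a, arrMap ψ a = push hkm (r a) := by
      refine ⟨homOfArr (fun a ↦ push hkm (r a)) (fun x ↦ ?_) (fun {a b c} H ↦ ?_) (fun a ↦ ?_),
        fun a ↦ arrMap_homOfArr _ _ _ _ _⟩
      · have := congrArg (push ((hm₁ ⟨Arr.id x, rfl⟩).trans g₁)) (e₁ (Arr.id x))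
        rw [push_push] at this
        replace this : push hkm (r (Arr.id x)) = _ := this.trans (Arr.map_id _ _)
        rw [this]
        rfl
      · have := push_isComp ((hm₂ ⟨(a, b, c), rfl⟩).trans g₂) (e₂ (a, b, c) H)
        simpa only [push_push] using this
      · refine (base_arrMap _ _).trans ?_
        refine Eq.trans (congrArg p (hr a).symm) ?_
        exact (ArrData.base_eq (D := arrData F) _).symm.trans (base_arrMap _ _)
    refine ⟨m, ψ, ?_⟩
    change φ = ψ ≫ ι m
    refine GrpdOver.hom_ext fun a ↦ (arrData F).arrEquiv.injective ((hr a).trans ?_)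
    rw [arrMap_comp, arrMap_ι, hψ, mk_push]
  -- Maps with the same image in the colimit agree on each arrow at some stage, hence on all arrows
  -- at a common bound.
  · have h' (a : Arr A.obj.obj) : ∃ (k : J) (h : i ≤ k), push h (arrMap f a) = push h (arrMap g a) := by
      refine mk_eq_mk'.1 ?_
      rw [← arrMap_ι, ← arrMap_ι, ← arrMap_comp, h]
      rfl
    choose k hk e using h'
    obtain ⟨l, hl⟩ := hA' k
    have hil : i ≤ max i l := le_max_left _ _
    refine ⟨max i l, homOfLE hil, GrpdOver.hom_ext fun a ↦ ?_⟩
    have := congrArg (push ((hl ⟨a, rfl⟩).trans (le_max_right i l))) (e a)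
    rwa [push_push, push_push] at this

end DirectedColimits

/-! ### Groupoids as categories fibered in groupoids over a point -/

section GrpdAsFibered

/-- The category with one morphism. -/
abbrev Pt : Type u := Discrete PUnit.{u + 1}

lemma isFiberedInGroupoids_star (G : Type u) [Groupoid.{u} G] :
    IsFiberedInGroupoids (Functor.star G : G ⥤ Pt.{u}) where
  exists_lift {Y} x f := ⟨x, 𝟙 x, IsHomLift.of_fac _ _ _ (Subsingleton.elim _ _)
    (Subsingleton.elim _ _) (Subsingleton.elim _ _)⟩
  existsUnique_fac f g h _ := ⟨f ≫ Groupoid.inv g, ⟨by simp, Subsingleton.elim _ _⟩, fun k hk ↦ by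
    simp [← hk.1]⟩

/-- Groupoids, considered as categories fibered in groupoids over a point. -/
def grpdToGrpdOver : Grpd.{u, u} ⥤ GrpdOver Pt.{u} where
  obj G :=
    { obj := BasedCategory.ofFunctor (Functor.star G)
      property := isFiberedInGroupoids_star G }
  map F :=
    { hom :=
      { toFunctor := F
        w := Functor.punit_ext' _ _ } }

instance : grpdToGrpdOver.{u}.Faithful where
  map_injective h := congrArg (fun F ↦ F.hom.toFunctor) h

instance : grpdToGrpdOver.{u}.Full where
  map_surjective F := ⟨F.hom.toFunctor, rfl⟩

instance : grpdToGrpdOver.{u}.EssSurj where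
  mem_essImage E := by
    have (a b : E.obj.obj) (φ : a ⟶ b) : IsIso φ :=
      E.property.isIso (X := E.obj.p.obj a) φ (IsHomLift.of_fac _ _ _ rfl (Subsingleton.elim _ _)
        (Subsingleton.elim _ _))
    let G : Groupoid E.obj.obj := Groupoid.ofIsIso fun {a b} φ ↦ this a b φ
    let F : BasedFunctor (BasedCategory.ofFunctor (Functor.star E.obj.obj)) E.obj :=
      { toFunctor := 𝟭 E.obj.obj
        w := Functor.punit_ext' _ _ }
    let F' : BasedFunctor E.obj (BasedCategory.ofFunctor (Functor.star E.obj.obj)) :=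
      { toFunctor := 𝟭 E.obj.obj
        w := Functor.punit_ext' _ _ }
    refine ⟨@Grpd.of E.obj.obj G, ⟨⟨F⟩, ⟨F'⟩, ?_, ?_⟩⟩
    · exact GrpdOver.hom_ext fun _ ↦ rfl
    · exact GrpdOver.hom_ext fun _ ↦ rfl

/-- Limits, colimits and presentability of groupoids thereby become special cases of the results
over `C`. -/
instance : grpdToGrpdOver.{u}.IsEquivalence where

instance : HasLimits Grpd.{u, u} := Adjunction.has_limits_of_equivalence grpdToGrpdOver.{u}

instance : HasColimits Grpd.{u, u} := Adjunction.has_colimits_of_equivalence grpdToGrpdOver.{u}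

/-- Groupoids with few morphisms are presentable. -/
lemma Grpd.preservesColimit_coyoneda_of_bddAbove {J : Type u} [LinearOrder J] [Nonempty J]
    (F : J ⥤ Grpd.{u, u}) (A : Grpd.{u, u})
    (hA : ∀ f : Arr A × Arr A × Arr A → J, BddAbove (Set.range f)) :
    PreservesColimit F (coyoneda.obj (op A)) := by
  have := _root_.preservesColimit_coyoneda_of_bddAbove (F ⋙ grpdToGrpdOver)
    (grpdToGrpdOver.obj A) hA
  exact preservesColimit_of_natIso F
    (show grpdToGrpdOver ⋙ coyoneda.obj (op (grpdToGrpdOver.obj A)) ≅ coyoneda.obj (op A) from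
      NatIso.ofComponents (fun G ↦ (Functor.FullyFaithful.ofFullyFaithful
        grpdToGrpdOver).homEquiv.toIso.symm))

end GrpdAsFibered

/-! ### The small object argument for small families of morphisms -/

section SmallObjectArgument

/-- A small family of morphisms whose sources are presentable permits the small object argument.
Here `X` is a bound on the size of the sources. -/
lemma hasSmallObjectArgument_ofHoms {M : Type w} [Category.{u} M] [HasColimits M] {ι : Type u}
    {A B : ι → M} (f : ∀ i, A i ⟶ B i) (X : Type u)
    (h : ∀ (J : Type u) [LinearOrder J] [Nonempty J], (∀ g : X → J, BddAbove (Set.range g)) →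
      ∀ (i : ι) (F : J ⥤ M), PreservesColimit F (coyoneda.obj (op (A i)))) :
    MorphismProperty.HasSmallObjectArgument.{u} (MorphismProperty.ofHoms f) := by
  obtain ⟨κ, hκ, hX⟩ : ∃ (κ : Cardinal.{u}) (_ : κ.IsRegular), HasCardinalLT X κ := by
    -- The successor makes `κ` regular and strictly larger than `X`, so that functions from `X` to
    -- the ordinal of `κ` are bounded.
    refine ⟨Order.succ (max Cardinal.aleph0 (Cardinal.mk X)),
      Cardinal.isRegular_succ (le_max_left _ _), ?_⟩
    rw [hasCardinalLT_iff_cardinal_mk_lt, Order.lt_succ_iff]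
    exact le_max_right _ _
  have : Fact κ.IsRegular := ⟨hκ⟩
  have : Nonempty κ.ord.ToType := IsCardinalFiltered.nonempty _ κ
  let : OrderBot κ.ord.ToType := WellFoundedLT.toOrderBot κ.ord.ToType
  refine ⟨κ, inferInstance, inferInstance, ?_⟩
  exact
    { preservesColimit := by
        rintro _ _ _ _ _ ⟨i⟩ _ hf
        refine h _ (fun g ↦ ?_) i _
        refine ⟨IsCardinalFiltered.max g hX, ?_⟩
        rintro _ ⟨x, rfl⟩
        exact leOfHom (IsCardinalFiltered.toMax g hX x) }

end SmallObjectArgument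

/-! ### Fibrations of groupoids -/

section LiftingFunctors

/-- A functor which is surjective on objects and fully faithful has the right lifting property with
respect to all functors which are injective on objects. -/
lemma exists_lift_of_fullyFaithful {A B G H : Type*} [Category* A] [Category* B] [Category* G]
    [Category* H] (i : A ⥤ B) (hi : Function.Injective i.obj) (q : G ⥤ H)
    (hq : Function.Surjective q.obj) [q.Full] [q.Faithful] (a : A ⥤ G) (b : B ⥤ H)
    (h : a ⋙ q = i ⋙ b) : ∃ l : B ⥤ G, i ⋙ l = a ∧ l ⋙ q = b := by
  classical
  -- Objects in the image of `i` have a prescribed lift, unambiguous by injectivity, and the others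
  -- get an arbitrary one. Full faithfulness then dictates the values on morphisms.
  have hex (y : B) : ∃ z : G, q.obj z = b.obj y ∧ ∀ x, i.obj x = y → z = a.obj x := by
    by_cases hy : ∃ x, i.obj x = y
    · obtain ⟨x, rfl⟩ := hy
      exact ⟨a.obj x, Functor.congr_obj h x, fun x' hx' ↦ by rw [hi hx']⟩
    · obtain ⟨z, hz⟩ := hq (b.obj y)
      exact ⟨z, hz, fun x hx ↦ (hy ⟨x, hx⟩).elim⟩
  choose o ho ho' using hex
  let l : B ⥤ G :=
    { obj := o
      map := fun {x y} f ↦ q.preimage (eqToHom (ho x) ≫ b.map f ≫ eqToHom (ho y).symm)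
      map_id := fun x ↦ q.map_injective (by simp)
      map_comp := fun f g ↦ q.map_injective (by simp) }
  refine ⟨l, ?_, ?_⟩
  · refine CategoryTheory.Functor.ext (fun x ↦ ho' _ x rfl) fun x y f ↦ q.map_injective ?_
    have := Functor.congr_hom h f
    dsimp at this
    simp [l, this, eqToHom_map]
  · exact CategoryTheory.Functor.ext ho fun x y f ↦ by simp [l]

end LiftingFunctors

/-! ### Functors from the groupoids `Δⁿ` -/

namespace SimplexGroupoid

variable {G : Type u} [Groupoid.{u} G] {H : Type u} [Groupoid.{u} H] {n : ℕ}

/-- The morphism between two objects of `Δⁿ`. -/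
def arrow (i j : Fin (n + 1)) : (⟨i⟩ : SimplexGroupoid.{u} n) ⟶ ⟨j⟩ := PUnit.unit

instance (i j : SimplexGroupoid.{u} n) : Subsingleton (i ⟶ j) :=
  inferInstanceAs (Subsingleton PUnit)

/-- Every morphism `i ⟶ j` is the inverse of `0 ⟶ i` followed by `0 ⟶ j`, so the arrows out of the
vertex `0` suffice. -/
lemma functor_ext {F F' : SimplexGroupoid.{u} n ⥤ G}
    (h : ∀ i, Arr.map F ⟨arrow 0 i⟩ = Arr.map F' ⟨arrow 0 i⟩) : F = F' := by
  have hobj (i : Fin (n + 1)) : F.obj ⟨i⟩ = F'.obj ⟨i⟩ := congrArg Arr.tgt (h i)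
  have hmap (i : Fin (n + 1)) : F.map (arrow 0 i) = eqToHom (hobj 0) ≫ F'.map (arrow 0 i) ≫
      eqToHom (hobj i).symm := by
    have := h i
    simp only [Arr.map, Arr.mk.injEq] at this
    exact (conj_eqToHom_iff_heq' _ _ _ _).2 this.2.2
  refine CategoryTheory.Functor.ext (fun i ↦ hobj i.vertex) ?_
  rintro ⟨i⟩ ⟨j⟩ f
  have hf : arrow.{u} 0 i ≫ f = arrow 0 j := Subsingleton.elim _ _
  rw [← cancel_epi (F.map (arrow.{u} 0 i)), ← F.map_comp, hf, hmap, hmap, ← hf, F'.map_comp]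
  simp

lemma arrow_self (i : Fin (n + 1)) : (⟨arrow.{u} i i⟩ : Arr _) = Arr.id ⟨i⟩ := rfl

lemma functor_ext_zero {F F' : SimplexGroupoid.{u} 0 ⥤ G} (h : F.obj ⟨0⟩ = F'.obj ⟨0⟩) :
    F = F' :=
  functor_ext fun i ↦ by
    obtain rfl : i = 0 := Fin.fin_one_eq_zero i
    rw [arrow_self, Arr.map_id, Arr.map_id, h]

lemma functor_ext_one {F F' : SimplexGroupoid.{u} 1 ⥤ G}
    (h : Arr.map F ⟨arrow 0 1⟩ = Arr.map F' ⟨arrow 0 1⟩) : F = F' :=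
  functor_ext fun i ↦ by
    obtain rfl | rfl : i = 0 ∨ i = 1 := by
      fin_cases i
      exacts [.inl rfl, .inr rfl]
    · rw [arrow_self, Arr.map_id, Arr.map_id]
      exact congrArg (fun f ↦ Arr.id f.src) h
    · exact h

/-- The functor from `Δ¹` given by a morphism. -/
def ofHom {a b : G} (φ : a ⟶ b) : SimplexGroupoid.{u} 1 ⥤ G :=
  let x : Fin (1 + 1) → G := ![a, b]
  let c : ∀ i, a ⟶ x i := Fin.cons (𝟙 _) (Fin.cons φ (fun i ↦ i.elim0))
  { obj i := x i.vertex
    map {i j} _ := Groupoid.inv (c i.vertex) ≫ c j.vertex }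

lemma map_ofHom {a b : G} (φ : a ⟶ b) : Arr.map (ofHom φ) ⟨arrow 0 1⟩ = ⟨φ⟩ := by
  refine Arr.mk_inj.2 ?_
  change Groupoid.inv (𝟙 a) ≫ φ = φ
  simp

/-- The inclusion of a vertex. -/
abbrev vertexFunctor : SimplexGroupoid.{u} 0 ⥤ SimplexGroupoid.{u} 1 :=
  toSimplexGroupoid (A := SimplexGroupoid.{u} 0) (fun _ ↦ 0)

/-- The right lifting property with respect to the inclusion of a vertex. -/
lemma exists_lift_vertexFunctor_iff (q : G ⥤ H) :
    (∀ (a : SimplexGroupoid.{u} 0 ⥤ G) (b : SimplexGroupoid.{u} 1 ⥤ H),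
      a ⋙ q = vertexFunctor ⋙ b → ∃ l : SimplexGroupoid.{u} 1 ⥤ G,
        vertexFunctor ⋙ l = a ∧ l ⋙ q = b) ↔
      ∀ (a : G) (φ : Arr H), φ.src = q.obj a → ∃ ψ : Arr G, ψ.src = a ∧ Arr.map q ψ = φ := by
  constructor
  · rintro hq a ⟨φ⟩ h
    obtain ⟨l, hl₁, hl₂⟩ := hq ((Functor.const _).obj a) (ofHom φ) (functor_ext_zero h.symm)
    refine ⟨Arr.map l ⟨arrow 0 1⟩, Functor.congr_obj hl₁ ⟨0⟩, ?_⟩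
    rw [← Arr.map_comp, hl₂, map_ofHom]
  · intro hq a b h
    obtain ⟨⟨ψ⟩, hψ, hψ'⟩ := hq (a.obj ⟨0⟩) (Arr.map b ⟨arrow 0 1⟩)
      (Functor.congr_obj h ⟨0⟩).symm
    refine ⟨ofHom ψ, functor_ext_zero hψ, functor_ext_one ?_⟩
    rw [Arr.map_comp, map_ofHom, hψ']

end SimplexGroupoid

/-! ### Isofibrations and surjective equivalences of groupoids -/

section GrpdFibrations

/-- A morphism in the category of groupoids, as a functor. -/
abbrev grpdFunctor {G H : Grpd.{u, u}} (q : G ⟶ H) : G ⥤ H := q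

lemma grpd_hasLiftingProperty_iff {A B G H : Grpd.{u, u}} (i : A ⟶ B) (q : G ⟶ H) :
    HasLiftingProperty i q ↔ ∀ (a : A ⥤ G) (b : B ⥤ H),
      a ⋙ (grpdFunctor q) = (grpdFunctor i) ⋙ b →
      ∃ l : B ⥤ G, (grpdFunctor i) ⋙ l = a ∧ l ⋙ (grpdFunctor q) = b := by
  constructor
  · rintro ⟨h⟩ a b w
    obtain ⟨⟨l, h₁, h₂⟩⟩ := h (f := show A ⟶ G from a) (g := show B ⟶ H from b) ⟨w⟩
    exact ⟨l, h₁, h₂⟩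
  · intro h
    refine ⟨fun {a b} sq ↦ ?_⟩
    obtain ⟨l, h₁, h₂⟩ := h a b sq.w
    exact ⟨⟨l, h₁, h₂⟩⟩

/-- Fibrations of groupoids are the isofibrations. -/
lemma grpdFibrations_iff {G H : Grpd.{u, u}} (q : G ⟶ H) :
    grpdFibrations q ↔ ∀ (a : G) (φ : Arr H), φ.src = (grpdFunctor q).obj a →
      ∃ ψ : Arr G, ψ.src = a ∧ Arr.map (grpdFunctor q) ψ = φ := by
  rw [← SimplexGroupoid.exists_lift_vertexFunctor_iff, grpdFibrations]
  refine Iff.trans ⟨fun h ↦ ?_, fun h ↦ ?_⟩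
    (grpd_hasLiftingProperty_iff vertexInclusion q)
  · exact h _ ⟨()⟩
  · rintro _ _ _ ⟨⟩
    exact h

/-- The functors of groupoids which are surjective on objects and fully faithful. -/
structure IsSurjectiveEquivalence {G H : Type*} [Category* G] [Category* H] (q : G ⥤ H) :
    Prop where
  surjective : Function.Surjective q.obj
  full : q.Full
  faithful : q.Faithful

/-- An essentially surjective isofibration is surjective on objects: lift an isomorphism from an
object in the image to the given object, and take the target of the lift. -/
lemma isSurjectiveEquivalence_iff {G H : Grpd.{u, u}} (q : G ⟶ H) :
    IsSurjectiveEquivalence (grpdFunctor q) ↔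
      (grpdWeakEquivalences ⊓ grpdFibrations) q := by
  constructor
  · rintro ⟨h₁, h₂, h₃⟩
    refine ⟨show Functor.IsEquivalence (grpdFunctor q) from
      { essSurj := ⟨fun y ↦ ?_⟩ }, ?_⟩
    · obtain ⟨x, rfl⟩ := h₁ y
      exact ⟨x, ⟨Iso.refl _⟩⟩
    · rw [grpdFibrations_iff]
      rintro a ⟨φ⟩ rfl
      rename_i b
      obtain ⟨b, rfl⟩ := h₁ b
      obtain ⟨ψ, rfl⟩ := h₂.map_surjective φ
      exact ⟨⟨ψ⟩, rfl, rfl⟩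
  · rintro ⟨h, h'⟩
    rw [grpdFibrations_iff] at h'
    replace h : Functor.IsEquivalence (grpdFunctor q) := h
    refine ⟨fun y ↦ ?_, inferInstance, inferInstance⟩
    obtain ⟨ψ, -, h₂⟩ := h' _ ⟨(Functor.objObjPreimageIso (grpdFunctor q) y).hom⟩ rfl
    exact ⟨ψ.tgt, congrArg Arr.tgt h₂⟩

lemma boundaryInclusion_injective (i : Fin 3) :
    Function.Injective (grpdFunctor (boundaryInclusion.{u} i).hom).obj := by
  fin_cases i
  · rintro ⟨⟨⟩⟩
  · rintro ⟨⟨x⟩⟩ ⟨⟨y⟩⟩ h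
    obtain rfl : x = y := congrArg SimplexGroupoid.vertex h
    rfl
  · rintro ⟨x, ⟨⟩⟩ ⟨y, ⟨⟩⟩ h
    obtain rfl : x = y := h
    rfl

lemma discreteFunctor_ext {α : Type*} {G : Type*} [Category* G] {F F' : Discrete α ⥤ G}
    (h : ∀ x, F.obj ⟨x⟩ = F'.obj ⟨x⟩) : F = F' :=
  Arr.functor_ext fun f ↦ by
    obtain ⟨f⟩ := f
    rename_i x y
    obtain ⟨x⟩ := x
    obtain ⟨y⟩ := y
    obtain rfl : x = y := Discrete.eq_of_hom f
    obtain rfl : f = 𝟙 _ := Subsingleton.elim _ _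
    exact (Arr.map_id F _).trans ((congrArg Arr.id (h _)).trans (Arr.map_id F' _).symm)

/-- The generating cofibrations of groupoids detect trivial fibrations. -/
lemma boundaryInclusion_rlp_iff {G H : Grpd.{u, u}} (q : G ⟶ H) :
    (∀ i, HasLiftingProperty (boundaryInclusion.{u} i).hom q) ↔
      IsSurjectiveEquivalence (grpdFunctor q) := by
  constructor
  · intro h
    let q' : G ⥤ H := q
    refine ⟨fun y ↦ ?_, ⟨fun {a b} φ ↦ ?_⟩, ⟨fun {a b} φ φ' hφ ↦ ?_⟩⟩
    · obtain ⟨l, -, hl⟩ := (grpd_hasLiftingProperty_iff _ _).1 (h 0) (Functor.empty G)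
        ((Functor.const (SimplexGroupoid 0)).obj y) (Functor.empty_ext' _ _)
      exact ⟨_, Functor.congr_obj hl ⟨0⟩⟩
    · let x : Fin 2 → G := ![a, b]
      let u : Discrete (ULift.{u} (Fin 2)) ⥤ G := Discrete.functor fun i ↦ x i.down
      obtain ⟨l, hl₁, hl₂⟩ := (grpd_hasLiftingProperty_iff _ _).1 (h 1) u
        (SimplexGroupoid.ofHom φ) (discreteFunctor_ext fun ⟨i⟩ ↦ by fin_cases i <;> rfl)
      obtain ⟨ψ, hψ⟩ := Arr.exists_eq_mk (Arr.map l ⟨SimplexGroupoid.arrow 0 1⟩)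
        (Functor.congr_obj hl₁ ⟨⟨0⟩⟩) (Functor.congr_obj hl₁ ⟨⟨1⟩⟩)
      refine ⟨ψ, ?_⟩
      have : Arr.map q' (Arr.map l ⟨SimplexGroupoid.arrow 0 1⟩) = ⟨φ⟩ := by
        rw [← Arr.map_comp, hl₂]
        exact SimplexGroupoid.map_ofHom φ
      rw [hψ] at this
      exact Arr.mk_inj.1 this
    · replace hφ : q'.map φ = q'.map φ' := hφ
      -- Faithfulness: `q` sends the loop `γ` to an identity, so the functor `Δ² × Bℤ ⥤ G` which
      -- sends the generator of `ℤ` to `γ` lies over a constant functor on `Δ²`. A lift defined on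
      -- `Δ²` forgets the `ℤ`-component, which forces `γ` to be trivial.
      let γ : CategoryTheory.End a := φ ≫ Groupoid.inv φ'
      have hγ : q'.mapEnd a γ = 1 := by
        refine (q'.map_comp φ (Groupoid.inv φ')).trans ?_
        rw [hφ, ← q'.map_comp, Groupoid.comp_inv, q'.map_id]
        rfl
      let P : SingleObj (ULift.{u} (Multiplicative ℤ)) ⥤ G :=
        SingleObj.functor ((zpowersHom _ γ).comp MulEquiv.ulift.toMonoidHom)
      obtain ⟨l, hl₁, hl₂⟩ := (grpd_hasLiftingProperty_iff _ _).1 (h 2)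
        (CategoryTheory.Prod.snd (SimplexGroupoid.{u} 2) _ ⋙ P)
        ((Functor.const (SimplexGroupoid 2)).obj (q'.obj a)) (by
          refine CategoryTheory.Functor.hext (fun _ ↦ rfl) ?_
          rintro ⟨x, ⟨⟩⟩ ⟨y, ⟨⟩⟩ ⟨f, ⟨n⟩⟩
          refine heq_of_eq ?_
          change q'.mapEnd a (γ ^ n.toAdd) = 1
          rw [map_zpow, hγ, one_zpow])
      have key : Arr.map l (Arr.id ⟨0⟩) = ⟨γ ^ (1 : ℤ)⟩ := congrArg (fun F ↦ Arr.map F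
        ⟨show ((⟨0⟩, SingleObj.star _) : SimplexGroupoid.{u} 2 × SingleObj (ULift.{u}
          (Multiplicative ℤ))) ⟶ (⟨0⟩, SingleObj.star _) from
          (𝟙 _, ⟨Multiplicative.ofAdd 1⟩)⟩) hl₁
      rw [zpow_one] at key
      have hla : l.obj ⟨0⟩ = a := Functor.congr_obj hl₁ (⟨0⟩, SingleObj.star _)
      replace key : 𝟙 a = φ ≫ Groupoid.inv φ' :=
        Arr.mk_inj.1 ((congrArg Arr.id hla).symm.trans ((Arr.map_id l ⟨0⟩).symm.trans key))
      rw [← Category.comp_id φ, ← Groupoid.inv_comp φ', ← Category.assoc, ← key,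
        Category.id_comp]
  · rintro ⟨h₁, h₂, h₃⟩ i
    rw [grpd_hasLiftingProperty_iff]
    exact exists_lift_of_fullyFaithful _ (boundaryInclusion_injective i) _ h₁

end GrpdFibrations

/-! ### Model structures detected by functors to groupoids -/

section DetectedModelStructure

lemma grpdWeakEquivalences_iff {G H : Grpd.{u, u}} (f : G ⟶ H) :
    grpdWeakEquivalences f ↔ (grpdFunctor f).IsEquivalence := Iff.rfl

instance : grpdWeakEquivalences.{u}.HasTwoOutOfThreeProperty where
  comp_mem f g hf hg := by
    rw [grpdWeakEquivalences_iff] at *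
    exact Functor.isEquivalence_trans (grpdFunctor f) (grpdFunctor g)
  of_postcomp f g hg hfg := by
    rw [grpdWeakEquivalences_iff] at *
    have : (grpdFunctor f ⋙ grpdFunctor g).IsEquivalence := hfg
    exact Functor.isEquivalence_of_comp_right (grpdFunctor f) (grpdFunctor g)
  of_precomp f g hf hfg := by
    rw [grpdWeakEquivalences_iff] at *
    have : (grpdFunctor f ⋙ grpdFunctor g).IsEquivalence := hfg
    exact Functor.isEquivalence_of_comp_left (grpdFunctor f) (grpdFunctor g)

variable {M : Type (u + 1)} [Category.{u} M] {ι : Type u}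

/-- The morphisms which become equivalences under all functors in a family. -/
def detectedWeakEquivalences (R : ι → M ⥤ Grpd.{u, u}) : MorphismProperty M :=
  fun _ _ f ↦ ∀ x, grpdWeakEquivalences ((R x).map f)

/-- The morphisms which become fibrations under all functors in a family. -/
def detectedFibrations (R : ι → M ⥤ Grpd.{u, u}) : MorphismProperty M :=
  fun _ _ f ↦ ∀ x, grpdFibrations ((R x).map f)

instance (R : ι → M ⥤ Grpd.{u, u}) : (detectedWeakEquivalences R).HasTwoOutOfThreeProperty where
  comp_mem f g hf hg x := by
    rw [Functor.map_comp]
    exact MorphismProperty.comp_mem _ _ _ (hf x) (hg x)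
  of_postcomp f g hg hfg x := by
    have := hfg x
    rw [Functor.map_comp] at this
    exact MorphismProperty.of_postcomp _ _ _ (hg x) this
  of_precomp f g hf hfg x := by
    have := hfg x
    rw [Functor.map_comp] at this
    exact MorphismProperty.of_precomp _ _ _ (hf x) this

variable (L : ι → Grpd.{u, u} ⥤ M)

/-- The images of the generating cofibrations of groupoids. -/
abbrev inducedGeneratingCofibrations : MorphismProperty M :=
  MorphismProperty.ofHoms fun j : ι × Fin 3 ↦ (L j.1).map (boundaryInclusion.{u} j.2).hom

/-- The images of the generating trivial cofibration of groupoids. -/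
abbrev inducedGeneratingTrivialCofibrations : MorphismProperty M :=
  MorphismProperty.ofHoms fun x : ι ↦ (L x).map vertexInclusion.{u}

variable {L} {R : ι → M ⥤ Grpd.{u, u}} (adj : ∀ x, L x ⊣ R x)

lemma ofHoms_rlp_iff {α : Type*} {A B : α → M} (f : ∀ a, A a ⟶ B a) {X Y : M} (p : X ⟶ Y) :
    (MorphismProperty.ofHoms f).rlp p ↔ ∀ a, HasLiftingProperty (f a) p := by
  constructor
  · intro h a
    exact h _ ⟨a⟩
  · rintro h _ _ _ ⟨a⟩
    exact h a

include adj

lemma rlp_inducedGeneratingTrivialCofibrations :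
    (inducedGeneratingTrivialCofibrations L).rlp = detectedFibrations R := by
  ext X Y p
  rw [ofHoms_rlp_iff]
  refine forall_congr' fun x ↦ ?_
  rw [(adj x).hasLiftingProperty_iff, grpdFibrations, ofHoms_rlp_iff]
  simp

lemma rlp_inducedGeneratingCofibrations_iff {X Y : M} (p : X ⟶ Y) :
    (inducedGeneratingCofibrations L).rlp p ↔
      ∀ x, IsSurjectiveEquivalence (grpdFunctor ((R x).map p)) := by
  rw [ofHoms_rlp_iff, Prod.forall]
  refine forall_congr' fun x ↦ ?_
  simp only [(adj x).hasLiftingProperty_iff]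
  exact boundaryInclusion_rlp_iff _

lemma rlp_inducedGeneratingCofibrations :
    (inducedGeneratingCofibrations L).rlp =
      detectedFibrations R ⊓ detectedWeakEquivalences R := by
  ext X Y p
  rw [rlp_inducedGeneratingCofibrations_iff adj]
  simp only [isSurjectiveEquivalence_iff]
  exact ⟨fun h ↦ ⟨fun x ↦ (h x).2, fun x ↦ (h x).1⟩, fun h x ↦ ⟨h.2 x, h.1 x⟩⟩

/-- Arrows in the values of a right adjoint are jointly detected. -/
lemma arr_ext_of_isLimit {x : ι} {X : M} {J : Type*} {Y : J → M} (p : ∀ j, X ⟶ Y j)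
    (hp : ∀ (Z : M) (f g : Z ⟶ X), (∀ j, f ≫ p j = g ≫ p j) → f = g)
    (φ ψ : Arr ((R x).obj X))
    (h : ∀ j, Arr.map (grpdFunctor ((R x).map (p j))) φ =
      Arr.map (grpdFunctor ((R x).map (p j))) ψ) : φ = ψ := by
  obtain ⟨φ⟩ := φ
  obtain ⟨ψ⟩ := ψ
  -- An arrow of `(R x).obj X` is a functor from `Δ¹`, hence by adjunction a map to `X`, and maps to
  -- `X` are detected by the `p j`.
  have key : SimplexGroupoid.ofHom φ = SimplexGroupoid.ofHom ψ := by
    let f : simplexGrpd 1 ⟶ (R x).obj X := SimplexGroupoid.ofHom φ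
    let g : simplexGrpd 1 ⟶ (R x).obj X := SimplexGroupoid.ofHom ψ
    change f = g
    apply ((adj x).homEquiv _ _).symm.injective
    refine hp _ _ _ fun j ↦ ?_
    rw [← (adj x).homEquiv_naturality_right_symm, ← (adj x).homEquiv_naturality_right_symm]
    congr 1
    apply SimplexGroupoid.functor_ext_one
    exact (congrArg _ (SimplexGroupoid.map_ofHom φ)).trans
      ((h j).trans (congrArg _ (SimplexGroupoid.map_ofHom ψ).symm))
  rw [← SimplexGroupoid.map_ofHom φ, key, SimplexGroupoid.map_ofHom ψ]

/-- Every object is fibrant, because all arrows with a given source have the same image as the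
identity of that source. -/
lemma detectedFibrations_to_terminal {X T : M} (hT : ∀ (Z : M) (f g : Z ⟶ T), f = g)
    (p : X ⟶ T) : detectedFibrations R p := by
  intro x
  rw [grpdFibrations_iff]
  exact fun a φ _ ↦ ⟨Arr.id a, rfl, arr_ext_of_isLimit adj (J := Empty) (Y := Empty.elim)
    (fun j ↦ j.elim) (fun Z f g _ ↦ hT Z f g) _ _ fun j ↦ j.elim⟩

/-- An arrow in the value of `R x` at a product is determined by its two projections, so it suffices
to lift pairs of arrows. -/
lemma detectedFibrations_prodLift [HasBinaryProducts M] {P X Y : M} (s : P ⟶ X) (t : P ⟶ Y)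
    (h : ∀ (x : ι) (a : (R x).obj P) (φ : Arr ((R x).obj X)) (ψ : Arr ((R x).obj Y)),
      φ.src = (grpdFunctor ((R x).map s)).obj a → ψ.src = (grpdFunctor ((R x).map t)).obj a →
      ∃ χ : Arr ((R x).obj P), χ.src = a ∧ Arr.map (grpdFunctor ((R x).map s)) χ = φ ∧
        Arr.map (grpdFunctor ((R x).map t)) χ = ψ) :
    detectedFibrations R (prod.lift s t) := by
  intro x
  rw [grpdFibrations_iff]
  intro a φ hφ
  have h₁ : (R x).map (prod.lift s t) ≫ (R x).map prod.fst = (R x).map s := by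
    rw [← Functor.map_comp, prod.lift_fst]
  have h₂ : (R x).map (prod.lift s t) ≫ (R x).map prod.snd = (R x).map t := by
    rw [← Functor.map_comp, prod.lift_snd]
  obtain ⟨χ, hχ, hs, ht⟩ := h x a (Arr.map (grpdFunctor ((R x).map prod.fst)) φ)
    (Arr.map (grpdFunctor ((R x).map prod.snd)) φ)
    ((congrArg _ hφ).trans (Functor.congr_obj h₁ a))
    ((congrArg _ hφ).trans (Functor.congr_obj h₂ a))
  refine ⟨χ, hχ, arr_ext_of_isLimit adj (J := WalkingPair) (Y := fun j ↦ WalkingPair.rec X Y j)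
    (fun j ↦ WalkingPair.rec prod.fst prod.snd j) ?_ _ _ ?_⟩
  · intro Z f g hfg
    exact prod.hom_ext (hfg .left) (hfg .right)
  · rintro (_ | _)
    · exact (congrArg (fun F ↦ Arr.map (grpdFunctor F) χ) h₁).trans hs
    · exact (congrArg (fun F ↦ Arr.map (grpdFunctor F) χ) h₂).trans ht

omit adj

/-- Path objects for the model structure which is detected by the functors `R x`. -/
structure DetectedPathObject (R : ι → M ⥤ Grpd.{u, u}) (B : M) where
  P : M
  s : P ⟶ B
  t : P ⟶ B
  c : B ⟶ P
  c_s : c ≫ s = 𝟙 B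
  c_t : c ≫ t = 𝟙 B
  exists_lift (x : ι) (a : (R x).obj P) (φ ψ : Arr ((R x).obj B)) :
    φ.src = (grpdFunctor ((R x).map s)).obj a → ψ.src = (grpdFunctor ((R x).map t)).obj a →
      ∃ χ : Arr ((R x).obj P), χ.src = a ∧ Arr.map (grpdFunctor ((R x).map s)) χ = φ ∧
        Arr.map (grpdFunctor ((R x).map t)) χ = ψ
  nonempty_iso (x : ι) : Nonempty (grpdFunctor ((R x).map s) ≅ grpdFunctor ((R x).map t))

/-- Homotopy equivalences are weak equivalences. -/
lemma detectedWeakEquivalences_of_homotopy {A B : M} (f : A ⟶ B) (r : B ⟶ A)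
    (PA : DetectedPathObject R A) (PB : DetectedPathObject R B)
    (η : A ⟶ PA.P) (hηs : η ≫ PA.s = 𝟙 A) (hηt : η ≫ PA.t = f ≫ r)
    (ε : B ⟶ PB.P) (hεs : ε ≫ PB.s = 𝟙 B) (hεt : ε ≫ PB.t = r ≫ f) :
    detectedWeakEquivalences R f := by
  intro x
  -- Under `R x` the two end point maps of a path object become isomorphic functors, so a homotopy
  -- becomes a natural isomorphism.
  have key {Y : M} (PY : DetectedPathObject R Y) (θ : Y ⟶ PY.P) (k : Y ⟶ Y) (hs : θ ≫ PY.s = 𝟙 Y)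
      (ht : θ ≫ PY.t = k) : Nonempty (𝟭 ((R x).obj Y) ≅ grpdFunctor ((R x).map k)) := by
    obtain ⟨e⟩ := PY.nonempty_iso x
    have h₂ : grpdFunctor ((R x).map θ) ⋙ grpdFunctor ((R x).map PY.t) =
      grpdFunctor ((R x).map k) := ((R x).map_comp _ _).symm.trans (congrArg _ ht)
    have h₃ : grpdFunctor ((R x).map θ) ⋙ grpdFunctor ((R x).map PY.s) = 𝟭 _ :=
      (((R x).map_comp _ _).symm.trans (congrArg _ hs)).trans ((R x).map_id _)
    exact ⟨eqToIso h₃.symm ≪≫ Functor.isoWhiskerLeft _ e ≪≫ eqToIso h₂⟩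
  obtain ⟨e₁⟩ := key PA η _ hηs hηt
  obtain ⟨e₂⟩ := key PB ε _ hεs hεt
  exact Functor.IsEquivalence.mk' (F := grpdFunctor ((R x).map f)) (grpdFunctor ((R x).map r))
    (e₁ ≪≫ eqToIso ((R x).map_comp f r)) (e₂ ≪≫ eqToIso ((R x).map_comp r f)).symm

include adj

/-- Quillen's path object argument: as `A` is fibrant, `f` has a retraction `r`. Lifting against the
fibration from the path object of `B` to `B × B` gives a homotopy from the identity of `B` to `r ≫
f`, so `f` is a homotopy equivalence. -/
lemma llp_detectedFibrations_le [HasBinaryProducts M] [HasTerminal M]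
    (path : ∀ B, DetectedPathObject R B) :
    (detectedFibrations R).llp ≤ detectedWeakEquivalences R := by
  intro A B f hf
  have := hf _ (detectedFibrations_to_terminal adj (X := A) (fun _ _ _ ↦ Subsingleton.elim _ _)
    (terminal.from A))
  have sq : CommSq (𝟙 A) f (terminal.from A) (terminal.from B) := ⟨Subsingleton.elim _ _⟩
  let r := sq.lift
  have hr : f ≫ r = 𝟙 A := sq.fac_left
  let PB := path B
  have := hf _ (detectedFibrations_prodLift adj PB.s PB.t PB.exists_lift)
  have sq' : CommSq (f ≫ PB.c) f (prod.lift PB.s PB.t) (prod.lift (𝟙 B) (r ≫ f)) := ⟨by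
    apply prod.hom_ext
    · rw [Category.assoc, prod.lift_fst, Category.assoc, PB.c_s, Category.assoc, prod.lift_fst]
    · rw [Category.assoc, prod.lift_snd, Category.assoc, PB.c_t, Category.assoc, prod.lift_snd,
        reassoc_of% hr, Category.comp_id]⟩
  let l := sq'.lift
  have hs : l ≫ PB.s = 𝟙 B := by
    have := sq'.fac_right =≫ prod.fst
    rwa [Category.assoc, prod.lift_fst, prod.lift_fst] at this
  have ht : l ≫ PB.t = r ≫ f := by
    have := sq'.fac_right =≫ prod.snd
    rwa [Category.assoc, prod.lift_snd, prod.lift_snd] at this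
  exact detectedWeakEquivalences_of_homotopy f r (path A) PB (path A).c (path A).c_s
    ((path A).c_t.trans hr.symm) l hs ht

/-- The model structure which is detected by right adjoints to groupoids. -/
theorem exists_detectedModelCategory [HasLimits M] [HasColimits M]
    (hle : (detectedFibrations R).llp ≤ detectedWeakEquivalences R)
    (hI : MorphismProperty.HasSmallObjectArgument.{u} (inducedGeneratingCofibrations L))
    (hJ : MorphismProperty.HasSmallObjectArgument.{u} (inducedGeneratingTrivialCofibrations L)) :
    ∃ (_ : ModelCategory M), weakEquivalences M = detectedWeakEquivalences R ∧
      fibrations M = detectedFibrations R ∧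
      cofibrations M = (trivialFibrations M).llp ∧ IsStrongModelCategory M ∧
      IsCofibrantlyGeneratedBy M (inducedGeneratingCofibrations L)
        (inducedGeneratingTrivialCofibrations L) := by
  let cF : CategoryWithFibrations M := ⟨detectedFibrations R⟩
  let cW : CategoryWithWeakEquivalences M := ⟨detectedWeakEquivalences R⟩
  let cC : CategoryWithCofibrations M :=
    ⟨(detectedFibrations R ⊓ detectedWeakEquivalences R).llp⟩
  have hI' : (inducedGeneratingCofibrations L).rlp = trivialFibrations M :=
    rlp_inducedGeneratingCofibrations adj
  have hJ' : (inducedGeneratingTrivialCofibrations L).rlp = fibrations M :=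
    rlp_inducedGeneratingTrivialCofibrations adj
  have hC : cofibrations M = (trivialFibrations M).llp := rfl
  have : (weakEquivalences M).HasTwoOutOfThreeProperty :=
    inferInstanceAs (detectedWeakEquivalences R).HasTwoOutOfThreeProperty
  have f₁ : MorphismProperty.HasFunctorialFactorization (cofibrations M) (trivialFibrations M) := by
    rw [hC, ← hI']
    infer_instance
  have f₂ : MorphismProperty.HasFunctorialFactorization (fibrations M).llp (fibrations M) := by
    rw [← hJ']
    infer_instance
  -- The retract argument: factor `f` as a map with the left lifting property followed by a
  -- fibration. By two-out-of-three the fibration is trivial, so the cofibration `f` lifts against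
  -- it and is a retract of the first factor.
  have hT : trivialCofibrations M = (fibrations M).llp := by
    apply le_antisymm
    · rintro A B f ⟨hf, hf'⟩
      let d := MorphismProperty.factorizationData (fibrations M).llp (fibrations M) f
      have hp : weakEquivalences M d.p :=
        MorphismProperty.of_precomp (W' := weakEquivalences M) _ d.i d.p (hle _ d.hi)
          (by rwa [d.fac])
      have := hf d.p ⟨d.hp, hp⟩
      exact MorphismProperty.of_retract (RetractArrow.ofLeftLiftingProperty d.fac) d.hi
    · exact le_inf (MorphismProperty.antitone_llp inf_le_left) hle
  have f₃ : MorphismProperty.HasFunctorialFactorization (trivialCofibrations M) (fibrations M) := by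
    rwa [hT]
  have w₁ : MorphismProperty.IsWeakFactorizationSystem (cofibrations M) (trivialFibrations M) :=
    { rlp := by rw [hC, ← hI', MorphismProperty.rlp_llp_rlp]
      llp := rfl }
  have w₂ : MorphismProperty.IsWeakFactorizationSystem (trivialCofibrations M) (fibrations M) :=
    { rlp := by rw [hT, ← hJ', MorphismProperty.rlp_llp_rlp]
      llp := hT.symm }
  let m : ModelCategory M := ModelCategory.mk' M
  exact ⟨m, rfl, rfl, rfl, ⟨inferInstance, inferInstance, f₃, f₁⟩,
    ⟨hI, hJ, hI'.symm, hJ'.symm⟩⟩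

end DetectedModelStructure

/-! ### Mapping groupoids -/

section MappingGroupoids

lemma Arr.IsComp.left_cancel {E : Type*} [Category* E] {x y : E} {f : x ⟶ y} [Epi f]
    {g g' h : Arr E} (H : IsComp ⟨f⟩ g h) (H' : IsComp ⟨f⟩ g' h) : g = g' := by
  obtain ⟨g⟩ := g
  obtain rfl := H.tgt_eq_src
  obtain ⟨h⟩ := h
  obtain rfl := H.src_eq
  obtain rfl := H.tgt_eq
  obtain ⟨g', rfl⟩ := g'.exists_eq_mk H'.tgt_eq_src.symm H'.tgt_eq.symm
  rw [isComp_mk] at H H'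
  exact Arr.mk_inj.2 ((cancel_epi f).1 (H.trans H'.symm))

variable {C : Type u} [SmallCategory C]

lemma isHomLift_iff_arr {E : Type*} [Category* E] {p : E ⥤ C} {X Y : C} {a b : E} (f : X ⟶ Y)
    (φ : a ⟶ b) : p.IsHomLift f φ ↔ Arr.map p ⟨φ⟩ = ⟨f⟩ := by
  constructor
  · rintro ⟨⟩
    rfl
  · intro h
    obtain rfl : p.obj a = X := congrArg Arr.src h
    obtain rfl : p.obj b = Y := congrArg Arr.tgt h
    obtain rfl := Arr.mk_inj.1 h
    exact .map φ

namespace IsFiberedInGroupoids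

variable {E : Type u} [SmallCategory E] {p : E ⥤ C} (hp : IsFiberedInGroupoids p)

include hp

lemma hom_ext {a b c : E} (g : b ⟶ c) {h h' : a ⟶ b} {X Y : C} (f : X ⟶ Y)
    (hh : p.IsHomLift f h) (hh' : p.IsHomLift f h') (w : h ≫ g = h' ≫ g) : h = h' := by
  refine (hp.existsUnique_fac (h ≫ g) g (p.map h) (p.map_comp _ _).symm).unique ⟨rfl, rfl⟩
    ⟨w.symm, ?_⟩
  rw [IsHomLift.fac' p f h, IsHomLift.fac' p f h']

lemma exists_hom {a b c : E} (g : b ⟶ c) (k : a ⟶ c) {X Y Z : C} (φ : X ⟶ Y) (ψ : Y ⟶ Z)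
    (hg : p.IsHomLift ψ g) (hk : p.IsHomLift (φ ≫ ψ) k) : ∃ h : a ⟶ b, h ≫ g = k ∧
      p.IsHomLift φ h := by
  obtain ⟨⟩ := hg
  obtain rfl := IsHomLift.domain_eq p (φ ≫ p.map g) k
  obtain ⟨h, ⟨h₁, rfl⟩, -⟩ := hp.existsUnique_fac k g φ (IsHomLift.eq_of_isHomLift _ _ k)
  exact ⟨h, h₁, .map h⟩

end IsFiberedInGroupoids

/-- An arrow of a category over `C` is vertical if it lies over an identity. -/
def IsVertical {E : GrpdOver C} (f : Arr E.obj.obj) : Prop :=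
  E.obj.p.IsHomLift (𝟙 (E.obj.p.obj f.src)) f.hom

namespace IsVertical

variable {E E' : GrpdOver C}

lemma of_isHomLift {X : C} {a b : E.obj.obj} (φ : a ⟶ b) (h : E.obj.p.IsHomLift (𝟙 X) φ) :
    IsVertical ⟨φ⟩ := by
  obtain rfl := IsHomLift.domain_eq E.obj.p (𝟙 X) φ
  exact h

lemma isHomLift {X : C} {a b : E.obj.obj} {φ : a ⟶ b} (h : IsVertical ⟨φ⟩)
    (hX : E.obj.p.obj a = X) : E.obj.p.IsHomLift (𝟙 X) φ := by
  subst hX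
  exact h

lemma obj_tgt {f : Arr E.obj.obj} (h : IsVertical f) : E.obj.p.obj f.tgt = E.obj.p.obj f.src := by
  replace h : E.obj.p.IsHomLift (𝟙 (E.obj.p.obj f.src)) f.hom := h
  exact IsHomLift.codomain_eq E.obj.p (𝟙 (E.obj.p.obj f.src)) f.hom

lemma isHomLift_of_tgt {X : C} {a b : E.obj.obj} {φ : a ⟶ b} (h : IsVertical ⟨φ⟩)
    (hX : E.obj.p.obj b = X) : E.obj.p.IsHomLift (𝟙 X) φ := by
  exact isHomLift h (h.obj_tgt.symm.trans hX)

lemma isIso {a b : E.obj.obj} {φ : a ⟶ b} (h : IsVertical ⟨φ⟩) : IsIso φ :=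
  E.property.isIso φ h

lemma comp {a b c : E.obj.obj} {φ : a ⟶ b} {ψ : b ⟶ c} (hφ : IsVertical ⟨φ⟩)
    (hψ : IsVertical ⟨ψ⟩) : IsVertical ⟨φ ≫ ψ⟩ := by
  have h₁ := hφ.isHomLift rfl
  have h₂ := hψ.isHomLift hφ.obj_tgt
  exact of_isHomLift (X := E.obj.p.obj a) (φ ≫ ψ) inferInstance

lemma inv {a b : E.obj.obj} {φ : a ⟶ b} [IsIso φ] (hφ : IsVertical ⟨φ⟩) :
    IsVertical ⟨CategoryTheory.inv φ⟩ := by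
  have h₁ := hφ.isHomLift rfl
  exact of_isHomLift (X := E.obj.p.obj a) (CategoryTheory.inv φ) inferInstance

lemma id (a : E.obj.obj) : IsVertical (Arr.id a) := IsHomLift.id rfl

lemma app {A : BasedCategory.{u, u} C} {F G : BasedFunctor A E.obj} (α : F ⟶ G) (a : A.obj) :
    IsVertical ⟨α.toNatTrans.app a⟩ :=
  of_isHomLift _ (α.isHomLift' a)

lemma arrMap {f : Arr E.obj.obj} (h : IsVertical f) (F : E ⟶ E') :
    IsVertical (GrpdOver.arrMap F f) := by
  obtain ⟨f⟩ := f
  exact of_isHomLift _ ((F.hom.isHomLift_iff _ f).2 h)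

lemma of_arrMap {f : Arr E.obj.obj} (F : E ⟶ E') (h : IsVertical (GrpdOver.arrMap F f)) :
    IsVertical f := by
  obtain ⟨f⟩ := f
  exact of_isHomLift _ ((F.hom.isHomLift_iff _ f).1 h)

end IsVertical

/-- Functors over `C` can be modified along vertical arrows. -/
lemma exists_basedNatTrans {B : BasedCategory.{u, u} C} {E : GrpdOver C}
    (T : BasedFunctor B E.obj) (e : B.obj → Arr E.obj.obj) (hs : ∀ b, (e b).src = T.obj b)
    (hv : ∀ b, IsVertical (e b)) :
    ∃ (T' : BasedFunctor B E.obj) (β : T ⟶ T'), ∀ b,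
      (⟨β.toNatTrans.app b⟩ : Arr E.obj.obj) = e b := by
  have h₀ (b : B.obj) : ∃ (y : E.obj.obj) (φ : T.obj b ⟶ y), ⟨φ⟩ = e b := by
    obtain ⟨φ, hφ⟩ := (e b).exists_eq_mk (hs b) rfl
    exact ⟨_, φ, hφ.symm⟩
  choose y φ hφ using h₀
  obtain rfl : (fun b ↦ ⟨φ b⟩) = e := funext hφ
  have hl (b : B.obj) : E.obj.p.IsHomLift (𝟙 (B.p.obj b)) (φ b) := (hv b).isHomLift (T.w_obj b)
  have hiso (b : B.obj) : IsIso (φ b) := E.property.isIso _ (hl b)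
  let T' : BasedFunctor B E.obj :=
    { toFunctor := T.toFunctor.copyObj y (fun b ↦ asIso (φ b))
      w := Arr.functor_ext fun f ↦ by
        obtain ⟨f⟩ := f
        rename_i a b
        refine (isHomLift_iff_arr (p := E.obj.p) (B.p.map f)
          (inv (φ a) ≫ T.map f ≫ φ b)).1 ?_
        infer_instance }
  exact ⟨T', ⟨(T.toFunctor.isoCopyObj y _).hom, fun b ↦ hl b⟩, fun b ↦ rfl⟩

/-- The components are isomorphisms, so naturality recovers the target functor from the source
functor and the components. This is why no assumption on the targets is made. -/
lemma basedNatTrans_arr_ext {A : BasedCategory.{u, u} C} {E : GrpdOver C}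
    {α β : Arr (BasedFunctor A E.obj)} (hs : α.src = β.src)
    (h : ∀ a, (⟨α.hom.toNatTrans.app a⟩ : Arr E.obj.obj) = ⟨β.hom.toNatTrans.app a⟩) :
    α = β := by
  obtain ⟨α⟩ := α
  obtain ⟨β⟩ := β
  dsimp only at hs h
  subst hs
  rename_i F G G'
  obtain rfl : G = G' := basedFunctor_ext (Arr.functor_ext fun f ↦ by
    obtain ⟨f⟩ := f
    rename_i a b
    have h₁ : Arr.IsComp ⟨α.toNatTrans.app a⟩ ⟨G.map f⟩ ⟨F.map f ≫ α.toNatTrans.app b⟩ :=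
      (Arr.isComp_mk _ _ _).2 (α.toNatTrans.naturality f).symm
    have h₂ : Arr.IsComp ⟨β.toNatTrans.app a⟩ ⟨G'.map f⟩ ⟨F.map f ≫ β.toNatTrans.app b⟩ :=
      (Arr.isComp_mk _ _ _).2 (β.toNatTrans.naturality f).symm
    have h₃ := Arr.IsComp.mk (F.map f) (α.toNatTrans.app b)
    have h₄ := Arr.IsComp.mk (F.map f) (β.toNatTrans.app b)
    rw [← h] at h₂ h₄
    rw [h₄.unique h₃] at h₂
    have := (IsVertical.app α a).isIso
    exact h₁.left_cancel h₂)
  exact Arr.mk_inj.2 (BasedNatTrans.ext _ _ (NatTrans.ext (funext fun a ↦ Arr.mk_inj.1 (h a))))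

/-- Postcomposition with functors which lift vertical arrows. -/
lemma exists_arr_postcomp {J : Type*} {E : GrpdOver C} {E' : J → GrpdOver C} (F : ∀ j, E ⟶ E' j)
    (hF : ∀ (a : E.obj.obj) (φ : ∀ j, Arr (E' j).obj.obj), (∀ j, (φ j).src = (F j).hom.obj a) →
      (∀ j, IsVertical (φ j)) →
        ∃ ψ : Arr E.obj.obj, ψ.src = a ∧ IsVertical ψ ∧ ∀ j, GrpdOver.arrMap (F j) ψ = φ j)
    (A : BasedCategory.{u, u} C) (s : BasedFunctor A E.obj)
    (φ : ∀ j, Arr (BasedFunctor A (E' j).obj)) (hφ : ∀ j, (φ j).src = (postcomp A (F j)).obj s) :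
    ∃ ψ : Arr (BasedFunctor A E.obj), ψ.src = s ∧ ∀ j, Arr.map (postcomp A (F j)) ψ = φ j := by
  choose e he₁ he₂ he₃ using fun a : A.obj ↦ hF (s.obj a)
    (fun j ↦ ⟨(φ j).hom.toNatTrans.app a⟩) (fun j ↦ by dsimp only; rw [hφ]; rfl)
    (fun j ↦ IsVertical.app _ _)
  obtain ⟨s', β, hβ⟩ := exists_basedNatTrans s e he₁ he₂
  refine ⟨⟨β⟩, rfl, fun j ↦ basedNatTrans_arr_ext (hφ j).symm fun a ↦ ?_⟩
  rw [← he₃, ← hβ]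
  rfl

/-! ### The 2-Yoneda lemma: sections over `C/X` and objects of the fiber over `X` -/

section Slice

variable {E : GrpdOver C} {X : C}

/-- A section over `C/X` given by a choice of pullbacks of an object. -/
lemma exists_section (a : E.obj.obj) (c : Over X → Arr E.obj.obj) (hc : ∀ f, (c f).tgt = a)
    (hb : ∀ f, GrpdOver.base (c f) = ⟨f.hom⟩) :
    ∃ s : BasedFunctor (slice X) E.obj, ∀ f, s.obj f = (c f).src := by
  have hex (k : Arr (Over X)) := E.property.existsUnique_arr (c k.src) (c k.tgt)
    ((hc _).trans (hc _).symm) (Arr.map (Over.forget X) k) (by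
      have h₁ := hb k.src
      have h₂ := hb k.tgt
      unfold GrpdOver.base at h₁ h₂
      rw [h₁, h₂]
      exact (Arr.isComp_mk _ _ _).2 (Over.w k.hom))
  choose φ hφ hφ' using hex
  have hid (f : Over X) : φ (Arr.id f) = Arr.id (c f).src :=
    (hφ' (Arr.id f) _ ⟨Arr.id_isComp (c f), by
      rw [Arr.map_id, Arr.map_id]
      exact congrArg (fun f ↦ Arr.id f.src) (hb f)⟩).symm
  let s : sliceGrpdOver X ⟶ E := GrpdOver.homOfArr φ
    (fun f ↦ (hid f).trans (congrArg (fun f ↦ Arr.id f.src) (hid f)).symm)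
    -- The composition `m` of the arrows chosen for `k₁` and `k₂` is a factorization with the same
    -- base as the one chosen for `k`, hence equal to it.
    (fun {k₁ k₂ k} H ↦ by
      have h₁ := (hφ k₁).1
      have h₂ := (hφ k₂).1
      have h₃ := h₂.src_eq
      rw [← H.tgt_eq_src] at h₂ h₃
      obtain ⟨m, hm⟩ := Arr.exists_isComp (h₁.tgt_eq_src.trans h₃)
      obtain ⟨x, hx⟩ := Arr.exists_isComp (hm.tgt_eq.trans h₂.tgt_eq_src)
      obtain rfl := (hm.assoc h₂ hx).unique h₁
      rwa [← hφ' k m ⟨by rwa [H.src_eq, H.tgt_eq], ?_⟩]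
      have h₄ := hm.map E.obj.p
      rw [(hφ k₁).2, (hφ k₂).2] at h₄
      exact h₄.unique (H.map _))
    (fun k ↦ (hφ k).2)
  exact ⟨s.hom, fun f ↦ congrArg Arr.src (a₁ := Arr.id _) (a₂ := Arr.id _) ((Arr.map_id s.hom.toFunctor f).symm.trans
    ((GrpdOver.arrMap_homOfArr _ _ _ _ _).trans (hid f)))⟩

/-- The identity of `X`, as an object of the slice. -/
abbrev overId (X : C) : (slice X).obj := Over.mk (𝟙 X)

/-- The morphism to the terminal object of a slice. -/
def toOverId (f : (slice X).obj) : f ⟶ overId X :=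
  show (show Over X from f) ⟶ Over.mk (𝟙 X) from Over.homMk (Over.hom f)

/-- The structure morphism of an object of the slice. -/
abbrev sliceHom (f : (slice X).obj) : (slice X).p.obj f ⟶ X := Over.hom f

lemma toOverId_self : toOverId (overId X) = 𝟙 (overId X) := rfl

lemma comp_toOverId {f g : (slice X).obj} (k : f ⟶ g) : k ≫ toOverId g = toOverId f :=
  Over.OverMorphism.ext ((Category.comp_id _).symm.trans (Over.w (k ≫ toOverId g)))

/-- The value of a section over `C/X` at the identity of `X`. -/
def evalSlice (X : C) (E : GrpdOver C) : BasedFunctor (slice X) E.obj ⥤ E.obj.p.Fiber X where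
  obj s := ⟨s.obj (overId X), s.w_obj _⟩
  map α := ⟨α.toNatTrans.app (overId X), α.isHomLift' (overId X)⟩

/-- The pullback along `𝟙 X` is chosen to be the identity, which makes evaluation surjective on
objects and not only up to isomorphism. Fibrations and surjective equivalences are not invariant
under isomorphism of objects, so this strictness matters for them. -/
lemma exists_section_of_fiber (a : E.obj.p.Fiber X) :
    ∃ s : BasedFunctor (slice X) E.obj, (evalSlice X E).obj s = a := by
  obtain ⟨a, rfl⟩ := a
  have hex (f : Over (E.obj.p.obj a)) : ∃ c : Arr E.obj.obj, c.tgt = a ∧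
      GrpdOver.base c = ⟨f.hom⟩ ∧ (f = Over.mk (𝟙 _) → c = Arr.id a) := by
    by_cases hf : f = Over.mk (𝟙 _)
    · subst hf
      exact ⟨Arr.id a, rfl, Arr.map_id _ _, fun _ ↦ rfl⟩
    · obtain ⟨c, h₁, h₂⟩ := E.property.exists_arr a ⟨f.hom⟩ rfl
      exact ⟨c, h₁, h₂, fun h ↦ (hf h).elim⟩
  choose c h₁ h₂ h₃ using hex
  obtain ⟨s, hs⟩ := exists_section a c h₁ h₂
  refine ⟨s, Subtype.ext ((hs _).trans ?_)⟩
  rw [h₃ _ rfl]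
  rfl

lemma isHomLift_map_toOverId (s : BasedFunctor (slice X) E.obj) (f : (slice X).obj) :
    E.obj.p.IsHomLift (sliceHom f) (s.map (toOverId f)) :=
  (s.isHomLift_iff (sliceHom f) (toOverId f)).2 (.map (toOverId f))

instance : (evalSlice X E).Faithful where
  map_injective {s t} α β h := by
    apply BasedNatTrans.ext
    apply NatTrans.ext
    funext f
    refine E.property.hom_ext (t.map (toOverId f)) _ (α.isHomLift' f) (β.isHomLift' f) ?_
    refine (α.toNatTrans.naturality (toOverId f)).symm.trans
      (Eq.trans ?_ (β.toNatTrans.naturality (toOverId f)))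
    exact congrArg _ (congrArg Subtype.val h)

/-- At an object `f` of the slice the component has to be the factorization of `s.map (toOverId f) ≫
γ` through `t.map (toOverId f)`. Uniqueness of factorizations gives naturality. -/
lemma exists_basedNatTrans_slice {s t : BasedFunctor (slice X) E.obj}
    (γ : s.obj (overId X) ⟶ t.obj (overId X)) (hγ : E.obj.p.IsHomLift (𝟙 X) γ) :
    ∃ α : s ⟶ t, α.toNatTrans.app (overId X) = γ := by
  have hex (f : (slice X).obj) : ∃ h : s.obj f ⟶ t.obj f,
      h ≫ t.map (toOverId f) = s.map (toOverId f) ≫ γ ∧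
        E.obj.p.IsHomLift (𝟙 ((slice X).p.obj f)) h := by
    refine E.property.exists_hom _ _ _ (sliceHom f) (isHomLift_map_toOverId t f) ?_
    rw [Category.id_comp]
    have := isHomLift_map_toOverId s f
    infer_instance
  choose α hα₁ hα₂ using hex
  refine ⟨⟨⟨α, fun f g k ↦ ?_⟩, hα₂⟩, ?_⟩
  · have := hα₂ f
    have := hα₂ g
    refine E.property.hom_ext (t.map (toOverId g)) ((slice X).p.map k)
      inferInstance inferInstance ?_
    rw [Category.assoc, Category.assoc, hα₁, ← t.map_comp, comp_toOverId, hα₁,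
      ← Category.assoc, ← s.map_comp, comp_toOverId]
  · have h₂ := hα₁ (overId X)
    rw [toOverId_self, t.map_id, s.map_id, Category.comp_id, Category.id_comp] at h₂
    exact h₂

instance : (evalSlice X E).Full where
  map_surjective {s t} γ := by
    obtain ⟨α, hα⟩ := exists_basedNatTrans_slice γ.1 γ.2
    exact ⟨α, Subtype.ext hα⟩

instance : (evalSlice X E).IsEquivalence where
  essSurj := ⟨fun a ↦ by
    obtain ⟨s, rfl⟩ := exists_section_of_fiber a
    exact ⟨s, ⟨Iso.refl _⟩⟩⟩

end Slice

end MappingGroupoids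

/-! ### Equivalences and fibrations of categories fibered in groupoids -/

section EquivalencesOver

variable {C : Type u} [SmallCategory C] {E E' : GrpdOver C}

lemma postcomp_faithful (F : E ⟶ E') [F.hom.toFunctor.Faithful] (A : BasedCategory.{u, u} C) :
    (postcomp A F).Faithful where
  map_injective {s t} α β h := by
    apply BasedNatTrans.ext
    apply NatTrans.ext
    funext a
    apply F.hom.toFunctor.map_injective
    exact congrArg (fun γ ↦ γ.toNatTrans.app a) h

lemma postcomp_full (F : E ⟶ E') [F.hom.toFunctor.Full] [F.hom.toFunctor.Faithful]
    (A : BasedCategory.{u, u} C) : (postcomp A F).Full where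
  map_surjective {s t} γ := by
    choose α hα using fun a ↦ F.hom.toFunctor.map_surjective (γ.toNatTrans.app a)
    refine ⟨⟨⟨α, fun a b f ↦ F.hom.toFunctor.map_injective ?_⟩, fun a ↦ ?_⟩, ?_⟩
    · rw [Functor.map_comp, Functor.map_comp, hα, hα]
      exact γ.toNatTrans.naturality f
    · rw [← F.hom.isHomLift_iff, hα]
      exact γ.isHomLift' a
    · apply BasedNatTrans.ext
      apply NatTrans.ext
      exact funext hα

/-- Functors over `C` lift against surjective equivalences. -/
lemma exists_lift_of_isSurjectiveEquivalence {A B : BasedCategory.{u, u} C}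
    (i : BasedFunctor A B) (hi : Function.Injective i.obj) (F : E ⟶ E')
    (hF : IsSurjectiveEquivalence F.hom.toFunctor) (a : BasedFunctor A E.obj)
    (b : BasedFunctor B E'.obj) (h : BasedFunctor.comp a F.hom = BasedFunctor.comp i b) :
    ∃ l : BasedFunctor B E.obj, BasedFunctor.comp i l = a ∧ BasedFunctor.comp l F.hom = b := by
  have := hF.full
  have := hF.faithful
  obtain ⟨l, h₁, h₂⟩ := exists_lift_of_fullyFaithful i.toFunctor hi F.hom.toFunctor hF.surjective
    a.toFunctor b.toFunctor (congrArg (fun F ↦ F.toFunctor) h)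
  refine ⟨⟨l, ?_⟩, basedFunctor_ext h₁, basedFunctor_ext h₂⟩
  rw [← F.hom.w, ← Functor.assoc, h₂, b.w]

/-- The empty category over `C`. -/
def emptyBased (C : Type u) [SmallCategory C] : BasedCategory.{u, u} C :=
  BasedCategory.ofFunctor (Functor.empty C : Discrete PEmpty.{u + 1} ⥤ C)

lemma isSurjectiveEquivalence_postcomp (F : E ⟶ E')
    (hF : IsSurjectiveEquivalence F.hom.toFunctor) (A : BasedCategory.{u, u} C) :
    IsSurjectiveEquivalence (postcomp A F) where
  full := by
    have := hF.full
    have := hF.faithful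
    exact postcomp_full F A
  faithful := by
    have := hF.faithful
    exact postcomp_faithful F A
  surjective s := by
    obtain ⟨l, -, hl⟩ := exists_lift_of_isSurjectiveEquivalence (A := emptyBased C)
      ⟨Functor.empty A.obj, Functor.empty_ext' _ _⟩ (fun x ↦ x.as.elim) F hF
      ⟨Functor.empty _, Functor.empty_ext' _ _⟩ s (basedFunctor_ext (Functor.empty_ext' _ _))
    exact ⟨l, hl⟩

/-- Evaluation at the identity of `X` is an equivalence and commutes strictly with the functors
induced by `F`, so two-out-of-three applies. -/
lemma sectionwise_grpdWeakEquivalences :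
    sectionwise C grpdWeakEquivalences = fiberwiseEquivalences C := by
  ext E E' F
  refine forall_congr' fun X ↦ ?_
  change (postcomp (slice X) F).IsEquivalence ↔ _
  have h : postcomp (slice X) F ⋙ evalSlice X E' = evalSlice X E ⋙ fiberFunctor F X := rfl
  constructor
  · intro hF
    have : (evalSlice X E ⋙ fiberFunctor F X).IsEquivalence :=
      Functor.isEquivalence_trans (postcomp (slice X) F) (evalSlice X E')
    exact Functor.isEquivalence_of_comp_left (evalSlice X E) _
  · intro hF
    have : (postcomp (slice X) F ⋙ evalSlice X E').IsEquivalence :=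
      Functor.isEquivalence_trans (evalSlice X E) (fiberFunctor F X)
    exact Functor.isEquivalence_of_comp_right _ (evalSlice X E')

lemma IsFiberedInGroupoids.exists_isHomLift {E : Type u} [SmallCategory E] {p : E ⥤ C}
    (hp : IsFiberedInGroupoids p) (b : E) {X Y : C} (f : X ⟶ Y) (h : Y = p.obj b) :
    ∃ (a : E) (φ : a ⟶ b), p.IsHomLift f φ := by
  subst h
  exact hp.exists_lift b f

/-- The morphisms of the fibers are isomorphisms. -/
lemma isIso_fiber {X : C} {a b : E.obj.p.Fiber X} (φ : a ⟶ b) : IsIso φ := by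
  have := E.property.isIso φ.1 φ.2
  have hφ := φ.2
  exact ⟨⟨inv φ.1, IsHomLift.lift_id_inv_isIso E.obj.p X φ.1⟩, Subtype.ext (IsIso.hom_inv_id φ.1),
    Subtype.ext (IsIso.inv_hom_id φ.1)⟩

/-- The equivalences of categories fibered in groupoids: the fully faithful functors with
essentially surjective functors on fibers. -/
structure IsOverEquivalence (F : E ⟶ E') : Prop where
  full : F.hom.toFunctor.Full
  faithful : F.hom.toFunctor.Faithful
  exists_vertical (b : E'.obj.obj) : ∃ (a : E.obj.obj) (φ : F.hom.obj a ⟶ b), IsVertical ⟨φ⟩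

/-- Every arrow is a vertical arrow followed by a chosen lift of its base. Thus fullness and
faithfulness on fibers extend to all arrows. -/
lemma fiberwiseEquivalences_iff (F : E ⟶ E') :
    fiberwiseEquivalences C F ↔ IsOverEquivalence F := by
  constructor
  · intro hF
    have hfull {a b : E.obj.obj} (φ : F.hom.obj a ⟶ F.hom.obj b) {X : C}
        (hφ : E'.obj.p.IsHomLift (𝟙 X) φ) : ∃ ψ : a ⟶ b, F.hom.map ψ = φ := by
      have ha := (F.hom.w_obj a).symm.trans (IsHomLift.domain_eq E'.obj.p (𝟙 X) φ)
      have hb := (F.hom.w_obj b).symm.trans (IsHomLift.codomain_eq E'.obj.p (𝟙 X) φ)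
      have := hF X
      let a' : E.obj.p.Fiber X := ⟨a, ha⟩
      let b' : E.obj.p.Fiber X := ⟨b, hb⟩
      let φ' : (fiberFunctor F X).obj a' ⟶ (fiberFunctor F X).obj b' := ⟨φ, hφ⟩
      obtain ⟨ψ, hψ⟩ := (fiberFunctor F X).map_surjective φ'
      exact ⟨ψ.1, congrArg Subtype.val hψ⟩
    have hfaithful {a b : E.obj.obj} (φ ψ : a ⟶ b) {X : C} (hφ : E.obj.p.IsHomLift (𝟙 X) φ)
        (hψ : E.obj.p.IsHomLift (𝟙 X) ψ) (h : F.hom.map φ = F.hom.map ψ) : φ = ψ := by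
      have ha := IsHomLift.domain_eq E.obj.p (𝟙 X) φ
      have hb := IsHomLift.codomain_eq E.obj.p (𝟙 X) φ
      have := hF X
      let a' : E.obj.p.Fiber X := ⟨a, ha⟩
      let b' : E.obj.p.Fiber X := ⟨b, hb⟩
      let φ' : a' ⟶ b' := ⟨φ, hφ⟩
      let ψ' : a' ⟶ b' := ⟨ψ, hψ⟩
      have h' : (fiberFunctor F X).map φ' = (fiberFunctor F X).map ψ' := Subtype.ext h
      exact congrArg Subtype.val ((fiberFunctor F X).map_injective h')
    refine ⟨⟨fun {a b} φ ↦ ?_⟩, ⟨fun {a b} φ ψ h ↦ ?_⟩, fun b ↦ ?_⟩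
    · obtain ⟨a', c, hc⟩ := E.property.exists_isHomLift b (E'.obj.p.map φ) (F.hom.w_obj b)
      obtain ⟨m, rfl, hm⟩ := E'.property.exists_hom (F.hom.map c) φ (𝟙 _) (E'.obj.p.map φ)
        (F.hom.preserves_isHomLift _ _) (by rw [Category.id_comp]; exact .map φ)
      obtain ⟨m, rfl⟩ := hfull m hm
      exact ⟨m ≫ c, F.hom.toFunctor.map_comp m c⟩
    · replace h : F.hom.map φ = F.hom.map ψ := h
      obtain ⟨a', c, hc⟩ := E.property.exists_isHomLift b (E'.obj.p.map (F.hom.map φ))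
        (F.hom.w_obj b)
      obtain ⟨m, hm, hm'⟩ := E.property.exists_hom c φ (𝟙 _) _ hc
        (by rw [Category.id_comp, ← F.hom.isHomLift_iff]; exact .map _)
      obtain ⟨n, hn, hn'⟩ := E.property.exists_hom c ψ (𝟙 _) _ hc
        (by rw [Category.id_comp, ← F.hom.isHomLift_iff, h]; exact .map _)
      have hmn : F.hom.map m = F.hom.map n := by
        refine E'.property.hom_ext (F.hom.map c) (𝟙 (E'.obj.p.obj (F.hom.obj a)))
          (F.hom.preserves_isHomLift _ m) (F.hom.preserves_isHomLift _ n) ?_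
        rw [← F.hom.map_comp, ← F.hom.map_comp, hm, hn, h]
      rw [hfaithful m n hm' hn' hmn] at hm
      exact hm.symm.trans hn
    · have := hF (E'.obj.p.obj b)
      let b' : E'.obj.p.Fiber (E'.obj.p.obj b) := ⟨b, rfl⟩
      let e := (fiberFunctor F _).objObjPreimageIso b'
      exact ⟨_, e.hom.1, .of_isHomLift _ e.hom.2⟩
  · rintro ⟨h₁, h₂, h₃⟩ X
    have : (fiberFunctor F X).Faithful := ⟨fun {a b} φ ψ h ↦ Subtype.ext
      (F.hom.toFunctor.map_injective (congrArg Subtype.val h))⟩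
    have : (fiberFunctor F X).Full := ⟨fun {a b} φ ↦ by
      obtain ⟨ψ, hψ⟩ := F.hom.toFunctor.map_surjective (X := a.1) (Y := b.1) φ.1
      refine ⟨⟨ψ, ?_⟩, Subtype.ext hψ⟩
      rw [← F.hom.isHomLift_iff, hψ]
      exact φ.2⟩
    have : (fiberFunctor F X).EssSurj := ⟨fun b ↦ by
      obtain ⟨a, φ, hφ⟩ := h₃ b.1
      have hφ' := hφ.isHomLift_of_tgt b.2
      let a' : E.obj.p.Fiber X :=
        ⟨a, (F.hom.w_obj a).symm.trans (IsHomLift.domain_eq E'.obj.p (𝟙 X) φ)⟩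
      let φ' : (fiberFunctor F X).obj a' ⟶ b := ⟨φ, hφ'⟩
      have : IsIso φ' := isIso_fiber φ'
      exact ⟨a', ⟨asIso φ'⟩⟩⟩
    constructor <;> assumption

/-- A functor over `C` can be changed along any choice of vertical arrows, one for each object, so
lifting transformations of sections amounts to lifting single vertical arrows. -/
lemma sectionwise_grpdFibrations_iff (F : E ⟶ E') :
    sectionwise C grpdFibrations F ↔ ∀ (a : E.obj.obj) (φ : Arr E'.obj.obj),
      φ.src = F.hom.obj a → IsVertical φ →
        ∃ ψ : Arr E.obj.obj, ψ.src = a ∧ GrpdOver.arrMap F ψ = φ := by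
  constructor
  · classical
    intro h a φ hφ hφ'
    obtain ⟨X, hX⟩ : ∃ X, E.obj.p.obj a = X := ⟨_, rfl⟩
    obtain ⟨s, hs⟩ := exists_section_of_fiber (⟨a, hX⟩ : E.obj.p.Fiber X)
    obtain rfl : s.obj (overId X) = a := congrArg Subtype.val hs
    let T := (postcomp _ F).obj s
    -- Move the section `T` along `φ` at the identity of `X` and leave its values at all other
    -- objects unchanged.
    obtain ⟨t, α, hα⟩ := exists_basedNatTrans T
      (fun f ↦ if f = overId X then φ else Arr.id (T.obj f))
      (fun f ↦ by
        split_ifs with hf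
        · rw [hφ, hf]
          rfl
        · rfl)
      (fun f ↦ by
        split_ifs with hf
        · exact hφ'
        · exact .id _)
    obtain ⟨ψ, hψ, hψ'⟩ := (grpdFibrations_iff _).1 (h X) s ⟨α⟩ rfl
    refine ⟨⟨ψ.hom.toNatTrans.app (overId X)⟩, by subst hψ; rfl, ?_⟩
    refine Eq.trans ?_ ((hα (overId X)).trans (if_pos rfl))
    exact congrArg (fun β ↦ (⟨β.hom.toNatTrans.app (overId X)⟩ : Arr E'.obj.obj)) hψ'
  · intro h X
    rw [grpdFibrations_iff]
    intro s φ hφ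
    obtain ⟨ψ, hψ, hψ'⟩ := exists_arr_postcomp (fun _ : Unit ↦ F) (fun a φ hφ hφ' ↦ by
      obtain ⟨ψ, h₁, h₂⟩ := h a (φ ()) (hφ ()) (hφ' ())
      exact ⟨ψ, h₁, .of_arrMap F (h₂ ▸ hφ' ()), fun _ ↦ h₂⟩) (slice X) s (fun _ ↦ φ) (fun _ ↦ hφ)
    exact ⟨ψ, hψ, hψ' ()⟩

end EquivalencesOver

/-! ### The model structure on categories fibered in groupoids -/

section FiberedModelStructure

variable {C : Type u} [SmallCategory C]

/-- This describes the trivial fibrations without slices. For surjectivity, extend an object of `E'`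
to a section over a slice, lift the section and evaluate at the identity. -/
lemma isSurjectiveEquivalence_iff_postcomp {E E' : GrpdOver C} (F : E ⟶ E') :
    (∀ X : C, IsSurjectiveEquivalence (postcomp (slice X) F)) ↔
      IsSurjectiveEquivalence F.hom.toFunctor := by
  refine ⟨fun h ↦ ?_, fun h X ↦ isSurjectiveEquivalence_postcomp F h _⟩
  have hF : IsOverEquivalence F := by
    rw [← fiberwiseEquivalences_iff, ← sectionwise_grpdWeakEquivalences]
    exact fun X ↦ ((isSurjectiveEquivalence_iff _).1 (h X)).1
  refine ⟨fun b ↦ ?_, hF.full, hF.faithful⟩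
  obtain ⟨t, ht⟩ := exists_section_of_fiber (⟨b, rfl⟩ : E'.obj.p.Fiber (E'.obj.p.obj b))
  obtain ⟨s, rfl⟩ := (h _).surjective t
  exact ⟨s.obj (overId _), congrArg Subtype.val ht⟩

/-! ### Replacing the set of objects of a category over `C` -/

section Induced

variable {E : GrpdOver C} {T : Type u} (k : T → E.obj.obj) (hk : Function.Surjective k)

/-- The category over `C` with a given set of objects mapping onto the objects of `E`, and with the
morphisms of `E`. -/
def inducedGrpdOver : GrpdOver C where
  obj := BasedCategory.ofFunctor (inducedFunctor k ⋙ E.obj.p)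
  property :=
    { exists_lift := fun {Y} x f ↦ by
        obtain ⟨y, g, hg⟩ := E.property.exists_lift (k x) f
        obtain ⟨y, rfl⟩ := hk y
        let g' : (show InducedCategory _ k from y) ⟶ x := InducedCategory.homMk g
        exact ⟨y, g', (isHomLift_iff_arr f g').2 ((isHomLift_iff_arr f g).1 hg)⟩
      existsUnique_fac := fun f g h w ↦ by
        obtain ⟨l, ⟨h₁, h₂⟩, h₃⟩ := E.property.existsUnique_fac f.hom g.hom h w
        exact ⟨InducedCategory.homMk l, ⟨InducedCategory.hom_ext h₁, h₂⟩, fun m hm ↦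
          InducedCategory.hom_ext (h₃ m.hom ⟨congrArg InducedCategory.Hom.hom hm.1, hm.2⟩)⟩ }

/-- The projection to the original category over `C`. -/
def inducedGrpdOverHom : inducedGrpdOver k hk ⟶ E where
  hom :=
    { toFunctor := inducedFunctor k
      w := rfl }

lemma isSurjectiveEquivalence_inducedGrpdOverHom :
    IsSurjectiveEquivalence (inducedGrpdOverHom k hk).hom.toFunctor where
  surjective := hk
  full := InducedCategory.full k
  faithful := InducedCategory.faithful k

end Induced

/-! ### Path objects made of vertical arrows -/

section PathObject

variable (E : GrpdOver C)

/-- The vertical arrows of a category over `C`. -/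
def VerticalArr : Type u := { f : Arr E.obj.obj // IsVertical f }

lemma surjective_verticalArr_src : Function.Surjective (fun f : VerticalArr E ↦ f.1.src) :=
  fun a ↦ ⟨⟨Arr.id a, .id a⟩, rfl⟩

/-- The path object: its objects are the vertical arrows. -/
def pathObject : GrpdOver C := inducedGrpdOver _ (surjective_verticalArr_src E)

variable {E} in
lemma VerticalArr.isIso (f : VerticalArr E) : IsIso f.1.hom := f.2.isIso

attribute [local instance] VerticalArr.isIso

/-- The source of a path. -/
def pathSource : pathObject E ⟶ E := inducedGrpdOverHom _ (surjective_verticalArr_src E)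

/-- The target of a path. -/
noncomputable def pathTarget : pathObject E ⟶ E where
  hom :=
    { toFunctor :=
        { obj := fun f : VerticalArr E ↦ f.1.tgt
          -- A morphism of paths records only the morphism between the sources. The one between the
          -- targets is forced by commutativity of the square, as vertical arrows are invertible.
          map := fun {f g : VerticalArr E} (h : InducedCategory.Hom f g) ↦
            inv f.1.hom ≫ h.hom ≫ g.1.hom
          map_id := fun (f : VerticalArr E) ↦ by
            change inv f.1.hom ≫ 𝟙 _ ≫ f.1.hom = 𝟙 _
            simp
          map_comp := fun {f g h : VerticalArr E} (k : InducedCategory.Hom f g)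
              (l : InducedCategory.Hom g h) ↦ by
            change inv f.1.hom ≫ (k.hom ≫ l.hom) ≫ h.1.hom =
              (inv f.1.hom ≫ k.hom ≫ g.1.hom) ≫ inv g.1.hom ≫ l.hom ≫ h.1.hom
            simp }
      w := Arr.functor_ext fun ⟨h⟩ ↦ by
        rename_i f g
        have := VerticalArr.isIso (E := E) f
        let h' : InducedCategory.Hom f g := h
        have hf : E.obj.p.IsHomLift (𝟙 (E.obj.p.obj f.1.src)) f.1.hom := f.2
        have hg : E.obj.p.IsHomLift (𝟙 (E.obj.p.obj g.1.src)) g.1.hom := g.2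
        refine (isHomLift_iff_arr (p := E.obj.p) (E.obj.p.map h'.hom)
          (inv f.1.hom ≫ h'.hom ≫ g.1.hom)).1 ?_
        infer_instance }

/-- The natural transformation from the source to the target of a path. -/
noncomputable def pathSourceToTarget : (pathSource E).hom ⟶ (pathTarget E).hom where
  app f := f.1.hom
  naturality f g h := by
    have := VerticalArr.isIso (E := E) f
    change h.hom ≫ g.1.hom = f.1.hom ≫ inv f.1.hom ≫ h.hom ≫ g.1.hom
    simp
  isHomLift' f := f.2

/-- Constant paths. -/
noncomputable def pathConst : E ⟶ pathObject E where
  hom :=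
    { toFunctor :=
        { obj := fun a ↦ (⟨Arr.id a, .id a⟩ : VerticalArr E)
          map := fun {a b} f ↦ InducedCategory.homMk f }
      w := rfl }

lemma pathConst_comp_pathSource : pathConst E ≫ pathSource E = 𝟙 E := rfl

lemma pathConst_comp_pathTarget : pathConst E ≫ pathTarget E = 𝟙 E := by
  refine GrpdOver.hom_ext fun ⟨f⟩ ↦ Arr.mk_inj.2 ?_
  change inv (𝟙 _) ≫ f ≫ 𝟙 _ = f
  simp

variable {E} in
lemma exists_arr_pathObject (a : (pathObject E).obj.obj) (φ ψ : Arr E.obj.obj)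
    (hφ : φ.src = (pathSource E).hom.obj a) (hψ : ψ.src = (pathTarget E).hom.obj a)
    (hφ' : IsVertical φ) (hψ' : IsVertical ψ) : ∃ χ : Arr (pathObject E).obj.obj, χ.src = a ∧
      IsVertical χ ∧ GrpdOver.arrMap (pathSource E) χ = φ ∧
        GrpdOver.arrMap (pathTarget E) χ = ψ := by
  obtain ⟨⟨α⟩, hα⟩ := a
  rename_i x y
  replace hα : IsVertical ⟨α⟩ := hα
  obtain ⟨φ⟩ := φ
  obtain ⟨ψ⟩ := ψ
  obtain rfl : _ = x := hφ
  obtain rfl : _ = y := hψ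
  have := hφ'.isIso
  -- The end of the lift is the path from `φ.tgt` to `ψ.tgt` obtained by transporting `α` along `φ`
  -- and `ψ`.
  let b : VerticalArr E := ⟨⟨inv φ ≫ α ≫ ψ⟩, hφ'.inv.comp (hα.comp hψ')⟩
  let a : VerticalArr E := ⟨⟨α⟩, hα⟩
  let χ : (show (pathObject E).obj.obj from a) ⟶ b := InducedCategory.homMk φ
  have := hα.isIso
  refine ⟨⟨χ⟩, rfl, .of_arrMap (pathSource E) hφ', rfl, Arr.mk_inj.2 ?_⟩
  change inv α ≫ φ ≫ inv φ ≫ α ≫ ψ = ψ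
  simp

/-- The functor between path objects. -/
noncomputable def pathMap {E E' : GrpdOver C} (F : E ⟶ E') : pathObject E ⟶ pathObject E' where
  hom :=
    { toFunctor :=
        { obj := fun f : VerticalArr E ↦ (⟨GrpdOver.arrMap F f.1, f.2.arrMap F⟩ : VerticalArr E')
          map := fun {f g : VerticalArr E} (h : InducedCategory.Hom f g) ↦
            InducedCategory.homMk (F.hom.map h.hom)
          map_id := fun _ ↦ InducedCategory.hom_ext (F.hom.map_id _)
          map_comp := fun _ _ ↦ InducedCategory.hom_ext (F.hom.map_comp _ _) }
      w := Arr.functor_ext fun f ↦ GrpdOver.base_arrMap F (GrpdOver.arrMap (pathSource E) f) }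

lemma pathMap_comp_pathSource {E E' : GrpdOver C} (F : E ⟶ E') :
    pathMap F ≫ pathSource E' = pathSource E ≫ F := rfl

lemma pathMap_comp_pathTarget {E E' : GrpdOver C} (F : E ⟶ E') :
    pathMap F ≫ pathTarget E' = pathTarget E ≫ F := by
  refine GrpdOver.hom_ext fun ⟨h⟩ ↦ Arr.mk_inj.2 ?_
  rename_i f g
  have := VerticalArr.isIso (E := E) f
  change inv (F.hom.map f.1.hom) ≫ F.hom.map h.hom ≫ F.hom.map g.1.hom =
    F.hom.map (inv f.1.hom ≫ h.hom ≫ g.1.hom)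
  simp

end PathObject

/-- The mapping groupoids as functors to groupoids. -/
noncomputable def mappingFunctor (A : BasedCategory.{u, u} C) : GrpdOver C ⥤ Grpd.{u, u} where
  obj E := Grpd.of (BasedFunctor A E.obj)
  map F := postcomp A F
  map_id _ := rfl
  map_comp _ _ := rfl

/-- The tensor product with groupoids as a functor. -/
def tensorFunctor (E : GrpdOver C) : Grpd.{u, u} ⥤ GrpdOver C where
  obj G := tensor E G
  map f := tensorMap E f
  map_id _ := rfl
  map_comp _ _ := rfl

/-! ### The adjunction between tensors with groupoids and mapping groupoids -/

section Currying

variable {A E : GrpdOver C} {G : Grpd.{u, u}}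

/-- The objects of `A ⊗ G`. -/
abbrev tensorMk (a : A.obj.obj) (g : G) : (tensor A G).obj.obj := (a, g)

/-- The morphisms of `A ⊗ G`. -/
def tensorHom {a b : A.obj.obj} {g h : G} (f : a ⟶ b) (k : g ⟶ h) :
    tensorMk a g ⟶ tensorMk b h := (f, k)

lemma tensorHom_comp {a b c : A.obj.obj} {g h i : G} (f : a ⟶ b) (k : g ⟶ h) (f' : b ⟶ c)
    (k' : h ⟶ i) : tensorHom f k ≫ tensorHom f' k' = tensorHom (f ≫ f') (k ≫ k') := rfl

lemma isHomLift_tensorHom {a b : A.obj.obj} {g h : G} (f : a ⟶ b) (k : g ⟶ h) :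
    (tensor A G).obj.p.IsHomLift (A.obj.p.map f) (tensorHom f k) := .map (tensorHom f k)

/-- A functor from `A ⊗ G`, as a functor from `G` to the mapping groupoid. -/
def tensorCurry (F : BasedFunctor (tensor A G).obj E.obj) : G ⥤ BasedFunctor A.obj E.obj where
  obj g :=
    { toFunctor :=
        { obj := fun a ↦ F.obj (tensorMk a g)
          map := fun {a b} f ↦ F.map (tensorHom f (𝟙 g))
          map_id := fun a ↦ F.map_id _
          map_comp := fun f f' ↦ by
            rw [← F.map_comp, tensorHom_comp, Category.comp_id] }
      w := Arr.functor_ext fun f ↦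
        congrArg (fun F ↦ Arr.map F ⟨tensorHom f.hom (𝟙 g)⟩) F.w }
  map {g g'} k :=
    { app := fun a ↦ F.map (tensorHom (𝟙 a) k)
      naturality := fun a b f ↦ by
        change F.map _ ≫ F.map _ = F.map _ ≫ F.map _
        rw [← F.map_comp, ← F.map_comp, tensorHom_comp, tensorHom_comp]
        simp
      isHomLift' := fun a ↦ (F.isHomLift_iff _ _).2
        (A.obj.p.map_id a ▸ isHomLift_tensorHom (𝟙 a) k) }
  map_id g := BasedNatTrans.ext _ _ (NatTrans.ext (funext fun a ↦ F.map_id _))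
  map_comp k l := BasedNatTrans.ext _ _ (NatTrans.ext (funext fun a ↦ by
    change F.map _ = F.map _ ≫ F.map _
    rw [← F.map_comp, tensorHom_comp, Category.comp_id]))

/-- A functor from `G` to a mapping groupoid, as a functor from `A ⊗ G`. -/
def tensorUncurry (H : G ⥤ BasedFunctor A.obj E.obj) : BasedFunctor (tensor A G).obj E.obj where
  toFunctor :=
    { obj := fun x : A.obj.obj × G ↦ (H.obj x.2).obj x.1
      map := fun {x y : A.obj.obj × G} (f : x ⟶ y) ↦
        (H.obj x.2).map f.1 ≫ (H.map f.2).toNatTrans.app y.1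
      map_id := fun (x : A.obj.obj × G) ↦ by
        change (H.obj x.2).map (𝟙 x.1) ≫ (H.map (𝟙 x.2)).toNatTrans.app x.1 = _
        rw [(H.obj x.2).map_id, H.map_id, Category.id_comp]
        rfl
      map_comp := fun {x y z : A.obj.obj × G} (f : x ⟶ y) (g : y ⟶ z) ↦ by
        change (H.obj x.2).map (f.1 ≫ g.1) ≫ (H.map (f.2 ≫ g.2)).toNatTrans.app z.1 =
          ((H.obj x.2).map f.1 ≫ (H.map f.2).toNatTrans.app y.1) ≫
            (H.obj y.2).map g.1 ≫ (H.map g.2).toNatTrans.app z.1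
        rw [H.map_comp, (H.obj x.2).map_comp, Category.assoc, Category.assoc,
          ← (H.map f.2).toNatTrans.naturality_assoc]
        rfl }
  w := Arr.functor_ext fun ⟨f⟩ ↦ by
    rename_i x y
    let f' : (show A.obj.obj × G from x) ⟶ y := f
    have := (H.map f'.2).isHomLift' y.1
    have : E.obj.p.IsHomLift (A.obj.p.map f'.1) ((H.obj x.2).map f'.1) :=
      (H.obj x.2).preserves_isHomLift _ _
    refine (isHomLift_iff_arr (p := E.obj.p) (A.obj.p.map f'.1)
      ((H.obj x.2).map f'.1 ≫ (H.map f'.2).toNatTrans.app y.1)).1 ?_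
    infer_instance

lemma tensorUncurry_tensorCurry (F : BasedFunctor (tensor A G).obj E.obj) :
    tensorUncurry (tensorCurry F) = F :=
  basedFunctor_ext (CategoryTheory.Functor.hext (fun _ ↦ rfl) fun x y f ↦ heq_of_eq (by
    change F.map (tensorHom _ _) ≫ F.map (tensorHom _ _) = _
    rw [← F.map_comp, tensorHom_comp, Category.comp_id, Category.id_comp]
    rfl))

lemma tensorCurry_tensorUncurry (H : G ⥤ BasedFunctor A.obj E.obj) :
    tensorCurry (tensorUncurry H) = H := by
  have h (g : G) : (tensorCurry (tensorUncurry H)).obj g = H.obj g :=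
    basedFunctor_ext (CategoryTheory.Functor.hext (fun _ ↦ rfl) fun a b f ↦ heq_of_eq (by
      change (H.obj g).map f ≫ (H.map (𝟙 g)).toNatTrans.app b = _
      rw [H.map_id]
      exact Category.comp_id _))
  refine Arr.functor_ext fun ⟨k⟩ ↦ basedNatTrans_arr_ext (h _) fun a ↦ ?_
  rename_i g g'
  refine Arr.mk_inj.2 ?_
  change (H.obj g).map (𝟙 a) ≫ (H.map k).toNatTrans.app a = _
  rw [(H.obj g).map_id, Category.id_comp]
  rfl

/-- The tensor product with groupoids is left adjoint to the mapping groupoid. -/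
noncomputable def tensorAdjunction (A : GrpdOver C) : tensorFunctor A ⊣ mappingFunctor A.obj :=
  Adjunction.mkOfHomEquiv
    { homEquiv := fun _ _ ↦
        { toFun := fun F ↦ tensorCurry F.hom
          invFun := fun H ↦ ⟨tensorUncurry H⟩
          left_inv := fun _ ↦ InducedCategory.hom_ext (tensorUncurry_tensorCurry _)
          right_inv := fun _ ↦ tensorCurry_tensorUncurry _ }
      homEquiv_naturality_left_symm := fun _ _ ↦ rfl
      homEquiv_naturality_right := fun _ _ ↦ rfl }

end Currying

/-- The path objects of categories fibered in groupoids. -/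
noncomputable def detectedPathObject (E : GrpdOver C) :
    DetectedPathObject (fun X : C ↦ mappingFunctor (slice X)) E where
  P := pathObject E
  s := pathSource E
  t := pathTarget E
  c := pathConst E
  c_s := pathConst_comp_pathSource E
  c_t := pathConst_comp_pathTarget E
  exists_lift X a φ ψ hφ hψ := by
    let F (j : Bool) : pathObject E ⟶ E := cond j (pathSource E) (pathTarget E)
    obtain ⟨χ, h₁, h₂⟩ := exists_arr_postcomp F (fun a φ hφ hφ' ↦ by
      obtain ⟨χ, h₁, h₂, h₃, h₄⟩ := exists_arr_pathObject a (φ true) (φ false) (hφ true) (hφ false)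
        (hφ' true) (hφ' false)
      exact ⟨χ, h₁, h₂, fun j ↦ Bool.rec h₄ h₃ j⟩) (slice X) a (fun j ↦ Bool.rec ψ φ j)
      (fun j ↦ Bool.rec hψ hφ j)
    exact ⟨χ, h₁, h₂ true, h₂ false⟩
  nonempty_iso X := by
    let α : postcomp (slice X) (pathSource E) ⟶ postcomp (slice X) (pathTarget E) :=
      { app := fun s ↦ BasedCategory.whiskerLeft s (pathSourceToTarget E)
        naturality := fun s t β ↦ BasedNatTrans.ext _ _ (NatTrans.ext (funext fun a ↦
          (pathSourceToTarget E).toNatTrans.naturality (β.toNatTrans.app a))) }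
    exact ⟨NatIso.ofComponents (fun s ↦ Groupoid.isoEquivHom _ _ |>.symm (α.app s))
      (fun β ↦ α.naturality β)⟩

/-- A small family of morphisms whose sources are presentable, with respect to given sizes `S i`,
permits the small object argument. -/
lemma hasSmallObjectArgument_ofHoms_of_sizes {M : Type w} [Category.{u} M] [HasColimits M]
    {ι : Type u} {A B : ι → M} (f : ∀ i, A i ⟶ B i) (S : ι → Type u)
    (h : ∀ (J : Type u) [LinearOrder J] [Nonempty J] (i : ι),
      (∀ g : S i → J, BddAbove (Set.range g)) →
        ∀ (F : J ⥤ M), PreservesColimit F (coyoneda.obj (op (A i)))) :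
    MorphismProperty.HasSmallObjectArgument.{u} (MorphismProperty.ofHoms f) := by
  refine hasSmallObjectArgument_ofHoms f (Σ i, S i) fun J _ _ hJ i F ↦ h J i (fun g ↦ ?_) F
  classical
  let j₀ : J := Classical.arbitrary J
  -- A function on `S i` is extended to the disjoint union by the constant `j₀`; a bound for the
  -- extension also bounds the original function.
  refine (hJ fun x ↦ if hx : x.1 = i then g (hx ▸ x.2) else j₀).mono ?_
  rintro _ ⟨y, rfl⟩
  exact ⟨⟨i, y⟩, dif_pos rfl⟩

lemma hasSmallObjectArgument_fibered {ι : Type u} {A B : ι → GrpdOver C} (f : ∀ i, A i ⟶ B i) :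
    MorphismProperty.HasSmallObjectArgument.{u} (MorphismProperty.ofHoms f) :=
  hasSmallObjectArgument_ofHoms_of_sizes f _ fun _ _ _ _ hi F ↦
    preservesColimit_coyoneda_of_bddAbove F _ hi

lemma llp_sectionwise_grpdFibrations_le :
    (sectionwise C grpdFibrations).llp ≤ sectionwise C grpdWeakEquivalences :=
  llp_detectedFibrations_le (fun X : C ↦ tensorAdjunction (sliceGrpdOver X)) detectedPathObject

variable (C) in
theorem exists_fiberedModelCategory : ∃ (_ : ModelCategory (GrpdOver C)),
    weakEquivalences (GrpdOver C) = sectionwise C grpdWeakEquivalences ∧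
      fibrations (GrpdOver C) = sectionwise C grpdFibrations ∧
      cofibrations (GrpdOver C) = (trivialFibrations (GrpdOver C)).llp ∧
      IsStrongModelCategory (GrpdOver C) ∧
      IsCofibrantlyGeneratedBy (GrpdOver C)
        (fiberedGeneratingCofibrations C) (fiberedGeneratingTrivialCofibrations C) :=
  exists_detectedModelCategory (L := fun X : C ↦ tensorFunctor (sliceGrpdOver X))
    (fun X : C ↦ tensorAdjunction (sliceGrpdOver X)) llp_sectionwise_grpdFibrations_le
    (hasSmallObjectArgument_fibered _) (hasSmallObjectArgument_fibered _)

end FiberedModelStructure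

/-! ### Left properness -/

section LeftProper

variable {C : Type u} [SmallCategory C]

lemma pathMap_comp {E E' E'' : GrpdOver C} (F : E ⟶ E') (G : E' ⟶ E'') :
    pathMap (F ≫ G) = pathMap F ≫ pathMap G := rfl

lemma pathObject_arr_ext {E : GrpdOver C} {χ χ' : Arr (pathObject E).obj.obj}
    (hs : χ.src = χ'.src) (ht : χ.tgt = χ'.tgt)
    (h : GrpdOver.arrMap (pathSource E) χ = GrpdOver.arrMap (pathSource E) χ') : χ = χ' := by
  obtain ⟨χ⟩ := χ
  obtain ⟨χ'⟩ := χ'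
  dsimp only at hs ht
  subst hs ht
  exact Arr.mk_inj.2 (InducedCategory.hom_ext (Arr.mk_inj.1 h))

/-- Equivalences of categories fibered in groupoids are homotopy equivalences. -/
lemma IsOverEquivalence.exists_homotopyInverse {A X : GrpdOver C} {f : A ⟶ X}
    (hf : IsOverEquivalence f) : ∃ (h : X ⟶ A) (η : A ⟶ pathObject A) (ε : X ⟶ pathObject X),
      η ≫ pathSource A = 𝟙 A ∧ η ≫ pathTarget A = f ≫ h ∧
        ε ≫ pathSource X = 𝟙 X ∧ ε ≫ pathTarget X = h ≫ f ∧ η ≫ pathMap f = f ≫ ε := by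
  have := hf.full
  have := hf.faithful
  -- `φ x` is a vertical isomorphism from the image of `o x` to `x`. The inverse functor is `o` on
  -- objects, with morphisms conjugated by `φ` and pulled back through the fully faithful `f`.
  choose o φ hφ using hf.exists_vertical
  have hi (x : X.obj.obj) : IsIso (φ x) := (hφ x).isIso
  let m {x y : X.obj.obj} (k : x ⟶ y) : o x ⟶ o y :=
    f.hom.toFunctor.preimage (φ x ≫ k ≫ inv (φ y))
  have hm {x y : X.obj.obj} (k : x ⟶ y) : f.hom.map (m k) = φ x ≫ k ≫ inv (φ y) :=
    f.hom.toFunctor.map_preimage _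
  let h : X ⟶ A :=
    { hom :=
      { toFunctor :=
        { obj := o
          map := m
          map_id := fun x ↦ f.hom.toFunctor.map_injective ((hm _).trans (by simp))
          map_comp := fun k l ↦ f.hom.toFunctor.map_injective ((hm _).trans (by
            refine Eq.trans ?_ (f.hom.map_comp _ _).symm
            rw [hm, hm]
            simp)) }
        w := Arr.functor_ext fun ⟨k⟩ ↦ by
          rename_i x y
          have h₁ := (hφ x).isHomLift_of_tgt rfl
          have h₂ := (hφ y).isHomLift_of_tgt rfl
          refine (isHomLift_iff_arr (p := A.obj.p) (X.obj.p.map k) (m k)).1 ?_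
          rw [← f.hom.isHomLift_iff, hm]
          infer_instance } }
  -- The homotopy on `A` is defined so that its image under `f` is the homotopy `inv φ` on `X`,
  -- restricted along `f`. This is the compatibility on which the gluing over a pushout depends.
  let n (a : A.obj.obj) : a ⟶ o (f.hom.obj a) := f.hom.toFunctor.preimage (inv (φ (f.hom.obj a)))
  have hn (a : A.obj.obj) : f.hom.map (n a) = inv (φ (f.hom.obj a)) :=
    f.hom.toFunctor.map_preimage _
  have hnv (a : A.obj.obj) : IsVertical ⟨n a⟩ := by
    refine .of_arrMap f ?_
    rw [show GrpdOver.arrMap f ⟨n a⟩ = ⟨inv (φ (f.hom.obj a))⟩ from Arr.mk_inj.2 (hn a)]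
    exact (hφ _).inv
  let η : A ⟶ pathObject A :=
    { hom :=
      { toFunctor :=
        { obj := fun a ↦ (⟨⟨n a⟩, hnv a⟩ : VerticalArr A)
          map := fun k ↦ InducedCategory.homMk k }
        w := rfl } }
  let ε : X ⟶ pathObject X :=
    { hom :=
      { toFunctor :=
        { obj := fun x ↦ (⟨⟨inv (φ x)⟩, (hφ x).inv⟩ : VerticalArr X)
          map := fun k ↦ InducedCategory.homMk k }
        w := rfl } }
  refine ⟨h, η, ε, rfl, ?_, rfl, ?_, ?_⟩
  · refine GrpdOver.hom_ext fun ⟨k⟩ ↦ Arr.mk_inj.2 ?_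
    rename_i a b
    have := (hnv a).isIso
    change inv (n a) ≫ k ≫ n b = m (f.hom.map k)
    rw [IsIso.inv_comp_eq]
    refine f.hom.toFunctor.map_injective ?_
    rw [Functor.map_comp, Functor.map_comp]
    refine (congrArg (f.hom.map k ≫ ·) (hn b)).trans
      (Eq.trans ?_ (congrArg₂ (· ≫ ·) (hn a) (hm (f.hom.map k))).symm)
    simp
  · refine GrpdOver.hom_ext fun ⟨k⟩ ↦ Arr.mk_inj.2 ?_
    rename_i a b
    change inv (inv (φ a)) ≫ k ≫ inv (φ b) = f.hom.map (m k)
    rw [hm, IsIso.inv_inv]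
  · exact GrpdOver.hom_ext fun ⟨k⟩ ↦ pathObject_arr_ext (Subtype.ext (Arr.mk_inj.2 (hn _)))
      (Subtype.ext (Arr.mk_inj.2 (hn _))) rfl

/-- Weak equivalences are stable under pushouts along functors which lift against the source maps
of path objects. -/
lemma sectionwise_grpdWeakEquivalences_of_isPushout {A B X Y : GrpdOver C} {f : A ⟶ X} {i : A ⟶ B}
    {j : X ⟶ Y} {g : B ⟶ Y} (sq : IsPushout f i j g)
    (hf : sectionwise C grpdWeakEquivalences f) (hi : HasLiftingProperty i (pathSource B)) :
    sectionwise C grpdWeakEquivalences g := by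
  rw [sectionwise_grpdWeakEquivalences, fiberwiseEquivalences_iff] at hf
  obtain ⟨h, η, ε, hηs, hηt, hεs, hεt, hηε⟩ := hf.exists_homotopyInverse
  have sq' : CommSq (η ≫ pathMap i) i (pathSource B) (𝟙 B) := ⟨by
    rw [Category.assoc, pathMap_comp_pathSource, reassoc_of% hηs, Category.comp_id]⟩
  -- The homotopy `η`, mapped to `B`, extends along `i` to a homotopy `Θ` on `B` that starts at the
  -- identity. The end of `Θ` and `h ≫ i` agree on `A` and glue to a map `r` from `Y` to `B`.
  let Θ := sq'.lift
  have hΘ : i ≫ Θ = η ≫ pathMap i := sq'.fac_left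
  have hΘ' : Θ ≫ pathSource B = 𝟙 B := sq'.fac_right
  have hr : f ≫ h ≫ i = i ≫ Θ ≫ pathTarget B := by
    rw [reassoc_of% hΘ, pathMap_comp_pathTarget, reassoc_of% hηt]
  let r := sq.desc _ _ hr
  have hr₁ : j ≫ r = h ≫ i := sq.inl_desc _ _ hr
  have hr₂ : g ≫ r = Θ ≫ pathTarget B := sq.inr_desc _ _ hr
  -- The homotopy from the identity of `Y` to `r ≫ g` is glued from `ε` on `X` and `Θ` on `B`. They
  -- agree on `A` by the compatibility `hηε`.
  have hΩ : f ≫ ε ≫ pathMap j = i ≫ Θ ≫ pathMap g := by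
    rw [reassoc_of% hΘ, ← pathMap_comp, ← sq.w, pathMap_comp, reassoc_of% hηε]
  let Ω := sq.desc _ _ hΩ
  have hΩ₁ : j ≫ Ω = ε ≫ pathMap j := sq.inl_desc _ _ hΩ
  have hΩ₂ : g ≫ Ω = Θ ≫ pathMap g := sq.inr_desc _ _ hΩ
  refine detectedWeakEquivalences_of_homotopy g r (detectedPathObject B) (detectedPathObject Y)
    Θ hΘ' hr₂.symm Ω (sq.hom_ext ?_ ?_) (sq.hom_ext ?_ ?_)
  · change j ≫ Ω ≫ pathSource Y = _
    rw [reassoc_of% hΩ₁, pathMap_comp_pathSource, reassoc_of% hεs, Category.comp_id]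
  · change g ≫ Ω ≫ pathSource Y = _
    rw [reassoc_of% hΩ₂, pathMap_comp_pathSource, reassoc_of% hΘ', Category.comp_id]
  · change j ≫ Ω ≫ pathTarget Y = _
    rw [reassoc_of% hΩ₁, pathMap_comp_pathTarget, reassoc_of% hεt, reassoc_of% hr₁, sq.w]
  · change g ≫ Ω ≫ pathTarget Y = _
    rw [reassoc_of% hΩ₂, pathMap_comp_pathTarget, reassoc_of% hr₂]

lemma isSurjectiveEquivalence_iff_trivialFibration {E E' : GrpdOver C} (F : E ⟶ E') :
    IsSurjectiveEquivalence F.hom.toFunctor ↔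
      (sectionwise C grpdWeakEquivalences ⊓ sectionwise C grpdFibrations) F := by
  rw [← isSurjectiveEquivalence_iff_postcomp]
  exact (forall_congr' fun X ↦ isSurjectiveEquivalence_iff
    (((sectionsFunctor C).map F).app (op X))).trans forall_and

/-- The source map of a path object is a trivial fibration, since the path object of `B` has the
morphisms of `B` and merely more objects. Thus cofibrations satisfy the lifting hypothesis of
`sectionwise_grpdWeakEquivalences_of_isPushout`. -/
lemma isLeftProper_fibered [ModelCategory (GrpdOver C)]
    (hW : weakEquivalences (GrpdOver C) = sectionwise C grpdWeakEquivalences)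
    (hF : fibrations (GrpdOver C) = sectionwise C grpdFibrations)
    (hC : cofibrations (GrpdOver C) = (trivialFibrations (GrpdOver C)).llp) :
    IsLeftProper (GrpdOver C) := by
  intro A B X Y f i j g sq hf hi
  rw [hW] at hf ⊢
  rw [hC] at hi
  refine sectionwise_grpdWeakEquivalences_of_isPushout sq hf (hi _ ?_)
  have := (isSurjectiveEquivalence_iff_trivialFibration _).1
    (isSurjectiveEquivalence_inducedGrpdOverHom _ (surjective_verticalArr_src B))
  rw [trivialFibrations, hF, hW]
  exact ⟨this.2, this.1⟩

end LeftProper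

/-! ### The adjunction between presheaves of groupoids and categories fibered in groupoids -/

section TotalAdjunction

variable {C : Type u} [SmallCategory C]

namespace TotalCat

variable {F F' : Cᵒᵖ ⥤ Grpd.{u, u}}

lemma arr_ext {X Y : C} {a a' : F.obj (op X)} {b b' : F.obj (op Y)} {k k' : X ⟶ Y} (ha : a = a')
    (hb : b = b') (hk : k = k') (α : a ⟶ (res F k).obj b) (α' : a' ⟶ (res F k').obj b')
    (h : α ≫ eqToHom (by rw [hb, hk]) = eqToHom ha ≫ α') :
    (⟨show (⟨X, a⟩ : TotalCat F) ⟶ ⟨Y, b⟩ from ⟨k, α⟩⟩ : Arr (TotalCat F)) =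
      ⟨show (⟨X, a'⟩ : TotalCat F) ⟶ ⟨Y, b'⟩ from ⟨k', α'⟩⟩ := by
  subst ha hb hk
  simp at h
  subst h
  rfl

lemma res_congr_map {X Y : C} {f g : X ⟶ Y} (h : f = g) {a b : F.obj (op Y)} (α : a ⟶ b) :
    (res F f).map α = eqToHom (by rw [h]) ≫ (res F g).map α ≫ eqToHom (by rw [h]) := by
  subst h
  simp

lemma res_over_obj {X : C} {f g : Over X} (k : f ⟶ g) (a : F.obj (op X)) :
    (res F f.hom).obj a = (res F k.left).obj ((res F g.hom).obj a) := by
  rw [← res_comp_obj, Over.w]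

lemma res_over_map {X : C} {f g : Over X} (k : f ⟶ g) {a b : F.obj (op X)} (α : a ⟶ b) :
    (res F f.hom).map α = eqToHom (res_over_obj k a) ≫ (res F k.left).map ((res F g.hom).map α) ≫
      eqToHom (res_over_obj k b).symm := by
  rw [res_congr_map (Over.w k).symm, res_comp_map]
  simp

/-- The functor `C/X ⥤ p F` given by the restrictions of an object of `F(X)`. -/
def restrictions {X : C} (a : F.obj (op X)) : Over X ⥤ TotalCat F where
  obj f := ⟨f.left, (res F f.hom).obj a⟩
  map k := ⟨k.left, eqToHom (res_over_obj k a)⟩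
  map_id f := Hom.ext' rfl (by simp [id_fiber])
  map_comp k l := Hom.ext' rfl (by simp [comp_fiber, eqToHom_map])

/-- The natural transformation given by the restrictions of a morphism of `F(X)`. -/
def restrictionsMap {X : C} {a b : F.obj (op X)} (α : a ⟶ b) : restrictions a ⟶ restrictions b where
  app f := ⟨𝟙 f.left, (res F f.hom).map α ≫ eqToHom (res_id_obj _).symm⟩
  naturality f g k := Hom.ext' ((Category.comp_id _).trans (Category.id_comp _).symm) (by
    change (eqToHom (res_over_obj k a) ≫ (res F k.left).map ((res F g.hom).map α ≫
      eqToHom (res_id_obj _).symm) ≫ eqToHom (res_comp_obj k.left (𝟙 g.left) _).symm) ≫ eqToHom _ =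
      ((res F f.hom).map α ≫ eqToHom (res_id_obj _).symm) ≫
        (res F (𝟙 f.left)).map (eqToHom (res_over_obj k b)) ≫
          eqToHom (res_comp_obj (𝟙 f.left) k.left _).symm
    simp [eqToHom_map, res_over_map k]
    erw [eqToHom_trans])

end TotalCat

open TotalCat

variable {F F' : Cᵒᵖ ⥤ Grpd.{u, u}}

/-- The unit of the adjunction, at an object of `C`. -/
def unitFunctor (F : Cᵒᵖ ⥤ Grpd.{u, u}) (X : C) :
    F.obj (op X) ⥤ BasedFunctor (slice X) ((totalFunctor C).obj F).obj where
  obj a := ⟨restrictions a, rfl⟩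
  map {a b} α := ⟨restrictionsMap α, fun f ↦ .map ((restrictionsMap α).app f)⟩
  map_id a := BasedNatTrans.ext _ _ (NatTrans.ext (funext fun (f : Over X) ↦ Hom.ext' rfl (by
    change ((res F f.hom).map (𝟙 a) ≫ eqToHom (res_id_obj _).symm) ≫ eqToHom _ =
      eqToHom (res_id_obj _).symm
    rw [CategoryTheory.Functor.map_id, Category.id_comp]
    exact eqToHom_trans _ _)))
  map_comp {a b c} α β := BasedNatTrans.ext _ _ (NatTrans.ext (funext fun (f : Over X) ↦
    Hom.ext' (Category.comp_id (𝟙 f.left)).symm (by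
      change ((res F f.hom).map (α ≫ β) ≫ eqToHom (res_id_obj _).symm) ≫ eqToHom _ =
        ((res F f.hom).map α ≫ eqToHom (res_id_obj _).symm) ≫
          (res F (𝟙 f.left)).map ((res F f.hom).map β ≫ eqToHom (res_id_obj _).symm) ≫
            eqToHom (res_comp_obj (𝟙 f.left) (𝟙 f.left) _).symm
      simp [res_id_map]
      exact congrArg (fun k ↦ _ ≫ _ ≫ k) (eqToHom_trans _ _))))

lemma unitFunctor_naturality {X Y : C} (f : Y ⟶ X) :
    res F f ⋙ unitFunctor F Y =
      unitFunctor F X ⋙ precomp (sliceMap f) ((totalFunctor C).obj F) := by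
  refine Arr.functor_ext fun ⟨α⟩ ↦ ?_
  rename_i a b
  refine basedNatTrans_arr_ext ?_ ?_
  · refine basedFunctor_ext (Arr.functor_ext fun (k : Arr (Over Y)) ↦ ?_)
    obtain ⟨k⟩ := k
    rename_i g h
    refine arr_ext (res_comp_obj g.hom f a).symm (res_comp_obj h.hom f a).symm rfl _ _ ?_
    change eqToHom _ ≫ eqToHom _ = eqToHom _ ≫ eqToHom _
    simp
  · intro (g : Over Y)
    refine arr_ext (res_comp_obj g.hom f a).symm (res_comp_obj g.hom f b).symm rfl _ _ ?_
    change ((res F g.hom).map ((res F f).map α) ≫ eqToHom _) ≫ eqToHom _ =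
      eqToHom (res_comp_obj g.hom f a).symm ≫ (res F (g.hom ≫ f)).map α ≫ eqToHom _
    simp [res_comp_map]

/-- The unit of the adjunction between presheaves of groupoids and categories fibered in
groupoids. -/
noncomputable def unitHom (F : Cᵒᵖ ⥤ Grpd.{u, u}) :
    F ⟶ (sectionsFunctor C).obj ((totalFunctor C).obj F) where
  app X := unitFunctor F X.unop
  naturality _ _ f := unitFunctor_naturality f.unop

lemma unitHom_naturality (φ : F ⟶ F') :
    unitHom F ≫ (sectionsFunctor C).map ((totalFunctor C).map φ) = φ ≫ unitHom F' := by
  refine NatTrans.ext (funext fun X ↦ ?_)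
  refine Arr.functor_ext (F := unitFunctor F X.unop ⋙ postcomp _ ((totalFunctor C).map φ))
    (G := app φ X.unop ⋙ unitFunctor F' X.unop) fun ⟨α⟩ ↦ ?_
  rename_i a b
  refine basedNatTrans_arr_ext ?_ ?_
  · refine basedFunctor_ext (Arr.functor_ext fun (k : Arr (Over X.unop)) ↦ ?_)
    obtain ⟨k⟩ := k
    rename_i g h
    refine arr_ext (app_res_obj φ g.hom a) (app_res_obj φ h.hom a) rfl _ _ ?_
    change ((app φ _).map (eqToHom (res_over_obj k a)) ≫ eqToHom _) ≫ eqToHom _ = eqToHom _ ≫ eqToHom _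
    rw [eqToHom_map]
    exact ((congrArg (· ≫ _) (eqToHom_trans _ _)).trans (eqToHom_trans _ _)).trans
      (eqToHom_trans _ _).symm
  · intro (g : Over X.unop)
    refine arr_ext (app_res_obj φ g.hom a) (app_res_obj φ g.hom b) rfl _ _ ?_
    change ((app φ g.left).map ((res F g.hom).map α ≫ eqToHom (res_id_obj _).symm) ≫
        eqToHom (app_res_obj φ (𝟙 _) _)) ≫ eqToHom _ =
      eqToHom _ ≫ (res F' g.hom).map ((app φ X.unop).map α) ≫ eqToHom _
    simp [app_res_map, eqToHom_map]
    erw [eqToHom_trans]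

lemma basedNatTrans_eqToHom_app {A : BasedCategory.{u, u} C} {E : GrpdOver C}
    {s t : BasedFunctor A E.obj} (h : s = t) (a : A.obj) :
    (eqToHom h).toNatTrans.app a = eqToHom (congrArg (fun s ↦ s.obj a) h) := by
  subst h
  rfl

lemma comp_sliceMap_id {E : GrpdOver C} {X : C} (s : BasedFunctor (slice X) E.obj) :
    s = BasedFunctor.comp (sliceMap (𝟙 X)) s := by
  rw [sliceMap_id]
  rfl

lemma comp_sliceMap_comp {E : GrpdOver C} {X Y Z : C} (f : X ⟶ Y) (g : Y ⟶ Z)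
    (r : BasedFunctor (slice Z) E.obj) :
    BasedFunctor.comp (sliceMap f) (BasedFunctor.comp (sliceMap g) r) =
      BasedFunctor.comp (sliceMap (f ≫ g)) r := by
  rw [sliceMap_comp]
  rfl

lemma comp_sliceMap_over {E : GrpdOver C} {X : C} (s : BasedFunctor (slice X) E.obj)
    {g h : Over X} (k : g ⟶ h) : BasedFunctor.comp (sliceMap g.hom) s =
      BasedFunctor.comp (sliceMap k.left) (BasedFunctor.comp (sliceMap h.hom) s) := by
  rw [comp_sliceMap_comp, Over.w]

/-- The counit of the adjunction, on morphisms. -/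
def counitMap {E : GrpdOver C} {X Y : C} {s : BasedFunctor (slice X) E.obj}
    {t : BasedFunctor (slice Y) E.obj} (f : X ⟶ Y) (α : s ⟶ BasedFunctor.comp (sliceMap f) t) :
    s.obj (overId X) ⟶ t.obj (overId Y) :=
  α.toNatTrans.app (overId X) ≫ t.map (toOverId ((sliceMap f).obj (overId X)))

lemma comp_comp_eq_of_eq {D : Type*} [Category* D] {x y z z' v p q : D} (a : x ⟶ y) (b : y ⟶ z)
    (e : z ⟶ z') (m : z' ⟶ v) (k : y ⟶ p) (b' : p ⟶ q) (l : q ⟶ v) (c : z ⟶ q)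
    (h₁ : e ≫ m = c ≫ l) (h₂ : k ≫ b' = b ≫ c) : (a ≫ b ≫ e) ≫ m = (a ≫ k) ≫ b' ≫ l := by
  simp [h₁, reassoc_of% h₂]

lemma counitMap_comp {E : GrpdOver C} {X Y Z : C} {s : BasedFunctor (slice X) E.obj}
    {t : BasedFunctor (slice Y) E.obj} {r : BasedFunctor (slice Z) E.obj} (f : X ⟶ Y)
    (α : s ⟶ BasedFunctor.comp (sliceMap f) t) (g : Y ⟶ Z)
    (β : t ⟶ BasedFunctor.comp (sliceMap g) r)
    (h : BasedFunctor.comp (sliceMap f) (BasedFunctor.comp (sliceMap g) r) =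
      BasedFunctor.comp (sliceMap (f ≫ g)) r) :
    counitMap (f ≫ g) (α ≫ BasedCategory.whiskerLeft (sliceMap f) β ≫ eqToHom h) =
      counitMap f α ≫ counitMap g β := by
  let k : (sliceMap f).obj (overId X) ⟶ overId Y := toOverId _
  let l : (sliceMap g).obj (overId Y) ⟶ overId Z := toOverId _
  let l' : (sliceMap (f ≫ g)).obj (overId X) ⟶ overId Z := toOverId _
  have hk : (sliceMap g).obj ((sliceMap f).obj (overId X)) =
      (sliceMap (f ≫ g)).obj (overId X) := by
    rw [sliceMap_comp]
    rfl
  have h₁ : eqToHom (congrArg r.obj hk) ≫ r.map l' = r.map ((sliceMap g).map k) ≫ r.map l := by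
    rw [← eqToHom_map r.toFunctor hk, ← r.map_comp, ← r.map_comp]
    exact congrArg r.map ((comp_toOverId _).trans (comp_toOverId _).symm)
  have h₂ : t.map k ≫ β.toNatTrans.app (overId Y) =
    β.toNatTrans.app _ ≫ r.map ((sliceMap g).map k) := β.toNatTrans.naturality k
  change (α.toNatTrans.app (overId X) ≫ β.toNatTrans.app ((sliceMap f).obj (overId X)) ≫
    (eqToHom h).toNatTrans.app _) ≫ r.map l' = (α.toNatTrans.app (overId X) ≫ t.map k) ≫
      β.toNatTrans.app (overId Y) ≫ r.map l
  rw [basedNatTrans_eqToHom_app]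
  exact comp_comp_eq_of_eq _ _ _ _ _ _ _ _ h₁ h₂

lemma map_toOverId_sliceMap_id {E : GrpdOver C} {X : C} (s : BasedFunctor (slice X) E.obj) :
    s.map (toOverId ((sliceMap (𝟙 X)).obj (overId X))) =
      eqToHom (congrArg s.obj (by rw [sliceMap_id]; rfl)) := by
  have hk : overId X = (sliceMap (𝟙 X)).obj (overId X) := by
    rw [sliceMap_id]
    rfl
  rw [← eqToHom_map s.toFunctor hk.symm]
  refine congrArg s.map ?_
  rw [← cancel_epi (eqToHom hk)]
  exact (comp_toOverId _).trans (Eq.symm ((eqToHom_trans _ _).trans (eqToHom_refl _ rfl)))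

lemma counitMap_id {E : GrpdOver C} {X : C} (s : BasedFunctor (slice X) E.obj)
    (h : s = BasedFunctor.comp (sliceMap (𝟙 X)) s) :
    counitMap (𝟙 X) (eqToHom h) = 𝟙 (s.obj (overId X)) := by
  change (eqToHom h).toNatTrans.app (overId X) ≫ s.map (toOverId _) = _
  rw [basedNatTrans_eqToHom_app, map_toOverId_sliceMap_id]
  exact eqToHom_trans _ _

lemma base_counitMap {E : GrpdOver C} {X Y : C} {s : BasedFunctor (slice X) E.obj}
    {t : BasedFunctor (slice Y) E.obj} (f : X ⟶ Y) (α : s ⟶ BasedFunctor.comp (sliceMap f) t) :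
    Arr.map E.obj.p ⟨counitMap f α⟩ = ⟨f⟩ := by
  rw [← isHomLift_iff_arr]
  have h₁ := α.isHomLift' (overId X)
  have h₂ : E.obj.p.IsHomLift (𝟙 X ≫ f) (t.map (toOverId ((sliceMap f).obj (overId X)))) :=
    isHomLift_map_toOverId t ((sliceMap f).obj (overId X))
  rw [Category.id_comp] at h₂
  have h₃ : E.obj.p.IsHomLift (𝟙 X ≫ f) (counitMap f α) :=
    @IsHomLift.comp _ _ _ _ E.obj.p _ _ _ _ _ _ (𝟙 X) f _ _ h₁ h₂
  rwa [Category.id_comp] at h₃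

lemma sliceMap_overId {X : C} (g : Over X) : (sliceMap g.hom).obj (overId g.left) = g := by
  exact congrArg Over.mk (Category.id_comp g.hom)

lemma over_arr_ext {X A B : C} {g g' : A ⟶ X} {h h' : B ⟶ X} (k : Over.mk g ⟶ Over.mk h)
    (k' : Over.mk g' ⟶ Over.mk h') (hg : g = g') (hh : h = h') (hk : k.left = k'.left) :
    (⟨k⟩ : Arr (Over X)) = ⟨k'⟩ := by
  subst hg hh
  exact Arr.mk_inj.2 (Over.OverMorphism.ext hk)

lemma Arr.mk_comp_eqToHom {D : Type*} [Category* D] {x y z : D} (f : x ⟶ y) (h : y = z) :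
    (⟨f ≫ eqToHom h⟩ : Arr D) = ⟨f⟩ := by
  subst h
  simp

lemma Arr.mk_eqToHom_comp {D : Type*} [Category* D] {x y z : D} (h : x = y) (f : y ⟶ z) :
    (⟨eqToHom h ≫ f⟩ : Arr D) = ⟨f⟩ := by
  subst h
  simp

/-- The counit of the adjunction, on objects. -/
abbrev counitObj {E : GrpdOver C} {X : C} (s : BasedFunctor (slice X) E.obj) : E.obj.obj :=
  s.obj (overId X)

/-- The counit of the adjunction, as a functor. -/
def counitFunctor (E : GrpdOver C) :
    TotalCat ((sectionsFunctor C).obj E) ⥤ E.obj.obj where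
  obj x := counitObj (X := x.base) x.fiber
  map f := counitMap f.base f.fiber
  map_id x := counitMap_id (X := x.base) x.fiber (comp_sliceMap_id _)
  map_comp {_ _ z} f g := 
    counitMap_comp (r := z.fiber) f.base f.fiber g.base g.fiber (comp_sliceMap_comp _ _ _)

/-- The counit of the adjunction between presheaves of groupoids and categories fibered in
groupoids. -/
def counitHom (E : GrpdOver C) : (totalFunctor C).obj ((sectionsFunctor C).obj E) ⟶ E where
  hom :=
    { toFunctor := counitFunctor E
      w := Arr.functor_ext fun ⟨f⟩ ↦ by
        rename_i x y
        exact base_counitMap (s := x.fiber) (t := y.fiber) f.base f.fiber }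

/-- This is the triangle identity `unitHom_counitHom` on objects of the mapping groupoid, and the
next lemma is the one on morphisms. Comparing arrows instead of morphisms absorbs the `eqToHom`
terms. -/
lemma mk_counitMap_eqToHom {E : GrpdOver C} {X : C} (s : BasedFunctor (slice X) E.obj)
    {g h : Over X} (k : g ⟶ h) (e : BasedFunctor.comp (sliceMap g.hom) s =
      BasedFunctor.comp (sliceMap k.left) (BasedFunctor.comp (sliceMap h.hom) s)) :
    (⟨counitMap k.left (eqToHom e)⟩ : Arr E.obj.obj) = Arr.map s.toFunctor ⟨k⟩ := by
  let l : (sliceMap h.hom).obj ((sliceMap k.left).obj (overId g.left)) ⟶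
    (sliceMap h.hom).obj (overId h.left) :=
    (sliceMap h.hom).map (toOverId ((sliceMap k.left).obj (overId g.left)))
  have hl : (⟨l⟩ : Arr (Over X)) = ⟨k⟩ :=
    over_arr_ext (X := X) l k
      ((Category.assoc _ _ _).trans ((Category.id_comp _).trans (Over.w k)))
      (Category.id_comp _) (Category.id_comp _)
  refine Eq.trans ?_ (congrArg (Arr.map s.toFunctor) hl)
  have h₁ : counitMap k.left (eqToHom e) =
      eqToHom (congrArg (fun s ↦ s.obj (overId _)) e) ≫ s.map l :=
    congrArg (· ≫ s.map l) (basedNatTrans_eqToHom_app e _)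
  rw [h₁]
  exact Arr.mk_eqToHom_comp _ _

lemma mk_counitMap_whiskerLeft {E : GrpdOver C} {X : C} {s t : BasedFunctor (slice X) E.obj}
    (α : s ⟶ t) (g : Over X) (e : BasedFunctor.comp (sliceMap g.hom) t =
      BasedFunctor.comp (sliceMap (𝟙 g.left)) (BasedFunctor.comp (sliceMap g.hom) t)) :
    (⟨counitMap (𝟙 g.left) (BasedCategory.whiskerLeft (sliceMap g.hom) α ≫ eqToHom e)⟩ :
      Arr E.obj.obj) = ⟨α.toNatTrans.app g⟩ := by
  have h₁ : (BasedFunctor.comp (sliceMap g.hom) t).map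
      (toOverId ((sliceMap (𝟙 g.left)).obj (overId g.left))) = _ := map_toOverId_sliceMap_id _
  have h₂ : counitMap (𝟙 g.left) (BasedCategory.whiskerLeft (sliceMap g.hom) α ≫ eqToHom e) =
      (α.toNatTrans.app ((sliceMap g.hom).obj (overId g.left)) ≫
        (eqToHom e).toNatTrans.app (overId _)) ≫ (BasedFunctor.comp (sliceMap g.hom) t).map
      (toOverId ((sliceMap (𝟙 g.left)).obj (overId g.left))) := rfl
  rw [h₂, h₁, basedNatTrans_eqToHom_app]
  refine (Arr.mk_comp_eqToHom _ _).trans ((Arr.mk_comp_eqToHom _ _).trans ?_)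
  exact congrArg (fun g ↦ (⟨α.toNatTrans.app g⟩ : Arr E.obj.obj)) (sliceMap_overId g)

lemma unitHom_counitHom (E : GrpdOver C) :
    unitHom ((sectionsFunctor C).obj E) ≫ (sectionsFunctor C).map (counitHom E) = 𝟙 _ := by
  refine NatTrans.ext (funext fun X ↦ ?_)
  refine Arr.functor_ext (F := unitFunctor _ X.unop ⋙ postcomp _ (counitHom E))
    (G := 𝟭 (BasedFunctor (slice X.unop) E.obj)) fun ⟨α⟩ ↦ ?_
  rename_i s t
  refine basedNatTrans_arr_ext ?_ ?_
  · refine basedFunctor_ext (Arr.functor_ext fun (k : Arr (Over X.unop)) ↦ ?_)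
    obtain ⟨k⟩ := k
    rename_i g h
    exact mk_counitMap_eqToHom (E := E) (X := X.unop) s k (comp_sliceMap_over s k)
  · intro (g : Over X.unop)
    exact mk_counitMap_whiskerLeft (E := E) (X := X.unop) α g (comp_sliceMap_id _)

/-- A morphism `(k, α)` of `p F` is `(𝟙, α)` followed by `(k, 𝟙)`. The first is a component of
`restrictionsMap α` and the second a value of `restrictions b`, so the unit reaches enough arrows to
determine a functor on `p F`. -/
lemma total_hom_ext {F : Cᵒᵖ ⥤ Grpd.{u, u}} {E : GrpdOver C} {G G' : (totalFunctor C).obj F ⟶ E}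
    (h : unitHom F ≫ (sectionsFunctor C).map G = unitHom F ≫ (sectionsFunctor C).map G') :
    G = G' := by
  have H (X : C) : unitFunctor F X ⋙ postcomp _ G = unitFunctor F X ⋙ postcomp _ G' :=
    congrArg (fun φ ↦ φ.app (op X)) h
  have h₁ {X : C} (a : F.obj (op X)) (k : Arr (Over X)) :
      GrpdOver.arrMap G (Arr.map (restrictions a) k) =
        GrpdOver.arrMap G' (Arr.map (restrictions a) k) :=
    congrArg (fun (s : BasedFunctor (slice X) E.obj) ↦ Arr.map s.toFunctor k)
      (Functor.congr_obj (H X) a)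
  have h₂ {X : C} {a b : F.obj (op X)} (α : a ⟶ b) (g : Over X) :
      GrpdOver.arrMap G ⟨(restrictionsMap α).app g⟩ =
        GrpdOver.arrMap G' ⟨(restrictionsMap α).app g⟩ :=
    congrArg (fun (β : Arr (BasedFunctor (slice X) E.obj)) ↦
      (⟨β.hom.toNatTrans.app g⟩ : Arr E.obj.obj))
      (a₁ := ⟨(unitFunctor F X ⋙ postcomp _ G).map α⟩)
      (a₂ := ⟨(unitFunctor F X ⋙ postcomp _ G').map α⟩)
      (congrArg (fun T : F.obj (op X) ⥤ BasedFunctor (slice X) E.obj ↦ Arr.map T ⟨α⟩) (H X))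
  refine GrpdOver.hom_ext fun (f : Arr (TotalCat F)) ↦ ?_
  obtain ⟨⟨k, α⟩⟩ := f
  rename_i x y
  obtain ⟨X, a⟩ := x
  obtain ⟨Y, b⟩ := y
  dsimp only at k α
  let β : (⟨X, a⟩ : TotalCat F) ⟶ ⟨X, (res F k).obj b⟩ := ⟨𝟙 X, α ≫ eqToHom (res_id_obj _).symm⟩
  let γ : (⟨X, (res F k).obj b⟩ : TotalCat F) ⟶ ⟨Y, b⟩ := ⟨k, 𝟙 _⟩
  have hβ : (⟨β⟩ : Arr (TotalCat F)) = ⟨(restrictionsMap α).app (Over.mk (𝟙 X))⟩ := by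
    refine arr_ext (res_id_obj _).symm (res_id_obj _).symm rfl _ _ ?_
    change (α ≫ eqToHom _) ≫ eqToHom _ = eqToHom _ ≫ (res F (𝟙 X)).map α ≫ eqToHom _
    simp [res_id_map]
  have hγ : (⟨γ⟩ : Arr (TotalCat F)) = Arr.map (restrictions b) ⟨toOverId (Over.mk k)⟩ := by
    refine arr_ext rfl (res_id_obj _).symm rfl _ _ ?_
    exact (Category.id_comp _).trans (Category.id_comp _).symm
  have hc : Arr.IsComp ⟨β⟩ ⟨γ⟩ (⟨show (⟨X, a⟩ : TotalCat F) ⟶ ⟨Y, b⟩ from ⟨k, α⟩⟩) := by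
    refine (Arr.isComp_mk _ _ _).2 (Hom.ext' (Category.id_comp _) ?_)
    change ((α ≫ eqToHom _) ≫ (res F (𝟙 X)).map (𝟙 _) ≫ eqToHom _) ≫ eqToHom _ = α
    simp
  have e₁ : GrpdOver.arrMap G ⟨β⟩ = GrpdOver.arrMap G' ⟨β⟩ := 
    (congrArg (GrpdOver.arrMap G) hβ).trans ((h₂ _ _).trans (congrArg (GrpdOver.arrMap G') hβ.symm))
  have e₂ : GrpdOver.arrMap G ⟨γ⟩ = GrpdOver.arrMap G' ⟨γ⟩ := 
    (congrArg (GrpdOver.arrMap G) hγ).trans ((h₁ _ _).trans (congrArg (GrpdOver.arrMap G') hγ.symm))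
  have i₁ := hc.map G.hom.toFunctor
  have i₂ := hc.map G'.hom.toFunctor
  change Arr.IsComp (GrpdOver.arrMap G ⟨β⟩) (GrpdOver.arrMap G ⟨γ⟩) _ at i₁
  rw [e₁, e₂] at i₁
  exact i₁.unique i₂

/-- The adjunction between presheaves of groupoids and categories fibered in groupoids. -/
noncomputable def totalAdjunction : totalFunctor C ⊣ sectionsFunctor C :=
  Adjunction.mkOfHomEquiv
    -- Injectivity comes from `total_hom_ext`, so a single triangle identity, used for surjectivity,
    -- is enough.
    { homEquiv := fun F E ↦ Equiv.ofBijective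
        (fun G ↦ unitHom F ≫ (sectionsFunctor C).map G)
        ⟨fun _ _ ↦ total_hom_ext, fun φ ↦ ⟨(totalFunctor C).map φ ≫ counitHom E, by
          change unitHom F ≫ (sectionsFunctor C).map (_ ≫ _) = φ
          rw [Functor.map_comp, ← Category.assoc, unitHom_naturality, Category.assoc,
            unitHom_counitHom, Category.comp_id]⟩⟩
      homEquiv_naturality_left_symm := fun {F F' E} φ ψ ↦ by
        rw [Equiv.symm_apply_eq]
        change _ = unitHom F ≫ (sectionsFunctor C).map (_ ≫ _)
        rw [Functor.map_comp, ← Category.assoc, unitHom_naturality, Category.assoc]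
        exact congrArg (φ ≫ ·) (Equiv.ofBijective_apply_symm_apply (fun G ↦ unitHom F' ≫ (sectionsFunctor C).map G) _ ψ).symm
      homEquiv_naturality_right := fun {F E E'} G H ↦ by
        change unitHom F ≫ (sectionsFunctor C).map (_ ≫ _) = (unitHom F ≫ _) ≫ _
        rw [Functor.map_comp, Category.assoc] }

lemma totalAdjunction_unit (F : Cᵒᵖ ⥤ Grpd.{u, u}) :
    totalAdjunction.unit.app F = unitHom F := by
  change unitHom F ≫ (sectionsFunctor C).map (𝟙 _) = _
  rw [CategoryTheory.Functor.map_id, Category.comp_id]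

/-- With the next two instances: the fiber of `p F` over `X` is a copy of `F(X)`, and the composite
sends `a` to its restriction along `𝟙 X`, which equals `a`. Since evaluation is an equivalence, so
is the unit at `X`. -/
instance (F : Cᵒᵖ ⥤ Grpd.{u, u}) (X : C) :
    (unitFunctor F X ⋙ evalSlice X ((totalFunctor C).obj F)).Faithful where
  map_injective {a b} α β h := by
    have h₁ : (⟨𝟙 X, (res F (𝟙 X)).map α ≫ eqToHom (res_id_obj _).symm⟩ :
        Hom (F := F) ⟨X, (res F (𝟙 X)).obj a⟩ ⟨X, (res F (𝟙 X)).obj b⟩) =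
        ⟨𝟙 X, (res F (𝟙 X)).map β ≫ eqToHom (res_id_obj _).symm⟩ := congrArg Subtype.val h
    have h₂ := eq_of_heq (Hom.mk.inj h₁).2
    rw [cancel_mono, res_id_map, res_id_map, cancel_epi, cancel_mono] at h₂
    exact h₂

instance (F : Cᵒᵖ ⥤ Grpd.{u, u}) (X : C) :
    (unitFunctor F X ⋙ evalSlice X ((totalFunctor C).obj F)).Full where
  map_surjective {a b} := by
    rintro ⟨φ, hφ⟩
    have h₁ := (isHomLift_iff_arr _ _).1 hφ
    obtain ⟨k, γ⟩ := φ
    obtain rfl : k = 𝟙 X := Arr.mk_inj.1 h₁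
    let γ' : (res F (𝟙 X)).obj a ⟶ (res F (𝟙 X)).obj ((res F (𝟙 X)).obj b) := γ
    refine ⟨eqToHom (res_id_obj a).symm ≫ γ' ≫ eqToHom (by rw [res_id_obj, res_id_obj]),
      Subtype.ext (Hom.ext' rfl ?_)⟩
    refine (Category.comp_id _).trans ?_
    change (res F (𝟙 X)).map _ ≫ eqToHom (res_id_obj _).symm = γ'
    rw [res_id_map]
    simp

instance (F : Cᵒᵖ ⥤ Grpd.{u, u}) (X : C) :
    (unitFunctor F X ⋙ evalSlice X ((totalFunctor C).obj F)).EssSurj where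
  mem_essImage := by
    rintro ⟨⟨X', a⟩, hX⟩
    obtain rfl : X' = X := hX
    refine ⟨a, ⟨eqToIso (Subtype.ext ?_)⟩⟩
    exact congrArg (TotalCat.mk X') (res_id_obj a)

instance (F : Cᵒᵖ ⥤ Grpd.{u, u}) (X : C) : (unitFunctor F X).IsEquivalence := by
  have : (unitFunctor F X ⋙ evalSlice X ((totalFunctor C).obj F)).IsEquivalence := { }
  exact Functor.isEquivalence_of_comp_right _ (evalSlice X ((totalFunctor C).obj F))

lemma objectwise_unitHom (F : Cᵒᵖ ⥤ Grpd.{u, u}) :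
    objectwise C grpdWeakEquivalences (unitHom F) :=
  fun X ↦ inferInstanceAs (unitFunctor F X).IsEquivalence

instance : (objectwise C grpdWeakEquivalences).HasTwoOutOfThreeProperty where
  comp_mem _ _ hf hg X := grpdWeakEquivalences.comp_mem _ _ (hf X) (hg X)
  of_postcomp _ _ hg h X := grpdWeakEquivalences.of_postcomp _ _ (hg X) (h X)
  of_precomp _ _ hf h X := grpdWeakEquivalences.of_precomp _ _ (hf X) (h X)

lemma sectionwise_map_iff (W : MorphismProperty Grpd.{u, u}) {E E' : GrpdOver C} (f : E ⟶ E') :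
    sectionwise C W f ↔ objectwise C W ((sectionsFunctor C).map f) := Iff.rfl

/-- The unit is natural and an objectwise equivalence, so two-out-of-three in its naturality square
compares `φ` with `Γ p φ`. -/
lemma sectionwise_total_map_iff (φ : F ⟶ F') :
    sectionwise C grpdWeakEquivalences ((totalFunctor C).map φ) ↔
      objectwise C grpdWeakEquivalences φ := by
  rw [sectionwise_map_iff, ← (objectwise C grpdWeakEquivalences).precomp_iff (unitHom F) _
    (objectwise_unitHom F), unitHom_naturality,
    (objectwise C grpdWeakEquivalences).postcomp_iff _ _ (objectwise_unitHom F')]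

end TotalAdjunction

/-! ### The model structure on presheaves of groupoids -/

section PresheafModelStructure

variable {C : Type u} [SmallCategory C]

/-- Tensors of a representable presheaf with groupoids. -/
def yonedaTensorFunctor (X : C) : Grpd.{u, u} ⥤ (Cᵒᵖ ⥤ Grpd.{u, u}) where
  obj G := yonedaTensor X G
  map f := yonedaTensorMap X f

open TotalCat

lemma discreteProd_functor_ext {ι : Type*} {G D : Type*} [Category* G] [Category* D]
    {S T : Discrete ι × G ⥤ D}
    (h : ∀ (i : ι) {a b : G} (k : a ⟶ b),
      Arr.map S ⟨show (Discrete.mk i, a) ⟶ (Discrete.mk i, b) from (𝟙 _, k)⟩ =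
        Arr.map T ⟨show (Discrete.mk i, a) ⟶ (Discrete.mk i, b) from (𝟙 _, k)⟩) : S = T := by
  refine Arr.functor_ext fun ⟨k⟩ ↦ ?_
  rename_i x y
  obtain ⟨⟨i⟩, a⟩ := x
  obtain ⟨⟨j⟩, b⟩ := y
  obtain ⟨⟨⟨h'⟩⟩, k⟩ := k
  obtain rfl : i = j := h'
  exact h i k

variable {X : C} {G : Grpd.{u, u}} {F : Cᵒᵖ ⥤ Grpd.{u, u}}

/-- The functor `G ⥤ F(X)` corresponding to a morphism `X ⊗ G ⟶ F`. -/
def yonedaTensorEval (φ : yonedaTensor X G ⟶ F) : G ⥤ F.obj (op X) :=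
  Functor.prod' ((Functor.const G).obj (Discrete.mk (𝟙 X))) (𝟭 G) ⋙ app φ X

/-- The value at `Y` of the morphism `X ⊗ G ⟶ F` corresponding to a functor `G ⥤ F(X)`. -/
def yonedaTensorDescApp (T : G ⥤ F.obj (op X)) (Y : C) : Discrete (Y ⟶ X) × G ⥤ F.obj (op Y) where
  obj x := (res F x.1.as).obj (T.obj x.2)
  map {x y} k := eqToHom (by rw [Discrete.eq_of_hom k.1]) ≫ (res F y.1.as).map (T.map k.2)
  map_id x := by simp
  map_comp {x y z} k l := by
    obtain ⟨⟨i⟩, a⟩ := x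
    obtain ⟨⟨j⟩, b⟩ := y
    obtain ⟨⟨j'⟩, c⟩ := z
    obtain ⟨⟨⟨hk⟩⟩, k⟩ := k
    obtain ⟨⟨⟨hl⟩⟩, l⟩ := l
    obtain rfl : i = j := hk
    obtain rfl : i = j' := hl
    simp

lemma map_yonedaTensorDescApp (T : G ⥤ F.obj (op X)) {Y : C} (f : Y ⟶ X) {a b : G} (k : a ⟶ b) :
    Arr.map (yonedaTensorDescApp T Y)
      ⟨show (Discrete.mk f, a) ⟶ (Discrete.mk f, b) from (𝟙 _, k)⟩ =
        Arr.map (res F f) (Arr.map T ⟨k⟩) :=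
  Arr.mk_inj.2 (Category.id_comp _)

lemma arrMap_res_comp {X Y Z : C} (f : X ⟶ Y) (g : Y ⟶ Z) (k : Arr (F.obj (op Z))) :
    Arr.map (res F (f ≫ g)) k = Arr.map (res F f) (Arr.map (res F g) k) :=
  congrArg (fun T : F.obj (op Z) ⥤ F.obj (op X) ↦ Arr.map T k) (F.map_comp g.op f.op)

/-- The morphism `X ⊗ G ⟶ F` corresponding to a functor `G ⥤ F(X)`. -/
def yonedaTensorDesc (T : G ⥤ F.obj (op X)) : yonedaTensor X G ⟶ F where
  app Y := yonedaTensorDescApp T Y.unop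
  naturality Y Z f := by
    refine discreteProd_functor_ext (S := Functor.prod (discretePrecomp X f.unop) (𝟭 G) ⋙
      yonedaTensorDescApp T Z.unop) (T := yonedaTensorDescApp T Y.unop ⋙ res F f.unop)
      fun g a b k ↦ ?_
    refine Eq.trans ?_ ((arrMap_res_comp f.unop g (Arr.map T ⟨k⟩)).trans
      (congrArg (Arr.map (res F f.unop)) (map_yonedaTensorDescApp T g k).symm))
    exact map_yonedaTensorDescApp T (f.unop ≫ g) k

lemma yonedaTensorEval_desc (T : G ⥤ F.obj (op X)) :
    yonedaTensorEval (yonedaTensorDesc T) = T :=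
  Arr.functor_ext fun ⟨k⟩ ↦ (map_yonedaTensorDescApp T (𝟙 X) k).trans
    (congrArg (fun T : F.obj (op X) ⥤ F.obj (op X) ↦ Arr.map T _) (F.map_id (op X)))

lemma yonedaTensorDesc_eval (φ : yonedaTensor X G ⟶ F) :
    yonedaTensorDesc (yonedaTensorEval φ) = φ := by
  refine NatTrans.ext (funext fun Y ↦ ?_)
  refine discreteProd_functor_ext (S := yonedaTensorDescApp _ Y.unop) (T := app φ Y.unop)
    fun f a b k ↦ ?_
  refine (map_yonedaTensorDescApp (yonedaTensorEval φ) f k).trans ?_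
  -- As in the Yoneda lemma, naturality with respect to `f` moves the evaluation to the identity of
  -- `X`.
  let k' : Arr (Discrete (X ⟶ X) × G) :=
    ⟨show (Discrete.mk (𝟙 X), a) ⟶ (Discrete.mk (𝟙 X), b) from (𝟙 _, k)⟩
  have h₁ : Arr.map (Functor.prod (discretePrecomp X f) (𝟭 G)) k' =
      ⟨show (Discrete.mk f, a) ⟶ (Discrete.mk f, b) from (𝟙 _, k)⟩ := by
    have h (f' : Y.unop ⟶ X) (hf : f' = f) :
        (⟨show (Discrete.mk f', a) ⟶ (Discrete.mk f', b) from (𝟙 _, k)⟩ :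
          Arr (Discrete (Y.unop ⟶ X) × G)) =
        ⟨show (Discrete.mk f, a) ⟶ (Discrete.mk f, b) from (𝟙 _, k)⟩ := by
      subst hf
      rfl
    refine Eq.trans ?_ (h (f ≫ 𝟙 X) (Category.comp_id f))
    exact Arr.mk_inj.2 (Prod.ext (Subsingleton.elim _ _) rfl)
  exact (congrArg (fun T : Discrete (X ⟶ X) × G ⥤ F.obj (op Y.unop) ↦ Arr.map T k')
    (φ.naturality f.op)).symm.trans (congrArg (Arr.map (app φ Y.unop)) h₁)

lemma yonedaTensorDesc_comp {H : Grpd.{u, u}} (f : H ⟶ G) (T : G ⥤ F.obj (op X)) :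
    yonedaTensorDesc (grpdFunctor f ⋙ T) = yonedaTensorMap X f ≫ yonedaTensorDesc T := rfl

/-- The Yoneda lemma for presheaves of groupoids. -/
def yonedaTensorAdjunction (X : C) :
    yonedaTensorFunctor X ⊣ (evaluation Cᵒᵖ Grpd.{u, u}).obj (op X) :=
  Adjunction.mkOfHomEquiv
    { homEquiv := fun _ _ ↦
        { toFun := fun φ ↦ yonedaTensorEval φ
          invFun := fun T ↦ yonedaTensorDesc T
          left_inv := yonedaTensorDesc_eval
          right_inv := yonedaTensorEval_desc }
      homEquiv_naturality_left_symm := yonedaTensorDesc_comp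
      homEquiv_naturality_right := fun _ _ ↦ rfl }

lemma llp_map_of_adjunction {M : Type*} [Category* M] {N : Type*} [Category* N] {L : M ⥤ N}
    {R : N ⥤ M} (adj : L ⊣ R) {W : MorphismProperty M} {W' : MorphismProperty N}
    (h : ∀ {X Y : N} (f : X ⟶ Y), W' f → W (R.map f)) {A B : M} (i : A ⟶ B) (hi : W.llp i) :
    W'.llp (L.map i) := fun _ _ f hf ↦ by
  have := hi _ (h f hf)
  exact (adj.hasLiftingProperty_iff i f).2 this

/-- No path objects of presheaves are needed: `Γ` preserves fibrations, so `p φ` inherits the left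
lifting property. It is therefore a weak equivalence, and `p` reflects weak equivalences. -/
lemma llp_objectwise_grpdFibrations_le :
    (objectwise C grpdFibrations).llp ≤ objectwise C grpdWeakEquivalences := fun _ _ φ hφ ↦ by
  rw [← sectionwise_total_map_iff]
  refine llp_sectionwise_grpdFibrations_le _ ?_
  exact llp_map_of_adjunction totalAdjunction
    (fun f hf ↦ (sectionwise_map_iff grpdFibrations f).1 hf) φ hφ

/-- Maps out of `X ⊗ G` are maps from `G` to the value at `X`, and evaluation preserves colimits. So
the smallness of `G` is what counts. -/
lemma hasSmallObjectArgument_yonedaTensor {ι : Type u} {X : ι → C} {G : ι → Grpd.{u, u}}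
    {B : ι → Cᵒᵖ ⥤ Grpd.{u, u}} (f : ∀ i, yonedaTensor (X i) (G i) ⟶ B i) :
    MorphismProperty.HasSmallObjectArgument.{u} (MorphismProperty.ofHoms f) :=
  hasSmallObjectArgument_ofHoms_of_sizes f (fun i ↦ Arr (G i) × Arr (G i) × Arr (G i))
    fun J _ _ i hi F ↦ by
    let R := (evaluation Cᵒᵖ Grpd.{u, u}).obj (op (X i))
    have := Grpd.preservesColimit_coyoneda_of_bddAbove (F ⋙ R) (G i) hi
    have : PreservesColimit F (R ⋙ coyoneda.obj (op (G i))) :=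
      comp_preservesColimit R (coyoneda.obj (op (G i)))
    exact preservesColimit_of_natIso (F := R ⋙ coyoneda.obj (op (G i))) F
      ((yonedaTensorAdjunction (X i)).compCoyonedaIso.app _).symm

variable (C) in
theorem exists_presheafModelCategory : ∃ (_ : ModelCategory (Cᵒᵖ ⥤ Grpd.{u, u})),
    weakEquivalences (Cᵒᵖ ⥤ Grpd.{u, u}) = objectwise C grpdWeakEquivalences ∧
      fibrations (Cᵒᵖ ⥤ Grpd.{u, u}) = objectwise C grpdFibrations ∧
      cofibrations (Cᵒᵖ ⥤ Grpd.{u, u}) = (trivialFibrations (Cᵒᵖ ⥤ Grpd.{u, u})).llp ∧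
      IsStrongModelCategory (Cᵒᵖ ⥤ Grpd.{u, u}) ∧
      IsCofibrantlyGeneratedBy (Cᵒᵖ ⥤ Grpd.{u, u})
        (presheafGeneratingCofibrations C) (presheafGeneratingTrivialCofibrations C) :=
  exists_detectedModelCategory (L := fun X : C ↦ yonedaTensorFunctor X)
    yonedaTensorAdjunction llp_objectwise_grpdFibrations_le
    (hasSmallObjectArgument_yonedaTensor _) (hasSmallObjectArgument_yonedaTensor _)

variable [ModelCategory (GrpdOver C)] [ModelCategory (Cᵒᵖ ⥤ Grpd.{u, u})]
  (hW : weakEquivalences (GrpdOver C) = sectionwise C grpdWeakEquivalences)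
  (hF : fibrations (GrpdOver C) = sectionwise C grpdFibrations)
  (hC : cofibrations (GrpdOver C) = (trivialFibrations (GrpdOver C)).llp)
  (hW' : weakEquivalences (Cᵒᵖ ⥤ Grpd.{u, u}) = objectwise C grpdWeakEquivalences)
  (hF' : fibrations (Cᵒᵖ ⥤ Grpd.{u, u}) = objectwise C grpdFibrations)
  (hC' : cofibrations (Cᵒᵖ ⥤ Grpd.{u, u}) = (trivialFibrations (Cᵒᵖ ⥤ Grpd.{u, u})).llp)

include hW hF hC hW' hF' hC'

lemma isQuillenAdjunction_total (adj : totalFunctor C ⊣ sectionsFunctor C) :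
    IsQuillenAdjunction adj where
  map_cofibrations i hi := by
    rw [hC'] at hi
    rw [hC]
    refine llp_map_of_adjunction adj (fun f hf ↦ ?_) i hi
    rw [trivialFibrations, hF, hW] at hf
    rw [trivialFibrations, hF', hW']
    exact hf
  map_trivialCofibrations i hi := by
    rw [← fibrations_llp] at hi ⊢
    refine llp_map_of_adjunction adj (fun f hf ↦ ?_) i hi
    rw [hF] at hf
    rw [hF']
    exact hf

/-- The functor `p` preserves pushouts and cofibrations, and it preserves and reflects weak
equivalences. -/
lemma isLeftProper_presheaf : IsLeftProper (Cᵒᵖ ⥤ Grpd.{u, u}) := by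
  intro A B X Y f i j g sq hf hi
  rw [hW', ← sectionwise_total_map_iff, ← hW] at hf ⊢
  have := totalAdjunction (C := C).leftAdjoint_preservesColimits
  exact isLeftProper_fibered hW hF hC _ _ _ _ (sq.map (totalFunctor C)) hf
    ((isQuillenAdjunction_total hW hF hC hW' hF' hC' totalAdjunction).map_cofibrations i hi)

/-- The adjunct of `f` is the unit followed by `Γ f`. The unit is a weak equivalence and `Γ` detects
weak equivalences. An arbitrary adjunction has the same unit as `totalAdjunction` up to an
automorphism of `Γ p F`-type, namely the isomorphism between left adjoints under `Γ`. -/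
lemma isQuillenEquivalence_total (adj : totalFunctor C ⊣ sectionsFunctor C) :
    IsQuillenEquivalence adj where
  toIsQuillenAdjunction := isQuillenAdjunction_total hW hF hC hW' hF' hC' adj
  weakEquivalence_iff F E _ _ f := by
    have h : objectwise C grpdWeakEquivalences (adj.unit.app F) := by
      rw [← totalAdjunction.unit_leftAdjointUniq_hom_app adj, totalAdjunction_unit]
      refine MorphismProperty.comp_mem _ _ _ (objectwise_unitHom F) ?_
      rw [← hW']
      exact (weakEquivalence_iff _).1 inferInstance
    rw [hW, hW', adj.homEquiv_unit, (objectwise C grpdWeakEquivalences).precomp_iff _ _ h]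
    exact sectionwise_map_iff _ _

end PresheafModelStructure

/-! ### Maps from products of simplicial sets to nerves of groupoids -/

section Nerves

/-- The comparison map of the nerve of a product. -/
def nerveProd (A B : Type u) [SmallCategory A] [SmallCategory B] :
    nerve A ⊗ nerve B ⟶ nerve (A × B) where
  app _ := ↾fun x ↦ Functor.prod' x.1 x.2
  naturality _ _ _ := rfl

instance (A B : Type u) [SmallCategory A] [SmallCategory B] : IsIso (nerveProd A B) := by
  let f : nerve (A × B) ⟶ nerve A ⊗ nerve B :=
    { app := fun _ ↦ ↾fun x ↦ (x ⋙ CategoryTheory.Prod.fst A B, x ⋙ CategoryTheory.Prod.snd A B)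
      naturality := fun _ _ _ ↦ rfl }
  exact ⟨f, rfl, rfl⟩

/-- The unit of the nerve adjunction. -/
noncomputable abbrev hoUnit (K : SSet.{u}) : K ⟶ nerve (SSet.hoFunctor.obj K) :=
  nerveAdjunction.unit.app K

lemma isIso_map_unit_of_isIso_counit {M N : Type*} [Category* M] [Category* N] {L : M ⥤ N}
    {R : N ⥤ M} (adj : L ⊣ R) (X : M) [IsIso (adj.counit.app (L.obj X))] :
    IsIso (L.map (adj.unit.app X)) := by
  have h : inv (adj.counit.app (L.obj X)) = L.map (adj.unit.app X) :=
    IsIso.inv_eq_of_inv_hom_id (adj.left_triangle_components X)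
  rw [← h]
  infer_instance

/-- Under the adjunction the map becomes precomposition with the isomorphism `L.map f ≫
adj.counit.app A`. -/
lemma bijective_comp_map_of_adjunction {M N : Type*} [Category* M] [Category* N] {L : M ⥤ N}
    {R : N ⥤ M} (adj : L ⊣ R) {X : M} {A : N} (f : X ⟶ R.obj A) (_ : IsIso (L.map f))
    [IsIso (adj.counit.app A)] (B : N) : Function.Bijective fun F : A ⟶ B ↦ f ≫ R.map F := by
  have h (F : A ⟶ B) : f ≫ R.map F =
      adj.homEquiv X B ((L.map f ≫ adj.counit.app A) ≫ F) := by
    simp [Adjunction.homEquiv_unit]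
  simp only [h]
  refine (Equiv.bijective _).comp ⟨fun g g' h ↦ (cancel_epi _).1 h, fun g ↦
    ⟨inv (L.map f ≫ adj.counit.app A) ≫ g, IsIso.hom_inv_id_assoc _ _⟩⟩

instance isIso_hoFunctor_map_hoUnit (K : SSet.{u}) : IsIso (SSet.hoFunctor.map (hoUnit K)) :=
  isIso_map_unit_of_isIso_counit nerveAdjunction K

lemma bijective_comp_nerveMap {K : SSet.{u}} {A : Type u} [SmallCategory A] (f : K ⟶ nerve A)
    (hf : IsIso (SSet.hoFunctor.map f)) (B : Type u) [SmallCategory B] :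
    Function.Bijective fun F : A ⥤ B ↦ f ≫ nerveMap F :=
  (bijective_comp_map_of_adjunction nerveAdjunction (A := Cat.of A) f hf (Cat.of B)).comp
    (Cat.Hom.equivFunctor (Cat.of A) (Cat.of B)).symm.bijective

/-- `hoFunctor` is monoidal, so it turns the tensor product of the units into a tensor product of
isomorphisms. Hence maps from `K ⊗ L` to a nerve are functors on a product of homotopy categories.
-/
instance isIso_hoFunctor_map_tensor (K L : SSet.{u}) : IsIso (SSet.hoFunctor.map
    ((hoUnit K ⊗ₘ hoUnit L) ≫ nerveProd _ _)) := by
  have : IsIso (SSet.hoFunctor.map (hoUnit K ⊗ₘ hoUnit L)) := by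
    rw [Functor.Monoidal.map_tensor]
    infer_instance
  rw [Functor.map_comp]
  infer_instance

/-- Functors to a groupoid form a groupoid. -/
noncomputable abbrev functorGroupoid (Q H : Type u) [SmallCategory Q] [Groupoid.{u} H] : Groupoid (Q ⥤ H) :=
  Groupoid.ofIsIso fun _ ↦ NatIso.isIso_of_isIso_app _

lemma curry_obj_prod_comp {P P' Q H : Type*} [Category* P] [Category* P'] [Category* Q]
    [Category* H] (S : P ⥤ P') (F : P' × Q ⥤ H) :
    Functor.curry.obj (Functor.prod S (𝟭 Q) ⋙ F) = S ⋙ Functor.curry.obj F := by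
  refine CategoryTheory.Functor.ext (fun p ↦ CategoryTheory.Functor.ext (fun _ ↦ rfl)
    fun _ _ _ ↦ by simp) fun p p' f ↦ ?_
  ext q
  simp [eqToHom_app]

/-- After currying this is the universal property of the free groupoid, because the functors from
`Q` to a groupoid form a groupoid. -/
lemma bijective_prod_comp_of (P Q H : Type u) [SmallCategory P] [SmallCategory Q]
    [Groupoid.{u} H] : Function.Bijective fun F : FreeGroupoid P × Q ⥤ H ↦
      Functor.prod (FreeGroupoid.of P) (𝟭 Q) ⋙ F := by
  let _ := functorGroupoid Q H
  constructor
  · intro F F' h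
    refine Functor.curry_obj_injective ?_
    have h' : FreeGroupoid.of P ⋙ Functor.curry.obj F =
      FreeGroupoid.of P ⋙ Functor.curry.obj F' := by
      rw [← curry_obj_prod_comp, ← curry_obj_prod_comp]
      exact congrArg Functor.curry.obj h
    exact (FreeGroupoid.lift_unique _ _ h').trans (FreeGroupoid.lift_unique _ _ rfl).symm
  · intro F
    refine ⟨Functor.uncurry.obj (FreeGroupoid.lift (Functor.curry.obj F)), ?_⟩
    refine Functor.curry_obj_injective ?_
    rw [curry_obj_prod_comp, Functor.curry_obj_uncurry_obj, FreeGroupoid.lift_spec]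

/-- The fundamental groupoid of a simplicial set. -/
abbrev fundamentalGrpd (K : SSet.{u}) : Grpd.{u, u} := Grpd.of (FreeGroupoid (SSet.hoFunctor.obj K))

/-- The universal map from a simplicial set to the nerve of a groupoid. -/
noncomputable def fundamentalUnit (K : SSet.{u}) : K ⟶ nerve (fundamentalGrpd K) :=
  hoUnit K ≫ nerveMap (FreeGroupoid.of _)

lemma bijective_comp_of_bijective_obj {E D : Type u} [SmallCategory E] [SmallCategory D]
    (Φ : E ⥤ D) [Φ.Full] [Φ.Faithful] (hΦ : Function.Bijective Φ.obj) (Q : Type u)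
    [SmallCategory Q] : Function.Bijective fun b : Q ⥤ E ↦ b ⋙ Φ := by
  constructor
  · intro b b' h
    have h₀ (q : Q) : b.obj q = b'.obj q := hΦ.injective (Functor.congr_obj h q)
    refine CategoryTheory.Functor.ext h₀ fun q q' f ↦ Φ.map_injective ?_
    rw [Functor.map_comp, Functor.map_comp, eqToHom_map, eqToHom_map]
    exact Functor.congr_hom h f
  · intro F
    choose o ho using fun q ↦ hΦ.surjective (F.obj q)
    refine ⟨{ obj := o
              map := fun {q q'} f ↦ Φ.preimage (eqToHom (ho q) ≫ F.map f ≫ eqToHom (ho q').symm)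
              map_id := fun q ↦ Φ.map_injective (by simp)
              map_comp := fun f g ↦ Φ.map_injective (by simp) },
      CategoryTheory.Functor.ext ho fun q q' f ↦ Φ.map_preimage _⟩

/-- Maps `L ⟶ nerve T` are functors from the homotopy category of `L` to `T`. As `Φ` is an
isomorphism onto the functors from the fundamental groupoid of `K` to `H`, uncurrying and the
universal properties of both factors turn these into maps `K ⊗ L ⟶ nerve H`. Applied to mapping
groupoids, this gives tensors and, after a swap, cotensors. -/
lemma bijective_tensor_comp_nerve (K : SSet.{u}) {T H : Type u} [Groupoid.{u} T] [Groupoid.{u} H]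
    (ev : fundamentalGrpd K × T ⥤ H) (Φ : T ⥤ fundamentalGrpd K ⥤ H)
    (hev : Functor.curry.obj (CategoryTheory.Prod.swap _ _ ⋙ ev) = Φ) [Φ.Full] [Φ.Faithful]
    (hΦ : Function.Bijective Φ.obj) (L : SSet.{u}) :
    Function.Bijective fun β : L ⟶ nerve T ↦
      (fundamentalUnit K ⊗ₘ β) ≫ nerveProd _ _ ≫ nerveMap ev := by
  have h₁ := bijective_comp_nerveMap (hoUnit L) inferInstance T
  let sw := CategoryTheory.Prod.swap (SSet.hoFunctor.obj L) (fundamentalGrpd K)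
  have h₂ : Function.Bijective fun b : SSet.hoFunctor.obj L ⥤ T ↦
      Functor.prod (𝟭 (fundamentalGrpd K)) b ⋙ ev := by
    have h₅ : Function.Bijective fun F : fundamentalGrpd K × SSet.hoFunctor.obj L ⥤ H ↦
        Functor.curry.obj (sw ⋙ F) :=
      ⟨fun F F' h ↦ congrArg (CategoryTheory.Prod.swap _ _ ⋙ ·) (Functor.curry_obj_injective h),
        fun F ↦ ⟨CategoryTheory.Prod.swap _ _ ⋙ Functor.uncurry.obj F,
          Functor.curry_obj_uncurry_obj F⟩⟩
    rw [← h₅.of_comp_iff']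
    convert bijective_comp_of_bijective_obj Φ hΦ (SSet.hoFunctor.obj L) using 2 with b
    rw [← hev]
    exact curry_obj_prod_comp b (CategoryTheory.Prod.swap _ _ ⋙ ev)
  have h₃ := bijective_prod_comp_of (SSet.hoFunctor.obj K) (SSet.hoFunctor.obj L) H
  have h₄ := bijective_comp_nerveMap ((hoUnit K ⊗ₘ hoUnit L) ≫ nerveProd _ _) inferInstance H
  rw [← Function.Bijective.of_comp_iff _ h₁]
  exact (h₄.comp (h₃.comp h₂))

lemma bijective_comp_tensor_nerve (K : SSet.{u}) {T H : Type u} [Groupoid.{u} T] [Groupoid.{u} H]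
    (ev : T × fundamentalGrpd K ⥤ H) (Φ : T ⥤ fundamentalGrpd K ⥤ H)
    (hev : Functor.curry.obj ev = Φ) [Φ.Full] [Φ.Faithful]
    (hΦ : Function.Bijective Φ.obj) (L : SSet.{u}) :
    Function.Bijective fun β : L ⟶ nerve T ↦
      (β ⊗ₘ fundamentalUnit K) ≫ nerveProd _ _ ≫ nerveMap ev := by
  have h₁ := bijective_tensor_comp_nerve K (CategoryTheory.Prod.swap _ _ ⋙ ev) Φ hev hΦ L
  have h₂ : Function.Bijective fun f : K ⊗ L ⟶ nerve H ↦ (β_ L K).hom ≫ f :=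
    ⟨fun f g h ↦ (cancel_epi _).1 h, fun f ↦ ⟨(β_ L K).inv ≫ f, Iso.hom_inv_id_assoc _ _⟩⟩
  exact h₂.comp h₁

end Nerves

/-! ### Tensors and cotensors with simplicial sets -/

section SimplicialTensors

variable {C : Type u} [SmallCategory C]

lemma comp_comp_eq_comp_comp {D : Type*} [Category* D] {x y z x' y' z' : D} {a : x ⟶ y}
    {b : y ⟶ z} {c : z ⟶ z'} {d : x ⟶ x'} {e : y ⟶ y'} {a' : x' ⟶ y'} {b' : y' ⟶ z'}
    (h₁ : a ≫ e = d ≫ a') (h₂ : b ≫ c = e ≫ b') : (a ≫ b) ≫ c = d ≫ a' ≫ b' := by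
  rw [Category.assoc, h₂, reassoc_of% h₁]

/-! ### Tensors with groupoids and with simplicial sets -/

section Tensor

variable (A E : GrpdOver C) (G : Grpd.{u, u})

/-- The unit of the tensor product with a groupoid. -/
def tensorUnit : G ⥤ BasedFunctor A.obj (tensor A G).obj :=
  tensorCurry (BasedFunctor.id (tensor A G).obj)

/-- Evaluation of functors on a tensor product. -/
def tensorEval : G × BasedFunctor (tensor A G).obj E.obj ⥤ BasedFunctor A.obj E.obj :=
  Functor.prod (tensorUnit A G) (𝟭 (BasedFunctor (tensor A G).obj E.obj)) ⋙
    basedCompFunctor _ _ _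

/-- Currying of functors on a tensor product, as a functor. -/
def tensorCurryFunctor :
    BasedFunctor (tensor A G).obj E.obj ⥤ G ⥤ BasedFunctor A.obj E.obj :=
  Functor.curry.obj (CategoryTheory.Prod.swap _ _ ⋙ tensorEval A E G)

lemma tensorCurryFunctor_obj (S : BasedFunctor (tensor A G).obj E.obj) :
    (tensorCurryFunctor A E G).obj S = tensorCurry S :=
  CategoryTheory.Functor.hext (fun _ ↦ rfl) fun _ _ _ ↦ heq_of_eq
    (BasedNatTrans.ext _ _ (NatTrans.ext (funext fun _ ↦ Category.comp_id _)))

lemma bijective_tensorCurryFunctor_obj : Function.Bijective (tensorCurryFunctor A E G).obj := by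
  rw [show (tensorCurryFunctor A E G).obj = tensorCurry from
    funext (tensorCurryFunctor_obj A E G)]
  exact ⟨Function.LeftInverse.injective tensorUncurry_tensorCurry,
    Function.RightInverse.surjective tensorCurry_tensorUncurry⟩

lemma tensorCurryFunctor_map_app {S S' : BasedFunctor (tensor A G).obj E.obj} (τ : S ⟶ S') (g : G)
    (a : A.obj.obj) : (((tensorCurryFunctor A E G).map τ).app g).toNatTrans.app a =
      τ.toNatTrans.app (tensorMk a g) := by
  refine (congrArg (· ≫ _) (S.map_id _)).trans (Category.id_comp _)

instance : (tensorCurryFunctor A E G).Faithful where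
  map_injective {S S'} τ τ' h := by
    refine BasedNatTrans.ext _ _ (NatTrans.ext (funext fun x ↦ ?_))
    obtain ⟨a, g⟩ := x
    exact (tensorCurryFunctor_map_app A E G τ g a).symm.trans
      ((congrArg (fun (σ : (tensorCurryFunctor A E G).obj S ⟶ (tensorCurryFunctor A E G).obj S') ↦
        (σ.app g).toNatTrans.app a) h).trans (tensorCurryFunctor_map_app A E G τ' g a))

instance : (tensorCurryFunctor A E G).Full where
  map_surjective {S S'} σ := by
    let τ : S ⟶ S' :=
      { app := fun (x : A.obj.obj × G) ↦ (σ.app x.2).toNatTrans.app x.1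
        naturality := fun (x y : A.obj.obj × G) (k : x ⟶ y) ↦ by
          have h₁ : S.map (tensorHom k.1 (𝟙 x.2)) ≫ (σ.app x.2).toNatTrans.app y.1 =
            (σ.app x.2).toNatTrans.app x.1 ≫ S'.map (tensorHom k.1 (𝟙 x.2)) :=
            (σ.app x.2).toNatTrans.naturality k.1
          have h₂ : S.map (tensorHom (𝟙 y.1) k.2) ≫ (σ.app y.2).toNatTrans.app y.1 =
              (σ.app x.2).toNatTrans.app y.1 ≫ S'.map (tensorHom (𝟙 y.1) k.2) := by
            have h := congrArg (fun (β : ((tensorCurryFunctor A E G).obj S).obj x.2 ⟶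
              ((tensorCurryFunctor A E G).obj S').obj y.2) ↦ β.toNatTrans.app y.1)
              (σ.naturality k.2)
            exact (congrArg (· ≫ _) (Category.comp_id _)).symm.trans
              (h.trans (congrArg (_ ≫ ·) (Category.comp_id _)))
          have h₃ (S : BasedFunctor (tensor A G).obj E.obj) : S.map k =
              S.map (tensorHom k.1 (𝟙 x.2)) ≫ S.map (tensorHom (𝟙 y.1) k.2) := by
            rw [← S.map_comp, tensorHom_comp, Category.comp_id, Category.id_comp]
            rfl
          rw [h₃ S, h₃ S']
          exact comp_comp_eq_comp_comp h₁ h₂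
        isHomLift' := fun (x : A.obj.obj × G) ↦ (σ.app x.2).isHomLift' x.1 }
    refine ⟨τ, NatTrans.ext (funext fun g ↦ BasedNatTrans.ext _ _ (NatTrans.ext (funext fun a ↦
      tensorCurryFunctor_map_app A E G τ g a)))⟩

end Tensor

lemma exists_isSimplicialTensor (A : GrpdOver C) (K : SSet.{u}) :
    ∃ (T : GrpdOver C) (η : K ⟶ SimplicialCategory.sHom A T), IsSimplicialTensor η :=
  ⟨tensor A (fundamentalGrpd K), fundamentalUnit K ≫ nerveMap (tensorUnit A _), fun E L ↦
    bijective_tensor_comp_nerve K (tensorEval A E _) (tensorCurryFunctor A E _) rfl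
      (bijective_tensorCurryFunctor_obj _ _ _) L⟩

/-! ### Cotensors with groupoids -/

section Cotensor

lemma Arr.mk_eqToHom {D : Type*} [Category* D] {x y z : D} (h : x = z) (h' : x = y) :
    (⟨eqToHom h'⟩ : Arr D) = ⟨𝟙 z⟩ := by
  subst h h'
  rfl

lemma isHomLift_eqToHom {E : Type*} [Category* E] {p : E ⥤ C} {a b : E} {φ : a ⟶ b} {X Y Z : C}
    (hφ : p.IsHomLift (𝟙 Z) φ) (h : X = Z) (h' : X = Y) : p.IsHomLift (eqToHom h') φ := by
  subst h h'
  exact hφ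

lemma eqToHom_conj_comp {D : Type*} [Category* D] {x x' x'' y y' y'' : D} (f : x ⟶ y) (h₁ : x' = x)
    (h₂ : y = y') (h₃ : y' = y'') (h₄ : x' = x'') (h₅ : x'' = x) (h₆ : y = y'') :
    (eqToHom h₁ ≫ f ≫ eqToHom h₂) ≫ eqToHom h₃ = eqToHom h₄ ≫ eqToHom h₅ ≫ f ≫ eqToHom h₆ := by
  subst h₄ h₃
  simp

/-- Objects of the cotensor product of `E` with `G`: functors from `G` to fibers of `E`. -/
structure CotensorObj (E : GrpdOver C) (G : Grpd.{u, u}) : Type u where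
  -- The base is separate data because it cannot be recovered from the functor if `G` is empty.
  base : C
  functor : G ⥤ E.obj.obj
  isHomLift {g g' : G} (k : g ⟶ g') : E.obj.p.IsHomLift (𝟙 base) (functor.map k)

namespace CotensorObj

variable {E : GrpdOver C} {G : Grpd.{u, u}}

/-- Morphisms of the cotensor product. -/
@[ext]
structure Hom (x y : CotensorObj E G) : Type u where
  base : x.base ⟶ y.base
  nat : x.functor ⟶ y.functor
  isHomLift (g : G) : E.obj.p.IsHomLift base (nat.app g)

instance : Category.{u} (CotensorObj E G) where
  Hom := Hom
  id x := ⟨𝟙 x.base, 𝟙 x.functor, fun g ↦ by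
    have := x.isHomLift (𝟙 g)
    rwa [x.functor.map_id] at this⟩
  comp f f' := ⟨f.base ≫ f'.base, f.nat ≫ f'.nat, fun g ↦ by
    have := f.isHomLift g
    have := f'.isHomLift g
    exact inferInstanceAs (E.obj.p.IsHomLift (f.base ≫ f'.base) (f.nat.app g ≫ f'.nat.app g))⟩
  id_comp f := Hom.ext (Category.id_comp _) (Category.id_comp _)
  comp_id f := Hom.ext (Category.comp_id _) (Category.comp_id _)
  assoc f f' f'' := Hom.ext (Category.assoc _ _ _) (Category.assoc _ _ _)

variable (E G) in
/-- The projection of the cotensor product. -/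
def proj : CotensorObj E G ⥤ C where
  obj x := x.base
  map f := f.base

lemma hom_ext {x y : CotensorObj E G} {f f' : x ⟶ y} (h : Hom.base f = Hom.base f')
    (h' : ∀ g, (Hom.nat f).app g = (Hom.nat f').app g) : f = f' :=
  Hom.ext h (NatTrans.ext (funext h'))

lemma arr_ext {f f' : Arr (CotensorObj E G)} (hb : Arr.map (proj E G) f = Arr.map (proj E G) f')
    (hs : ∀ k, Arr.map f.src.functor k = Arr.map f'.src.functor k)
    (ht : ∀ k, Arr.map f.tgt.functor k = Arr.map f'.tgt.functor k)
    (h : ∀ g, (⟨(Hom.nat f.hom).app g⟩ : Arr E.obj.obj) = ⟨(Hom.nat f'.hom).app g⟩) : f = f' := by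
  obtain ⟨f⟩ := f
  obtain ⟨f'⟩ := f'
  rename_i x y x' y'
  obtain ⟨a, S, hS⟩ := x
  obtain ⟨b, T, hT⟩ := y
  obtain ⟨a', S', hS'⟩ := x'
  obtain ⟨b', T', hT'⟩ := y'
  obtain rfl : S = S' := Arr.functor_ext hs
  obtain rfl : T = T' := Arr.functor_ext ht
  obtain rfl : a = a' := congrArg Arr.src hb
  obtain rfl : b = b' := congrArg Arr.tgt hb
  exact Arr.mk_inj.2 (hom_ext (Arr.mk_inj.1 hb) fun g ↦ Arr.mk_inj.1 (h g))

/-- Lifts and factorizations are taken separately at each object of `G`. The uniqueness of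
factorizations in `E` makes them functorial and natural. -/
lemma isFiberedInGroupoids_proj : IsFiberedInGroupoids (proj E G) where
  exists_lift {c} x f₀ := by
    let f : c ⟶ x.base := f₀
    have h₁ (g : G) : ∃ (y : E.obj.obj) (φ : y ⟶ x.functor.obj g), E.obj.p.IsHomLift f φ := by
      have := x.isHomLift (𝟙 g)
      exact E.property.exists_isHomLift (x.functor.obj g) f
        (IsHomLift.domain_eq E.obj.p (𝟙 x.base) (x.functor.map (𝟙 g))).symm
    choose y φ hφ using h₁
    have h₂ (g g' : G) (k : g ⟶ g') : ∃ l : y g ⟶ y g', l ≫ φ g' = φ g ≫ x.functor.map k ∧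
        E.obj.p.IsHomLift (𝟙 c) l := by
      have := x.isHomLift k
      have := hφ g
      refine E.property.exists_hom (φ g') _ (𝟙 c) f (hφ g') ?_
      rw [Category.id_comp, ← Category.comp_id f]
      infer_instance
    choose l hl hl' using h₂
    let y' : CotensorObj E G :=
      { base := c
        functor :=
          { obj := y
            map := fun k ↦ l _ _ k
            map_id := fun g ↦ by
              have := hφ g
              have := IsHomLift.domain_eq E.obj.p f (φ g)
              refine E.property.hom_ext (φ g) (𝟙 c) (hl' _ _ _) (IsHomLift.id this) ?_
              rw [hl, x.functor.map_id, Category.comp_id, Category.id_comp]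
            map_comp := fun {g g' g''} k k' ↦ by
              have := hl' _ _ k
              have := hl' _ _ k'
              have h : E.obj.p.IsHomLift (𝟙 c ≫ 𝟙 c) (l _ _ k ≫ l _ _ k') := inferInstance
              rw [Category.comp_id] at h
              refine E.property.hom_ext (φ g'') (𝟙 c) (hl' _ _ _) h ?_
              rw [hl, x.functor.map_comp, Category.assoc, hl, ← Category.assoc, ← Category.assoc,
                hl] }
        isHomLift := fun k ↦ hl' _ _ k }
    let f' : y' ⟶ x := ⟨f, ⟨φ, fun g g' k ↦ hl _ _ k⟩, hφ⟩
    exact ⟨y', f', .map f'⟩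
  existsUnique_fac {z x y} f g h w := by
    have hex (a : G) : ∃ k : x.functor.obj a ⟶ y.functor.obj a,
        k ≫ (Hom.nat g).app a = (Hom.nat f).app a ∧ E.obj.p.IsHomLift h k := by
      refine E.property.exists_hom _ _ h (Hom.base g) (Hom.isHomLift g a) ?_
      have h₁ : h ≫ Hom.base g = Hom.base f := w
      rw [h₁]
      exact Hom.isHomLift f a
    choose k hk hk' using hex
    let h₀ : x.base ⟶ y.base := h
    let h' : x ⟶ y := ⟨h, ⟨k, fun a b l ↦ by
      have h₁ := x.isHomLift l
      have h₂ := y.isHomLift l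
      have h₃ : E.obj.p.IsHomLift h₀ (k a) := hk' a
      have h₄ : E.obj.p.IsHomLift h₀ (k b) := hk' b
      refine E.property.hom_ext ((Hom.nat g).app b) h₀ inferInstance inferInstance ?_
      rw [Category.assoc, hk, Category.assoc, (Hom.nat g).naturality, reassoc_of% hk,
        (Hom.nat f).naturality]⟩, hk'⟩
    refine ⟨h', ⟨hom_ext w fun a ↦ hk a, rfl⟩, fun l hl ↦ hom_ext hl.2 fun a ↦ ?_⟩
    obtain ⟨h₁, h₂⟩ := hl
    have h₃ : Hom.base l = h := h₂
    refine E.property.hom_ext ((Hom.nat g).app a) h (h₃ ▸ Hom.isHomLift l a) (hk' a) ?_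
    rw [hk, ← h₁]
    rfl

end CotensorObj

/-- The cotensor product of a category over `C` with a groupoid. -/
def cotensor (E : GrpdOver C) (G : Grpd.{u, u}) : GrpdOver C where
  obj := BasedCategory.ofFunctor (CotensorObj.proj E G)
  property := CotensorObj.isFiberedInGroupoids_proj

variable (A E : GrpdOver C) (G : Grpd.{u, u})

/-- The counit of the cotensor product with a groupoid. -/
def cotensorCounit : G ⥤ BasedFunctor (cotensor E G).obj E.obj where
  obj g :=
    { toFunctor :=
        { obj := fun x : CotensorObj E G ↦ x.functor.obj g
          map := fun f ↦ (CotensorObj.Hom.nat f).app g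
          map_id := fun _ ↦ rfl
          map_comp := fun _ _ ↦ rfl }
      w := Arr.functor_ext fun ⟨f⟩ ↦
        (isHomLift_iff_arr (CotensorObj.Hom.base f) ((CotensorObj.Hom.nat f).app g)).1
          (CotensorObj.Hom.isHomLift f g) }
  map k :=
    { app := fun x : CotensorObj E G ↦ x.functor.map k
      naturality := fun _ _ f ↦ ((CotensorObj.Hom.nat f).naturality k).symm
      isHomLift' := fun x : CotensorObj E G ↦ x.isHomLift k }
  map_id g := BasedNatTrans.ext _ _ (NatTrans.ext (funext fun (x : CotensorObj E G) ↦
    x.functor.map_id g))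
  map_comp k k' := BasedNatTrans.ext _ _ (NatTrans.ext (funext fun (x : CotensorObj E G) ↦
    x.functor.map_comp k k'))

/-- Evaluation of functors to a cotensor product. -/
def cotensorEval : BasedFunctor A.obj (cotensor E G).obj × G ⥤ BasedFunctor A.obj E.obj :=
  Functor.prod (𝟭 (BasedFunctor A.obj (cotensor E G).obj)) (cotensorCounit E G) ⋙
    basedCompFunctor _ _ _

/-- Currying of functors to a cotensor product, as a functor. -/
def cotensorCurryFunctor :
    BasedFunctor A.obj (cotensor E G).obj ⥤ G ⥤ BasedFunctor A.obj E.obj :=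
  Functor.curry.obj (cotensorEval A E G)

lemma cotensorCurryFunctor_obj_map_app (S : BasedFunctor A.obj (cotensor E G).obj) {g g' : G}
    (k : g ⟶ g') (a : A.obj.obj) :
    (((cotensorCurryFunctor A E G).obj S).map k).toNatTrans.app a =
      (CotensorObj.functor (S.obj a)).map k :=
  Category.id_comp _

lemma cotensorCurryFunctor_map_app {S S' : BasedFunctor A.obj (cotensor E G).obj} (τ : S ⟶ S')
    (g : G) (a : A.obj.obj) : (((cotensorCurryFunctor A E G).map τ).app g).toNatTrans.app a =
      (CotensorObj.Hom.nat (τ.toNatTrans.app a)).app g := by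
  refine (congrArg (_ ≫ ·) ((CotensorObj.functor (S'.obj a)).map_id g)).trans (Category.comp_id _)

lemma injective_cotensorCurryFunctor_obj :
    Function.Injective (cotensorCurryFunctor A E G).obj := by
  intro S S' h
  have h₁ (a : A.obj.obj) (k : Arr G) : Arr.map (CotensorObj.functor (S.obj a)) k =
      Arr.map (CotensorObj.functor (S'.obj a)) k :=
    (Arr.mk_inj.2 (cotensorCurryFunctor_obj_map_app A E G S k.hom a)).symm.trans
      ((congrArg (fun T : G ⥤ BasedFunctor A.obj E.obj ↦
        (⟨(T.map k.hom).toNatTrans.app a⟩ : Arr E.obj.obj)) h).trans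
        (Arr.mk_inj.2 (cotensorCurryFunctor_obj_map_app A E G S' k.hom a)))
  refine basedFunctor_ext (Arr.functor_ext fun k ↦ CotensorObj.arr_ext ?_ (h₁ _) (h₁ _) fun g ↦ ?_)
  · exact congrArg (fun T : A.obj.obj ⥤ C ↦ Arr.map T k) (S.w.trans S'.w.symm)
  · exact congrArg (fun T : G ⥤ BasedFunctor A.obj E.obj ↦ Arr.map (T.obj g).toFunctor k) h

lemma surjective_cotensorCurryFunctor_obj :
    Function.Surjective (cotensorCurryFunctor A E G).obj := by
  intro H
  let S : BasedFunctor A.obj (cotensor E G).obj :=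
    { toFunctor :=
        { obj := fun a ↦ (⟨A.obj.p.obj a,
            { obj := fun g ↦ (H.obj g).obj a
              map := fun k ↦ (H.map k).toNatTrans.app a
              map_id := fun g ↦ by
                rw [H.map_id]
                rfl
              map_comp := fun k k' ↦ by
                rw [H.map_comp]
                rfl }, fun k ↦ (H.map k).isHomLift' a⟩ : CotensorObj E G)
          map := fun {a b} f ↦ (⟨A.obj.p.map f,
            { app := fun g ↦ (H.obj g).map f
              naturality := fun g g' k ↦ ((H.map k).toNatTrans.naturality f).symm },
            fun g ↦ (H.obj g).preserves_isHomLift _ _⟩ : CotensorObj.Hom _ _)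
          map_id := fun a ↦ CotensorObj.hom_ext (A.obj.p.map_id a) fun g ↦ (H.obj g).map_id a
          map_comp := fun f f' ↦ CotensorObj.hom_ext (A.obj.p.map_comp f f') fun g ↦
            (H.obj g).map_comp f f' }
      w := rfl }
  exact ⟨S, CategoryTheory.Functor.hext (fun _ ↦ rfl) fun _ _ k ↦ heq_of_eq
    (BasedNatTrans.ext _ _ (NatTrans.ext (funext fun a ↦
      cotensorCurryFunctor_obj_map_app A E G S k a)))⟩

instance : (cotensorCurryFunctor A E G).Faithful where
  map_injective {S S'} τ τ' h := by
    refine BasedNatTrans.ext _ _ (NatTrans.ext (funext fun a ↦ ?_))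
    refine CotensorObj.hom_ext ?_ fun g ↦ ?_
    · have h₁ := (isHomLift_iff_arr _ _).1 (τ.isHomLift' a)
      have h₂ := (isHomLift_iff_arr _ _).1 (τ'.isHomLift' a)
      exact Arr.mk_inj.1 (h₁.trans h₂.symm)
    · exact (cotensorCurryFunctor_map_app A E G τ g a).symm.trans
        ((congrArg (fun (σ : (cotensorCurryFunctor A E G).obj S ⟶
          (cotensorCurryFunctor A E G).obj S') ↦ (σ.app g).toNatTrans.app a) h).trans
          (cotensorCurryFunctor_map_app A E G τ' g a))

instance : (cotensorCurryFunctor A E G).Full where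
  map_surjective {S S'} σ := by
    have hb {a b : A.obj.obj} (f : a ⟶ b) (S : BasedFunctor A.obj (cotensor E G).obj) :
        CotensorObj.Hom.base (S.map f) =
          eqToHom (S.w_obj a) ≫ A.obj.p.map f ≫ eqToHom (S.w_obj b).symm :=
      Functor.congr_hom S.w f
    have hS (a : A.obj.obj) : CotensorObj.base (S.obj a) = CotensorObj.base (S'.obj a) :=
      (S.w_obj a).trans (S'.w_obj a).symm
    let τ : S ⟶ S' :=
      { app := fun a ↦ (⟨eqToHom (hS a),
          { app := fun g ↦ (σ.app g).toNatTrans.app a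
            naturality := fun g g' k ↦ by
              have h := congrArg (fun (β : ((cotensorCurryFunctor A E G).obj S).obj g ⟶
                ((cotensorCurryFunctor A E G).obj S').obj g') ↦ β.toNatTrans.app a)
                (σ.naturality k)
              exact (congrArg (· ≫ _) (Category.id_comp _)).symm.trans
                (h.trans (congrArg (_ ≫ ·) (Category.id_comp _))) }, fun g ↦
            isHomLift_eqToHom ((σ.app g).isHomLift' a) (S.w_obj a) _⟩ : CotensorObj.Hom _ _)
        naturality := fun a b f ↦ CotensorObj.hom_ext (by
          refine (congrArg (· ≫ _) (hb f S)).trans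
            (Eq.trans ?_ (congrArg (_ ≫ ·) (hb f S')).symm)
          exact eqToHom_conj_comp (A.obj.p.map f) (S.w_obj a) (S.w_obj b).symm (hS b) (hS a)
            (S'.w_obj a) (S'.w_obj b).symm) fun g ↦ (σ.app g).toNatTrans.naturality f
        isHomLift' := fun a ↦ (isHomLift_iff_arr _ _).2 (Arr.mk_eqToHom (S.w_obj a) (hS a)) }
    refine ⟨τ, NatTrans.ext (funext fun g ↦ BasedNatTrans.ext _ _ (NatTrans.ext (funext fun a ↦
      cotensorCurryFunctor_map_app A E G τ g a)))⟩

end Cotensor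

lemma exists_isSimplicialCotensor (E : GrpdOver C) (K : SSet.{u}) :
    ∃ (P : GrpdOver C) (ε : K ⟶ SimplicialCategory.sHom P E), IsSimplicialCotensor ε :=
  ⟨cotensor E (fundamentalGrpd K), fundamentalUnit K ≫ nerveMap (cotensorCounit E _), fun A L ↦
    bijective_comp_tensor_nerve K (cotensorEval A E _) (cotensorCurryFunctor A E _) rfl
      ⟨injective_cotensorCurryFunctor_obj _ _ _, surjective_cotensorCurryFunctor_obj _ _ _⟩ L⟩

end SimplicialTensors

/-! ### Lifting properties of nerves -/

section NerveLifting

section Simplices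

variable {T Q : Type u} [SmallCategory T] [SmallCategory Q] {K L : SSet.{u}}

/-- Restriction of a sequence of composable arrows along a monotone map. -/
abbrev restrictArrows {m m' : ℕ} (F : ComposableArrows T m)
    (g : SimplexCategory.mk m' ⟶ SimplexCategory.mk m) : ComposableArrows T m' :=
  g.toOrderHom.monotone.functor ⋙ F

/-- The value of a map to a nerve on a simplex. -/
def nerveSimplex (x : K ⟶ nerve T) {m : ℕ} (s : K.obj (op (SimplexCategory.mk m))) :
    ComposableArrows T m := x.app _ s

lemma nerveSimplex_map (x : K ⟶ nerve T) {m m' : ℕ} (s : K.obj (op (SimplexCategory.mk m)))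
    (g : SimplexCategory.mk m' ⟶ SimplexCategory.mk m) :
    nerveSimplex x (K.map g.op s) = restrictArrows (nerveSimplex x s) g :=
  ConcreteCategory.congr_hom (x.naturality g.op) s

lemma nerveSimplex_ext {x x' : K ⟶ nerve T}
    (h : ∀ (m : ℕ) (s : K.obj (op (SimplexCategory.mk m))),
      nerveSimplex x s = nerveSimplex x' s) : x = x' := by
  ext ⟨m⟩ s
  induction m using SimplexCategory.rec with
  | _ m => exact h m s

/-- A map to a nerve, given by compatible sequences of composable arrows. -/
def homNerve (F : ∀ (m : SimplexCategory), K.obj (op m) → ComposableArrows T m.len)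
    (hF : ∀ (m m' : SimplexCategory) (g : m' ⟶ m) (s : K.obj (op m)),
      F m' (K.map g.op s) = restrictArrows (F m s) g) : K ⟶ nerve T where
  app m := ↾F m.unop
  naturality m m' g := ConcreteCategory.hom_ext _ _ fun s ↦ hF m.unop m'.unop g.unop s

end Simplices

section PathHom

variable {T Q : Type u} [Groupoid.{u} T] [Groupoid.{u} Q]

/-- The morphism between two vertices of a simplex in the nerve of a groupoid. -/
def pathHom {m : ℕ} (F : ComposableArrows T m) (k l : Fin (m + 1)) : F.obj k ⟶ F.obj l :=
  -- Passing through the vertex `0` defines the arrow for `l < k` as well.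
  Groupoid.inv (F.map (homOfLE (Fin.zero_le k))) ≫ F.map (homOfLE (Fin.zero_le l))

lemma pathHom_comp {m : ℕ} (F : ComposableArrows T m) (j k l : Fin (m + 1)) :
    pathHom F j k ≫ pathHom F k l = pathHom F j l := by
  simp [pathHom]

lemma pathHom_self {m : ℕ} (F : ComposableArrows T m) (k : Fin (m + 1)) :
    pathHom F k k = 𝟙 _ := by
  simp [pathHom]

lemma inv_pathHom {m : ℕ} (F : ComposableArrows T m) (k l : Fin (m + 1)) :
    Groupoid.inv (pathHom F k l) = pathHom F l k := by
  rw [← cancel_epi (pathHom F k l), pathHom_comp, pathHom_self, Groupoid.comp_inv]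

lemma pathHom_of_hom {m : ℕ} (F : ComposableArrows T m) {k l : Fin (m + 1)} (h : k ⟶ l) :
    pathHom F k l = F.map h := by
  have : F.map (homOfLE (Fin.zero_le l)) = F.map (homOfLE (Fin.zero_le k)) ≫ F.map h := by
    rw [← F.map_comp]
    rfl
  simp [pathHom, this]

lemma map_pathHom (q : T ⥤ Q) {m : ℕ} (F : ComposableArrows T m) (k l : Fin (m + 1)) :
    q.map (pathHom F k l) = pathHom (m := m) (F ⋙ q) k l := by
  simp [pathHom]

lemma pathHom_map {m m' : ℕ} (F : ComposableArrows T m)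
    (g : SimplexCategory.mk m' ⟶ SimplexCategory.mk m) (k l : Fin (m' + 1)) :
    pathHom (restrictArrows F g) k l = pathHom F (g.toOrderHom k) (g.toOrderHom l) := by
  have h (l : Fin (m' + 1)) : (restrictArrows F g).map (homOfLE (Fin.zero_le l)) =
        pathHom F (g.toOrderHom 0) (g.toOrderHom l) :=
    (pathHom_of_hom F (homOfLE (g.toOrderHom.monotone (Fin.zero_le l)))).symm
  have h' : pathHom (restrictArrows F g) k l =
      Groupoid.inv (pathHom F (g.toOrderHom 0) (g.toOrderHom k)) ≫
        pathHom F (g.toOrderHom 0) (g.toOrderHom l) :=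
    congrArg₂ (fun a b ↦ Groupoid.inv a ≫ b) (h k) (h l)
  have h'' : pathHom F (g.toOrderHom 0) (g.toOrderHom l) =
    pathHom F (g.toOrderHom 0) (g.toOrderHom k) ≫ pathHom F (g.toOrderHom k) (g.toOrderHom l) :=
    (pathHom_comp ..).symm
  rw [h', h'']
  simp

end PathHom

section FullyFaithful

variable {T P : Type u} [SmallCategory T] [SmallCategory P] {K : SSet.{u}}

/-- The vertices of a simplex. -/
abbrev simplexVertex {m : SimplexCategory} (s : K.obj (op m)) (i : Fin (m.len + 1)) :
    K.obj (op (SimplexCategory.mk 0)) :=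
  K.map (SimplexCategory.const (SimplexCategory.mk 0) m i).op s

lemma simplexVertex_map {m m' : SimplexCategory} (s : K.obj (op m)) (g : m' ⟶ m)
    (i : Fin (m'.len + 1)) :
    simplexVertex (K.map g.op s) i = simplexVertex s (g.toOrderHom i) := by
  rw [simplexVertex, ← ConcreteCategory.comp_apply, ← K.map_comp, ← op_comp,
    SimplexCategory.const_comp]

lemma simplexVertex_self (s : K.obj (op (SimplexCategory.mk 0))) : simplexVertex s 0 = s := by
  rw [simplexVertex, SimplexCategory.const_eq_id, op_id, K.map_id]
  rfl

lemma nerveSimplex_obj (x : K ⟶ nerve T) {m : ℕ} (s : K.obj (op (SimplexCategory.mk m)))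
    (i : Fin (m + 1)) : (nerveSimplex x s).obj i =
      (nerveSimplex x (simplexVertex s i)).obj 0 :=
  (Functor.congr_obj (nerveSimplex_map x s (SimplexCategory.const _ _ i)) 0).symm

/-- Full faithfulness determines the simplices of a lift from its vertices. They are compatible with
restriction because sequences with the same objects and the same image under `q` coincide. -/
lemma exists_lift_nerveMap (q : T ⥤ P) [q.Full] [q.Faithful] (y : K ⟶ nerve P)
    (o : K.obj (op (SimplexCategory.mk 0)) → T)
    (ho : ∀ v, q.obj (o v) = (nerveSimplex y v).obj 0) :
    ∃ x : K ⟶ nerve T, x ≫ nerveMap q = y ∧ ∀ v, (nerveSimplex x v).obj 0 = o v := by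
  have h (m : ℕ) (s : K.obj (op (SimplexCategory.mk m))) :
      ∃ F : Fin (m + 1) ⥤ T, F ⋙ q = nerveSimplex y s ∧ ∀ i, F.obj i = o (simplexVertex s i) := by
    have h' (i : Fin (m + 1)) : q.obj (o (simplexVertex s i)) = (nerveSimplex y s).obj i :=
      (ho _).trans (nerveSimplex_obj y s i).symm
    exact ⟨{ obj := fun i ↦ o (simplexVertex s i)
             map := fun f ↦ q.preimage
               (eqToHom (h' _) ≫ (nerveSimplex y s).map f ≫ eqToHom (h' _).symm)
             map_id := fun i ↦ q.map_injective (by simp)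
             map_comp := fun f g ↦ q.map_injective (by simp) },
      CategoryTheory.Functor.ext h' fun _ _ f ↦ q.map_preimage _, fun _ ↦ rfl⟩
  choose F hF hF' using h
  have hq {m : ℕ} {F G : Fin (m + 1) ⥤ T} (h : F ⋙ q = G ⋙ q) (h' : ∀ i, F.obj i = G.obj i) :
      F = G := by
    refine CategoryTheory.Functor.ext h' fun i j f ↦ q.map_injective ?_
    rw [Functor.map_comp, Functor.map_comp, eqToHom_map, eqToHom_map]
    exact Functor.congr_hom h f
  refine ⟨homNerve (fun m s ↦ F m.len s) fun m m' g s ↦ hq ?_ fun i ↦ ?_,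
    nerveSimplex_ext fun m s ↦ hF m s, fun v ↦ (hF' 0 v 0).trans ?_⟩
  · refine (hF _ _).trans ((nerveSimplex_map y s g).trans ?_)
    exact congrArg (g.toOrderHom.monotone.functor ⋙ ·) (hF m.len s).symm
  · exact (hF' _ _ i).trans ((congrArg o (simplexVertex_map s g i)).trans (hF' _ _ _).symm)
  · rw [simplexVertex_self]

lemma hom_nerve_ext (q : T ⥤ P) [q.Faithful] {x x' : K ⟶ nerve T}
    (h : x ≫ nerveMap q = x' ≫ nerveMap q)
    (h' : ∀ v : K.obj (op (SimplexCategory.mk 0)),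
      (nerveSimplex x v).obj 0 = (nerveSimplex x' v).obj 0) : x = x' := by
  refine nerveSimplex_ext fun m s ↦ ?_
  refine CategoryTheory.Functor.ext (fun i ↦ ?_) fun i j f ↦ q.map_injective ?_
  · rw [nerveSimplex_obj, nerveSimplex_obj x', h']
  · rw [Functor.map_comp, Functor.map_comp, eqToHom_map, eqToHom_map]
    exact Functor.congr_hom (congrArg (fun z ↦ nerveSimplex z s) h) f

end FullyFaithful

end NerveLifting

/-! ### Horn filling in nerves of groupoids -/

section HornFilling

variable {T Q W : Type u} [Groupoid.{u} T] [Groupoid.{u} Q] [Groupoid.{u} W]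

/-- A morphism of simplices, as a simplex of the standard simplex. -/
abbrev stdSimplexOf {m n : ℕ} (f : SimplexCategory.mk m ⟶ SimplexCategory.mk n) :
    (SSet.stdSimplex.{u}.obj (SimplexCategory.mk n)).obj (op (SimplexCategory.mk m)) :=
  SSet.stdSimplex.objEquiv.symm f

lemma exists_eq_stdSimplexOf {m n : ℕ} (s : (SSet.stdSimplex.{u}.obj (SimplexCategory.mk n)).obj
    (op (SimplexCategory.mk m))) : ∃ f, s = stdSimplexOf f :=
  ⟨SSet.stdSimplex.objEquiv s, (Equiv.symm_apply_apply _ _).symm⟩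

/-- The map from a standard simplex to a nerve given by a sequence of composable arrows. -/
def simplexToNerve {T : Type u} [SmallCategory T] {n : ℕ} (X : ComposableArrows T n) :
    SSet.stdSimplex.{u}.obj (SimplexCategory.mk n) ⟶ nerve T :=
  homNerve (fun _ s ↦ restrictArrows X (SSet.stdSimplex.objEquiv s)) fun _ _ _ _ ↦ rfl

lemma nerveSimplex_simplexToNerve {T : Type u} [SmallCategory T] {n m : ℕ}
    (X : ComposableArrows T n) (f : SimplexCategory.mk m ⟶ SimplexCategory.mk n) :
    nerveSimplex (simplexToNerve X) (stdSimplexOf f) = restrictArrows X f := rfl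

lemma eq_simplexToNerve {T : Type u} [SmallCategory T] {n : ℕ}
    (y : SSet.stdSimplex.{u}.obj (SimplexCategory.mk n) ⟶ nerve T) :
    y = simplexToNerve (nerveSimplex y (stdSimplexOf (𝟙 _))) := by
  refine nerveSimplex_ext fun m s ↦ ?_
  obtain ⟨f, rfl⟩ := exists_eq_stdSimplexOf s
  rw [nerveSimplex_simplexToNerve, ← nerveSimplex_map, SSet.stdSimplex.map_objEquiv_symm]
  simp

/-- The inverse of an arrow in a groupoid. -/
def Arr.inv (f : Arr T) : Arr T := ⟨Groupoid.inv f.hom⟩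

section SimplexArr

variable {n : ℕ} {A : (SSet.stdSimplex.{u}.obj (SimplexCategory.mk n)).Subcomplex}
  (t : (A : SSet.{u}) ⟶ nerve T)

/-- The arrow between two vertices of a simplex of a subcomplex of the standard simplex
determined by a map to a nerve. -/
def simplexArr {m : ℕ} (f : SimplexCategory.mk m ⟶ SimplexCategory.mk n)
    (hf : stdSimplexOf f ∈ A.obj _) (k l : Fin (m + 1)) : Arr T :=
  ⟨pathHom (nerveSimplex t ⟨stdSimplexOf f, hf⟩) k l⟩

lemma stdSimplexOf_comp_mem {m m' : ℕ} {f : SimplexCategory.mk m ⟶ SimplexCategory.mk n}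
    (g : SimplexCategory.mk m' ⟶ SimplexCategory.mk m)
    (hf : stdSimplexOf f ∈ A.obj _) : stdSimplexOf (g ≫ f) ∈ A.obj _ := by
  have := A.map g.op hf
  rwa [Set.mem_preimage, SSet.stdSimplex.map_objEquiv_symm] at this

lemma simplexArr_comp {m m' : ℕ} {f : SimplexCategory.mk m ⟶ SimplexCategory.mk n}
    (g : SimplexCategory.mk m' ⟶ SimplexCategory.mk m)
    (hf : stdSimplexOf f ∈ A.obj _) (hf' : stdSimplexOf (g ≫ f) ∈ A.obj _) (k l : Fin (m' + 1)) :
    simplexArr t (g ≫ f) hf' k l = simplexArr t f hf (g.toOrderHom k) (g.toOrderHom l) := by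
  have h : nerveSimplex t ⟨stdSimplexOf (g ≫ f), hf'⟩ =
      restrictArrows (nerveSimplex t ⟨stdSimplexOf f, hf⟩) g := by
    refine (congrArg (nerveSimplex t) (Subtype.ext ?_)).trans (nerveSimplex_map t _ g)
    exact (SSet.stdSimplex.map_objEquiv_symm ..).symm
  refine (congrArg (fun F ↦ (⟨pathHom F k l⟩ : Arr T)) h).trans ?_
  exact congrArg Arr.mk (pathHom_map _ g k l)

lemma simplexArr_inv {m : ℕ} {f : SimplexCategory.mk m ⟶ SimplexCategory.mk n}
    (hf : stdSimplexOf f ∈ A.obj _) (k l : Fin (m + 1)) :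
    (simplexArr t f hf k l).inv = simplexArr t f hf l k := by
  exact congrArg Arr.mk (inv_pathHom _ k l)

lemma isComp_simplexArr {m : ℕ} {f : SimplexCategory.mk m ⟶ SimplexCategory.mk n}
    (hf : stdSimplexOf f ∈ A.obj _) (j k l : Fin (m + 1)) :
    Arr.IsComp (simplexArr t f hf j k) (simplexArr t f hf k l) (simplexArr t f hf j l) :=
  (Arr.isComp_mk _ _ _).2 (pathHom_comp _ _ _ _)

lemma simplexArr_eq_of_le {m m' : ℕ} {f : SimplexCategory.mk m ⟶ SimplexCategory.mk n}
    {f' : SimplexCategory.mk m' ⟶ SimplexCategory.mk n}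
    (hf : stdSimplexOf f ∈ A.obj _) (hf' : stdSimplexOf f' ∈ A.obj _) {k l : Fin (m + 1)}
    {k' l' : Fin (m' + 1)} (hk : f.toOrderHom k = f'.toOrderHom k')
    (hl : f.toOrderHom l = f'.toOrderHom l') (hkl : k ≤ l) (hkl' : k' ≤ l') :
    simplexArr t f hf k l = simplexArr t f' hf' k' l' := by
  have h : SimplexCategory.mkOfLe k l hkl ≫ f = SimplexCategory.mkOfLe k' l' hkl' ≫ f' :=
    SimplexCategory.Hom.ext_one_left _ _ hk hl
  have h₁ := simplexArr_comp t (SimplexCategory.mkOfLe k l hkl) hf (stdSimplexOf_comp_mem _ hf) 0 1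
  have h₂ := simplexArr_comp t (SimplexCategory.mkOfLe k' l' hkl') hf'
    (stdSimplexOf_comp_mem _ hf') 0 1
  refine h₁.symm.trans (Eq.trans ?_ h₂)
  congr 1

lemma simplexArr_eq {m m' : ℕ} {f : SimplexCategory.mk m ⟶ SimplexCategory.mk n}
    {f' : SimplexCategory.mk m' ⟶ SimplexCategory.mk n}
    (hf : stdSimplexOf f ∈ A.obj _) (hf' : stdSimplexOf f' ∈ A.obj _) {k l : Fin (m + 1)}
    {k' l' : Fin (m' + 1)} (hk : f.toOrderHom k = f'.toOrderHom k')
    (hl : f.toOrderHom l = f'.toOrderHom l') :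
    simplexArr t f hf k l = simplexArr t f' hf' k' l' := by
  wlog hkl : k ≤ l generalizing k l k' l'
  · rw [← simplexArr_inv, ← simplexArr_inv t hf' l', this hl hk (le_of_not_ge hkl)]
  by_cases hkl' : k' ≤ l'
  · exact simplexArr_eq_of_le t hf hf' hk hl hkl hkl'
  -- The two orders can be opposite only if both end points are the same vertex of the standard
  -- simplex.
  · have h₁ := f.toOrderHom.monotone hkl
    have h₂ := f'.toOrderHom.monotone (le_of_not_ge hkl')
    have h₃ : f'.toOrderHom l' = f'.toOrderHom k' := le_antisymm h₂ (hk ▸ hl ▸ h₁)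
    rw [← simplexArr_inv t hf' l',
      simplexArr_eq_of_le t hf' hf' h₃ rfl (le_of_not_ge hkl') le_rfl, simplexArr_inv]
    exact simplexArr_eq_of_le t hf hf' hk (hl.trans h₃) hkl le_rfl

end SimplexArr

/-- If `T ⥤ Q` is an isofibration onto the equalizer of two functors `r₁` and `r₂`, its nerve has
the lifting property with respect to inclusions of cones in standard simplices. -/
lemma exists_lift_of_cone {n : ℕ} {A : (SSet.stdSimplex.{u}.obj (SimplexCategory.mk n)).Subcomplex}
    (i : Fin (n + 1))
    (hi : stdSimplexOf (SimplexCategory.const (SimplexCategory.mk 0) (SimplexCategory.mk n) i) ∈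
      A.obj _)
    (hA : ∀ (m : ℕ) (f : SimplexCategory.mk m ⟶ SimplexCategory.mk n), stdSimplexOf f ∈ A.obj _ →
      ∃ (m' : ℕ) (g : SimplexCategory.mk m ⟶ SimplexCategory.mk m')
        (f' : SimplexCategory.mk m' ⟶ SimplexCategory.mk n) (p : Fin (m' + 1)),
        stdSimplexOf f' ∈ A.obj _ ∧ g ≫ f' = f ∧ f'.toOrderHom p = i)
    (q : T ⥤ Q) (r₁ r₂ : Q ⥤ W)
    (hlift : ∀ (s : T) (k : Arr Q), k.src = q.obj s → Arr.map r₁ k = Arr.map r₂ k →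
      ∃ θ : Arr T, θ.src = s ∧ Arr.map q θ = k)
    (t : (A : SSet.{u}) ⟶ nerve T)
    (y : SSet.stdSimplex.{u}.obj (SimplexCategory.mk n) ⟶ nerve Q)
    (hy : y ≫ nerveMap r₁ = y ≫ nerveMap r₂) (hty : t ≫ nerveMap q = A.ι ≫ y) :
    ∃ x : SSet.stdSimplex.{u}.obj (SimplexCategory.mk n) ⟶ nerve T,
      A.ι ≫ x = t ∧ x ≫ nerveMap q = y := by
  obtain ⟨Y, rfl⟩ : ∃ Y : ComposableArrows Q n, y = simplexToNerve Y := ⟨_, eq_simplexToNerve y⟩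
  have hY : (show Fin (n + 1) ⥤ Q from Y) ⋙ r₁ = (show Fin (n + 1) ⥤ Q from Y) ⋙ r₂ :=
    congrArg (fun z ↦ nerveSimplex z (stdSimplexOf (𝟙 _))) hy
  have hq {m : ℕ} (f : SimplexCategory.mk m ⟶ SimplexCategory.mk n) (hf : stdSimplexOf f ∈ A.obj _)
      (k l : Fin (m + 1)) : Arr.map q (simplexArr t f hf k l) =
        ⟨pathHom Y (f.toOrderHom k) (f.toOrderHom l)⟩ := by
    have h : (show Fin (m + 1) ⥤ T from nerveSimplex t ⟨stdSimplexOf f, hf⟩) ⋙ q =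
        restrictArrows Y f :=
      congrArg (fun z : (A : SSet.{u}) ⟶ nerve Q ↦
        nerveSimplex (K := (A : SSet.{u})) (m := m) z ⟨stdSimplexOf f, hf⟩) hty
    refine (congrArg Arr.mk (map_pathHom q _ k l)).trans ?_
    refine (congrArg (fun F ↦ (⟨pathHom (m := m) F k l⟩ : Arr Q)) h).trans ?_
    exact congrArg Arr.mk (pathHom_map Y f k l)
  let o : T := (simplexArr t _ hi 0 0).src
  have ho : q.obj o = Y.obj i := congrArg Arr.src (hq _ hi 0 0)
  -- On a cone with apex `i`, a map to the nerve of a groupoid is determined by the arrows from `i`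
  -- to the other vertices. If a simplex of `A` contains both `i` and `a`, then `t` prescribes the
  -- arrow, independently of the simplex; otherwise it is lifted from `Y`.
  have key (a : Fin (n + 1)) : ∃ θ : Arr T, θ.src = o ∧ Arr.map q θ = ⟨pathHom Y i a⟩ ∧
      ∀ (m : ℕ) (f : SimplexCategory.mk m ⟶ SimplexCategory.mk n) (hf : stdSimplexOf f ∈ A.obj _)
        (k l : Fin (m + 1)), f.toOrderHom k = i → f.toOrderHom l = a →
          simplexArr t f hf k l = θ := by
    by_cases h : ∃ (m : ℕ) (f : SimplexCategory.mk m ⟶ SimplexCategory.mk n)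
        (_ : stdSimplexOf f ∈ A.obj _) (k l : Fin (m + 1)), f.toOrderHom k = i ∧ f.toOrderHom l = a
    · obtain ⟨m, f, hf, k, l, hk, hl⟩ := h
      refine ⟨simplexArr t f hf k l, ?_, ?_, fun m' f' hf' k' l' hk' hl' ↦ ?_⟩
      · have h₁ : simplexArr t f hf k k = simplexArr t _ hi 0 0 := simplexArr_eq t hf hi hk hk
        have h₂ := congrArg Arr.src h₁
        exact h₂
      · rw [hq, hk, hl]
      · exact simplexArr_eq t hf' hf (hk'.trans hk.symm) (hl'.trans hl.symm)
    · obtain ⟨θ, h₁, h₂⟩ := hlift o ⟨pathHom Y i a⟩ ho.symm (by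
        refine (congrArg Arr.mk (map_pathHom r₁ Y i a)).trans (Eq.trans ?_
          (congrArg Arr.mk (map_pathHom r₂ Y i a)).symm)
        exact congrArg (fun F ↦ (⟨pathHom (m := n) F i a⟩ : Arr W)) hY)
      exact ⟨θ, h₁, h₂, fun m f hf k l hk hl ↦ (h ⟨m, f, hf, k, l, hk, hl⟩).elim⟩
  have key' (a : Fin (n + 1)) : ∃ (b : T) (φ : o ⟶ b), Arr.map q ⟨φ⟩ = ⟨pathHom Y i a⟩ ∧
      ∀ (m : ℕ) (f : SimplexCategory.mk m ⟶ SimplexCategory.mk n) (hf : stdSimplexOf f ∈ A.obj _)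
        (k l : Fin (m + 1)), f.toOrderHom k = i → f.toOrderHom l = a →
          simplexArr t f hf k l = ⟨φ⟩ := by
    obtain ⟨θ, h₁, h₂⟩ := key a
    obtain ⟨φ, hφ⟩ := Arr.exists_eq_mk θ h₁ rfl
    exact ⟨_, φ, hφ ▸ h₂⟩
  choose b φ hφ hφ' using key'
  let X : ComposableArrows T n :=
    { obj := b
      map := fun {k l} _ ↦ Groupoid.inv (φ k) ≫ φ l }
  have hX {k l : Fin (n + 1)} (f : k ⟶ l) : Arr.IsComp ⟨φ k⟩ ⟨X.map f⟩ ⟨φ l⟩ :=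
    (Arr.isComp_mk _ _ _).2 (by simp [X])
  refine ⟨simplexToNerve X, nerveSimplex_ext fun m s ↦ ?_, ?_⟩
  · obtain ⟨s, hs⟩ := s
    obtain ⟨f, rfl⟩ := exists_eq_stdSimplexOf s
    refine Arr.functor_ext fun ⟨e⟩ ↦ ?_
    rename_i k l
    -- Enlarge the simplex inside `A` so that it contains the apex. There `t` is also computed from
    -- the arrows out of `i`, which can be cancelled.
    obtain ⟨m', g, f', p, hf', rfl, hp⟩ := hA m f hs
    have h₁ := hφ' _ m' f' hf' p (g.toOrderHom k) hp rfl
    have h₂ := hφ' _ m' f' hf' p (g.toOrderHom l) hp rfl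
    have h₃ : (⟨(nerveSimplex t ⟨stdSimplexOf (g ≫ f'), hs⟩).map e⟩ : Arr T) =
        simplexArr t f' hf' (g.toOrderHom k) (g.toOrderHom l) := by
      rw [← simplexArr_comp t g hf' hs]
      exact congrArg Arr.mk (pathHom_of_hom _ e).symm
    have h₄ := isComp_simplexArr t hf' p (g.toOrderHom k) (g.toOrderHom l)
    rw [h₁, h₂, ← h₃] at h₄
    exact Arr.IsComp.left_cancel (hX ((g ≫ f').toOrderHom.monotone.functor.map e)) h₄
  · rw [eq_simplexToNerve (simplexToNerve X ≫ nerveMap q)]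
    refine congrArg simplexToNerve (Arr.functor_ext fun ⟨e⟩ ↦ ?_)
    rename_i k l
    have h₁ := (hX e).map q
    have h₂ : Arr.IsComp ⟨pathHom Y i k⟩ ⟨Y.map e⟩ ⟨pathHom Y i l⟩ :=
      (Arr.isComp_mk _ _ _).2 (by rw [← pathHom_of_hom, pathHom_comp])
    rw [hφ, hφ] at h₁
    exact Arr.IsComp.left_cancel h₁ h₂

/-- If `T ⥤ Q` is an isofibration onto the equalizer of two functors `r₁` and `r₂`, its nerve has
the right lifting property with respect to horn inclusions. -/
lemma exists_lift_horn {n : ℕ} (i : Fin (n + 2)) (q : T ⥤ Q) (r₁ r₂ : Q ⥤ W)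
    (hlift : ∀ (s : T) (k : Arr Q), k.src = q.obj s → Arr.map r₁ k = Arr.map r₂ k →
      ∃ θ : Arr T, θ.src = s ∧ Arr.map q θ = k)
    (t : (SSet.horn.{u} (n + 1) i : SSet.{u}) ⟶ nerve T)
    (y : SSet.stdSimplex.{u}.obj (SimplexCategory.mk (n + 1)) ⟶ nerve Q)
    (hy : y ≫ nerveMap r₁ = y ≫ nerveMap r₂)
    (hty : t ≫ nerveMap q = (SSet.horn.{u} (n + 1) i).ι ≫ y) :
    ∃ x : SSet.stdSimplex.{u}.obj (SimplexCategory.mk (n + 1)) ⟶ nerve T,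
      (SSet.horn.{u} (n + 1) i).ι ≫ x = t ∧ x ≫ nerveMap q = y := by
  refine exists_lift_of_cone i ?_ ?_ q r₁ r₂ hlift t y hy hty
  · obtain ⟨j, hj⟩ := exists_ne i
    refine (SSet.mem_horn_iff_notMem_range _ _).2 ⟨j, hj, ?_⟩
    rintro ⟨k, hk⟩
    exact hj hk.symm
  · intro m f hf
    -- A simplex of the horn misses some vertex `j ≠ i`, so it lies in the face opposite to `j`, and
    -- this face contains `i`.
    obtain ⟨j, hj, hj'⟩ := (SSet.mem_horn_iff_notMem_range _ _).1 hf
    obtain ⟨p, hp⟩ := Fin.exists_succAbove_eq hj.symm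
    refine ⟨n, SimplexCategory.factor_δ f j, SimplexCategory.δ j, p,
      (SSet.mem_horn_iff_notMem_range _ _).2 ⟨j, hj, ?_⟩,
      SimplexCategory.factor_δ_spec f j fun k hk ↦ hj' ⟨k, hk⟩, hp⟩
    rintro ⟨k, hk⟩
    exact Fin.succAbove_ne j k hk

end HornFilling

/-! ### The simplicial model category of categories fibered in groupoids -/

section SimplicialModelStructure

variable {C : Type u} [SmallCategory C] {A B X Y : GrpdOver C}

/-- Give `B` the objects of `A` in addition to its own. The projection to `B` is a trivial fibration
and `i` lifts to it with pairwise distinct values on objects; a section extending this lift shows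
that `i` is injective. -/
lemma injective_obj_of_llp (i : A ⟶ B)
    (hi : (sectionwise C grpdWeakEquivalences ⊓ sectionwise C grpdFibrations).llp i) :
    Function.Injective i.hom.obj := by
  let k : A.obj.obj ⊕ B.obj.obj → B.obj.obj := Sum.elim i.hom.obj _root_.id
  have hk : Function.Surjective k := fun b ↦ ⟨Sum.inr b, rfl⟩
  let π := inducedGrpdOverHom k hk
  let l : A ⟶ inducedGrpdOver k hk :=
    { hom :=
      { toFunctor :=
        { obj := Sum.inl
          map := fun f ↦ InducedCategory.homMk (i.hom.map f)
          map_id := fun a ↦ InducedCategory.hom_ext (i.hom.map_id a)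
          map_comp := fun f g ↦ InducedCategory.hom_ext (i.hom.map_comp f g) }
        w := i.hom.w } }
  have hπ := (isSurjectiveEquivalence_iff_trivialFibration π).1
    (isSurjectiveEquivalence_inducedGrpdOverHom k hk)
  have sq : CommSq l i π (𝟙 B) := ⟨rfl⟩
  have := hi π hπ
  intro a a' h
  have h₁ (a : A.obj.obj) : sq.lift.hom.obj (i.hom.obj a) = (Sum.inl a : A.obj.obj ⊕ B.obj.obj) :=
    congrArg (fun m : A ⟶ inducedGrpdOver k hk ↦ m.hom.obj a) sq.fac_left
  exact Sum.inl_injective ((h₁ a).symm.trans ((congrArg sq.lift.hom.obj h).trans (h₁ a')))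

section Precomp

variable (i : A ⟶ B) (hi : IsOverEquivalence i) (E : GrpdOver C)

include hi in
lemma IsOverEquivalence.isEquivalence : i.hom.toFunctor.IsEquivalence := by
  have := hi.full
  have := hi.faithful
  have : i.hom.toFunctor.EssSurj := ⟨fun b ↦ by
    obtain ⟨a, φ, hφ⟩ := hi.exists_vertical b
    have := hφ.isIso
    exact ⟨a, ⟨asIso φ⟩⟩⟩
  constructor <;> assumption

include hi in
lemma precomp_faithful : (precomp i.hom E).Faithful where
  map_injective {s t} α β h := by
    have := hi.isEquivalence
    refine BasedNatTrans.ext _ _ (((Functor.whiskeringLeft _ _ E.obj.obj).obj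
      i.hom.toFunctor).map_injective ?_)
    exact congrArg (fun γ ↦ γ.toNatTrans) h

include hi in
-- Precomposition with an equivalence is full on all natural transformations. Verticality at `b`
-- follows from that at the image of some `a` by conjugation with a vertical isomorphism.
lemma precomp_full : (precomp i.hom E).Full where
  map_surjective {s t} γ := by
    have := hi.isEquivalence
    obtain ⟨τ, hτ⟩ := ((Functor.whiskeringLeft _ _ E.obj.obj).obj
      i.hom.toFunctor).map_surjective (X := s.toFunctor) (Y := t.toFunctor) γ.toNatTrans
    have hτ' (a : A.obj.obj) : IsVertical (⟨τ.app (i.hom.obj a)⟩ : Arr E.obj.obj) := by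
      have h : (⟨τ.app (i.hom.obj a)⟩ : Arr E.obj.obj) = ⟨γ.toNatTrans.app a⟩ :=
        congrArg Arr.mk (congrArg (fun σ : i.hom.toFunctor ⋙ s.toFunctor ⟶
          i.hom.toFunctor ⋙ t.toFunctor ↦ σ.app a) hτ)
      rw [h]
      exact IsVertical.app γ a
    refine ⟨⟨τ, fun b ↦ ?_⟩, BasedNatTrans.ext _ _ hτ⟩
    obtain ⟨a, φ, hφ⟩ := hi.exists_vertical b
    have := hφ.isIso
    have h₁ : IsVertical (⟨s.map (inv φ) ≫ τ.app (i.hom.obj a) ≫ t.map φ⟩ : Arr E.obj.obj) := by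
      have e (s : BasedFunctor B.obj E.obj) := IsVertical.arrMap (F := (⟨s⟩ : B ⟶ E)) hφ
      have e' (s : BasedFunctor B.obj E.obj) := IsVertical.arrMap (F := (⟨s⟩ : B ⟶ E)) hφ.inv
      exact (e' s).comp ((hτ' a).comp (e t))
    have h₂ : s.map (inv φ) ≫ τ.app (i.hom.obj a) ≫ t.map φ = τ.app b := by
      rw [← τ.naturality, ← Functor.map_comp_assoc, IsIso.inv_hom_id, CategoryTheory.Functor.map_id,
        Category.id_comp]
    rw [h₂] at h₁
    exact h₁.isHomLift (s.w_obj b)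

end Precomp

/-! ### Lifting problems for `pullbackHom` in terms of mapping groupoids -/

section Pullback

variable (i : A ⟶ B) (p : X ⟶ Y)

lemma eHomWhiskerLeft_eq :
    eHomWhiskerLeft SSet.{u} A p = nerveMap (postcomp A.obj p) := by
  refine nerveSimplex_ext (T := BasedFunctor A.obj Y.obj) fun m s ↦ ?_
  refine CategoryTheory.Functor.hext (fun i ↦ rfl) fun i j k ↦ heq_of_eq ?_
  exact BasedNatTrans.ext _ _ (NatTrans.ext (funext fun a ↦ Category.comp_id _))

lemma eHomWhiskerRight_eq :
    eHomWhiskerRight SSet.{u} i Y = nerveMap (precomp i.hom Y) := by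
  refine nerveSimplex_ext (T := BasedFunctor A.obj Y.obj) fun m s ↦ ?_
  refine CategoryTheory.Functor.hext (fun i ↦ rfl) fun j k e ↦ heq_of_eq ?_
  refine BasedNatTrans.ext _ _ (NatTrans.ext (funext fun a ↦ ?_))
  exact (congrArg (· ≫ _) (CategoryTheory.Functor.map_id _ _)).trans (Category.id_comp _)

lemma hasLiftingProperty_pullbackHom {K L : SSet.{u}} (j : K ⟶ L)
    (h : ∀ (t : K ⟶ nerve (BasedFunctor B.obj X.obj)) (l : L ⟶ nerve (BasedFunctor A.obj X.obj))
      (r : L ⟶ nerve (BasedFunctor B.obj Y.obj)),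
      l ≫ nerveMap (postcomp A.obj p) = r ≫ nerveMap (precomp i.hom Y) →
      t ≫ nerveMap (precomp i.hom X) = j ≫ l → t ≫ nerveMap (postcomp B.obj p) = j ≫ r →
      ∃ x : L ⟶ nerve (BasedFunctor B.obj X.obj), j ≫ x = t ∧
        x ≫ nerveMap (precomp i.hom X) = l ∧ x ≫ nerveMap (postcomp B.obj p) = r) :
    HasLiftingProperty j (pullbackHom i p) where
  sq_hasLift {t b} sq := by
    have h₁ : pullbackHom i p ≫ pullback.fst _ _ = eHomWhiskerRight SSet.{u} i X :=
      pullback.lift_fst _ _ _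
    have h₂ : pullbackHom i p ≫ pullback.snd _ _ = eHomWhiskerLeft SSet.{u} B p :=
      pullback.lift_snd _ _ _
    obtain ⟨x, hx, hl, hr⟩ := h t (b ≫ pullback.fst _ _) (b ≫ pullback.snd _ _)
      (by
        rw [← eHomWhiskerLeft_eq, ← eHomWhiskerRight_eq]
        exact (Category.assoc _ _ _).trans ((congrArg (b ≫ ·) pullback.condition).trans
          (Category.assoc _ _ _).symm))
      (by
        rw [← eHomWhiskerRight_eq, ← h₁]
        exact (Category.assoc _ _ _).symm.trans ((congrArg (· ≫ pullback.fst _ _) sq.w).trans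
          (Category.assoc _ _ _)))
      (by
        rw [← eHomWhiskerLeft_eq, ← h₂]
        exact (Category.assoc _ _ _).symm.trans ((congrArg (· ≫ pullback.snd _ _) sq.w).trans
          (Category.assoc _ _ _)))
    rw [← eHomWhiskerRight_eq, ← h₁] at hl
    rw [← eHomWhiskerLeft_eq, ← h₂] at hr
    exact ⟨⟨⟨x, hx, pullback.hom_ext ((Category.assoc _ _ _).trans hl)
      ((Category.assoc _ _ _).trans hr)⟩⟩⟩

end Pullback

section Lifting

variable {T P Q W : Type u} [SmallCategory T] [SmallCategory P] [SmallCategory Q] [SmallCategory W]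

/-- Vertices in the image of `j` are prescribed by `t`, unambiguously as `j` is a monomorphism, and
the others come from `hobj`. The fully faithful `q` extends the lift to all simplices, and the
faithful `w'` shows that it also lies over `r`. -/
lemma exists_lift_of_fullyFaithful_nerve {K L : SSet.{u}} (j : K ⟶ L) [Mono j] (q : T ⥤ P)
    (q' : T ⥤ Q) (w : P ⥤ W) (w' : Q ⥤ W) (h : q ⋙ w = q' ⋙ w') [q.Full] [q.Faithful] [w'.Faithful]
    (hobj : ∀ (a : P) (b : Q), w.obj a = w'.obj b → ∃ c, q.obj c = a ∧ q'.obj c = b)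
    (t : K ⟶ nerve T) (l : L ⟶ nerve P) (r : L ⟶ nerve Q) (hlr : l ≫ nerveMap w = r ≫ nerveMap w')
    (htl : t ≫ nerveMap q = j ≫ l) (htr : t ≫ nerveMap q' = j ≫ r) :
    ∃ x : L ⟶ nerve T, j ≫ x = t ∧ x ≫ nerveMap q = l ∧ x ≫ nerveMap q' = r := by
  have hj : Function.Injective (j.app (op (SimplexCategory.mk 0))) :=
    (mono_iff_injective _).1 inferInstance
  have key (v : L.obj (op (SimplexCategory.mk 0))) : ∃ o : T,
      q.obj o = (nerveSimplex l v).obj 0 ∧ q'.obj o = (nerveSimplex r v).obj 0 ∧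
        ∀ k, j.app _ k = v → (nerveSimplex t k).obj 0 = o := by
    by_cases hv : ∃ k, j.app _ k = v
    · obtain ⟨k, rfl⟩ := hv
      refine ⟨(nerveSimplex t k).obj 0, ?_, ?_, fun k' hk' ↦ by rw [hj hk']⟩
      · exact congrArg (fun z : K ⟶ nerve P ↦ (nerveSimplex z k).obj 0) htl
      · exact congrArg (fun z : K ⟶ nerve Q ↦ (nerveSimplex z k).obj 0) htr
    · obtain ⟨o, h₁, h₂⟩ := hobj ((nerveSimplex l v).obj 0) ((nerveSimplex r v).obj 0)
        (congrArg (fun z : L ⟶ nerve W ↦ (nerveSimplex z v).obj 0) hlr)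
      exact ⟨o, h₁, h₂, fun k hk ↦ (hv ⟨k, hk⟩).elim⟩
  choose o ho₁ ho₂ ho₃ using key
  obtain ⟨x, hx, hxo⟩ := exists_lift_nerveMap q l o ho₁
  refine ⟨x, hom_nerve_ext q ?_ fun v ↦ ?_, hx, hom_nerve_ext w' ?_ fun v ↦ ?_⟩
  · rw [Category.assoc, hx, htl]
  · exact (hxo _).trans (ho₃ _ v rfl).symm
  · rw [← hlr, ← hx, Category.assoc, Category.assoc]
    exact congrArg (fun F : T ⥤ W ↦ x ≫ nerveMap F) h.symm
  · exact (congrArg q'.obj (hxo v)).trans (ho₂ v)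

end Lifting

section TrivialFibrations

variable (i : A ⟶ B) (p : X ⟶ Y) [HasLiftingProperty i p]

lemma exists_basedFunctor_lift (a : BasedFunctor A.obj X.obj) (b : BasedFunctor B.obj Y.obj)
    (h : (postcomp A.obj p).obj a = (precomp i.hom Y).obj b) :
    ∃ c : BasedFunctor B.obj X.obj,
      (precomp i.hom X).obj c = a ∧ (postcomp B.obj p).obj c = b := by
  have sq : CommSq (⟨a⟩ : A ⟶ X) i p (⟨b⟩ : B ⟶ Y) := ⟨InducedCategory.hom_ext h⟩
  exact ⟨sq.lift.hom, congrArg InducedCategory.Hom.hom sq.fac_left,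
    congrArg InducedCategory.Hom.hom sq.fac_right⟩

/-- If `i` is an equivalence then precomposition with it is fully faithful, and if `p` is one then
postcomposition with it is. The two cases exchange the roles of the two projections of the pullback;
vertices lift because `i` lifts against `p`. -/
lemma hasLiftingProperty_pullbackHom_of_trivial {K L : SSet.{u}} (j : K ⟶ L) [Mono j]
    (h : fiberwiseEquivalences C i ∨ fiberwiseEquivalences C p) :
    HasLiftingProperty j (pullbackHom i p) := by
  refine hasLiftingProperty_pullbackHom i p j fun t l r hlr hl hr ↦ ?_
  obtain h | h := h
  · have h := (fiberwiseEquivalences_iff i).1 h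
    have := precomp_full i h X
    have := precomp_faithful i h X
    have := precomp_faithful i h Y
    exact exists_lift_of_fullyFaithful_nerve j (precomp i.hom X) (postcomp B.obj p)
      (postcomp A.obj p) (precomp i.hom Y) rfl (exists_basedFunctor_lift i p) t l r hlr hl hr
  · have h := (fiberwiseEquivalences_iff p).1 h
    have := h.full
    have := h.faithful
    have := postcomp_full p B.obj
    have := postcomp_faithful p B.obj
    have := postcomp_faithful p A.obj
    obtain ⟨x, h₁, h₂, h₃⟩ := exists_lift_of_fullyFaithful_nerve j (postcomp B.obj p)
      (precomp i.hom X) (precomp i.hom Y) (postcomp A.obj p) rfl (fun b a h ↦ by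
        obtain ⟨c, h₁, h₂⟩ := exists_basedFunctor_lift i p a b h.symm
        exact ⟨c, h₂, h₁⟩) t r l hlr.symm hr hl
    exact ⟨x, h₁, h₃, h₂⟩

end TrivialFibrations

section Fibrations

variable (i : A ⟶ B) (p : X ⟶ Y)

lemma Arr.prod_ext {P Q : Type*} [Category* P] [Category* Q] {f g : Arr (P × Q)}
    (h₁ : Arr.map (CategoryTheory.Prod.fst P Q) f = Arr.map (CategoryTheory.Prod.fst P Q) g)
    (h₂ : Arr.map (CategoryTheory.Prod.snd P Q) f = Arr.map (CategoryTheory.Prod.snd P Q) g) :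
    f = g := by
  obtain ⟨⟨f₁, f₂⟩⟩ := f
  obtain ⟨⟨g₁, g₂⟩⟩ := g
  rename_i x y x' y'
  obtain ⟨x₁, x₂⟩ := x
  obtain ⟨y₁, y₂⟩ := y
  obtain ⟨x₁', x₂'⟩ := x'
  obtain ⟨y₁', y₂'⟩ := y'
  obtain rfl : x₁ = x₁' := congrArg Arr.src h₁
  obtain rfl : x₂ = x₂' := congrArg Arr.src h₂
  obtain rfl : y₁ = y₁' := congrArg Arr.tgt h₁
  obtain rfl : y₂ = y₂' := congrArg Arr.tgt h₂
  exact Arr.mk_inj.2 (Prod.ext (Arr.mk_inj.1 h₁) (Arr.mk_inj.1 h₂))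

/-- Components at objects in the image of `i` are prescribed by `k₁`, unambiguously by injectivity,
and the others are lifted along the fibration `p`. Any choice of vertical components defines a
transformation, so nothing else has to match. -/
lemma exists_arr_lift (hi : Function.Injective i.hom.obj) (hp : sectionwise C grpdFibrations p)
    (s : BasedFunctor B.obj X.obj) (k₁ : Arr (BasedFunctor A.obj X.obj))
    (k₂ : Arr (BasedFunctor B.obj Y.obj)) (h₁ : k₁.src = (precomp i.hom X).obj s)
    (h₂ : k₂.src = (postcomp B.obj p).obj s)
    (h : Arr.map (postcomp A.obj p) k₁ = Arr.map (precomp i.hom Y) k₂) :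
    ∃ θ : Arr (BasedFunctor B.obj X.obj), θ.src = s ∧
      Arr.map (precomp i.hom X) θ = k₁ ∧ Arr.map (postcomp B.obj p) θ = k₂ := by
  have key (b : B.obj.obj) : ∃ e : Arr X.obj.obj, e.src = s.obj b ∧
      GrpdOver.arrMap p e = ⟨k₂.hom.toNatTrans.app b⟩ ∧
        ∀ a, i.hom.obj a = b → e = ⟨k₁.hom.toNatTrans.app a⟩ := by
    by_cases hb : ∃ a, i.hom.obj a = b
    · obtain ⟨a, rfl⟩ := hb
      refine ⟨⟨k₁.hom.toNatTrans.app a⟩, ?_, ?_, fun a' ha' ↦ by rw [hi ha']⟩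
      · exact congrArg (fun S : BasedFunctor A.obj X.obj ↦ S.obj a) h₁
      · exact congrArg (fun S : Arr (BasedFunctor A.obj Y.obj) ↦
          (⟨S.hom.toNatTrans.app a⟩ : Arr Y.obj.obj)) h
    · obtain ⟨e, h₃, h₄⟩ := (sectionwise_grpdFibrations_iff p).1 hp (s.obj b)
        ⟨k₂.hom.toNatTrans.app b⟩
        (congrArg (fun S : BasedFunctor B.obj Y.obj ↦ S.obj b) h₂) (IsVertical.app _ _)
      exact ⟨e, h₃, h₄, fun a ha ↦ (hb ⟨a, ha⟩).elim⟩
  choose e he₁ he₂ he₃ using key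
  obtain ⟨s', β, hβ⟩ := exists_basedNatTrans s e he₁ fun b ↦
    .of_arrMap p ((he₂ b).symm ▸ IsVertical.app _ _)
  refine ⟨⟨β⟩, rfl, basedNatTrans_arr_ext h₁.symm fun a ↦ ?_,
    basedNatTrans_arr_ext h₂.symm fun b ↦ ?_⟩
  · exact (hβ _).trans (he₃ _ a rfl)
  · exact (congrArg (GrpdOver.arrMap p) (hβ b)).trans (he₂ b)

/-- A simplex of the pullback of nerves is a simplex in the nerve of the product of two mapping
groupoids on which the two functors to the third agree. This is the form required by
`exists_lift_horn`. -/
lemma hasLiftingProperty_horn_pullbackHom (hi : Function.Injective i.hom.obj)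
    (hp : sectionwise C grpdFibrations p) {n : ℕ} (j : Fin (n + 2)) :
    HasLiftingProperty (SSet.horn.{u} (n + 1) j).ι (pullbackHom i p) := by
  refine hasLiftingProperty_pullbackHom i p _ fun t l r hlr hl hr ↦ ?_
  let y : SSet.stdSimplex.{u}.obj (SimplexCategory.mk (n + 1)) ⟶
      nerve (BasedFunctor A.obj X.obj × BasedFunctor B.obj Y.obj) :=
    homNerve (fun _ s ↦ Functor.prod' (l.app _ s) (r.app _ s)) fun m m' g s ↦
      congrArg₂ Functor.prod' (nerveSimplex_map l s g) (nerveSimplex_map r s g)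
  have hty : t ≫ nerveMap (Functor.prod' (precomp i.hom X) (postcomp B.obj p)) =
      (SSet.horn.{u} (n + 1) j).ι ≫ y := by
    refine nerveSimplex_ext fun m s ↦ ?_
    exact congrArg₂ Functor.prod' (congrArg (nerveSimplex (m := m) · s) hl)
      (congrArg (nerveSimplex (m := m) · s) hr)
  obtain ⟨x, hx, hx'⟩ := exists_lift_horn j
    (Functor.prod' (precomp i.hom X) (postcomp B.obj p))
    (CategoryTheory.Prod.fst _ _ ⋙ postcomp A.obj p)
    (CategoryTheory.Prod.snd _ _ ⋙ precomp i.hom Y) (fun s k hk hk' ↦ by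
      obtain ⟨θ, h₁, h₂, h₃⟩ := exists_arr_lift i p hi hp s
        (Arr.map (CategoryTheory.Prod.fst _ _) k) (Arr.map (CategoryTheory.Prod.snd _ _) k)
        (congrArg Prod.fst hk) (congrArg Prod.snd hk) hk'
      exact ⟨θ, h₁, Arr.prod_ext h₂ h₃⟩) t y hlr hty
  exact ⟨x, hx, congrArg (· ≫ nerveMap (CategoryTheory.Prod.fst _ _)) hx',
    congrArg (· ≫ nerveMap (CategoryTheory.Prod.snd _ _)) hx'⟩

end Fibrations

lemma isSimplicialModelCategory_fibered [ModelCategory (GrpdOver C)]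
    (hW : weakEquivalences (GrpdOver C) = sectionwise C grpdWeakEquivalences)
    (hF : fibrations (GrpdOver C) = sectionwise C grpdFibrations)
    (hC : cofibrations (GrpdOver C) = (trivialFibrations (GrpdOver C)).llp) :
    IsSimplicialModelCategory (GrpdOver C) where
  exists_tensor A K := exists_isSimplicialTensor A K
  exists_cotensor E K := exists_isSimplicialCotensor E K
  fibration i p hi hp := by
    have hi' := injective_obj_of_llp i (by
      rw [hC, trivialFibrations, hF, hW, inf_comm] at hi
      exact hi)
    rw [hF] at hp
    intro K L j hj
    simp only [SSet.modelCategoryQuillen.J, MorphismProperty.iSup_iff] at hj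
    obtain ⟨n, ⟨k⟩⟩ := hj
    exact hasLiftingProperty_horn_pullbackHom i p hi' hp k
  trivialFibration i p hi hp h := by
    intro K L j hj
    have : Mono j := SSet.modelCategoryQuillen.I_le_monomorphisms _ hj
    have hi' : Cofibration i := ⟨hi⟩
    have hp' : Fibration p := ⟨hp⟩
    have : HasLiftingProperty i p := by
      obtain h | h := h
      · have : WeakEquivalence i := ⟨h⟩
        infer_instance
      · have : WeakEquivalence p := ⟨h⟩
        infer_instance
    rw [hW, sectionwise_grpdWeakEquivalences] at h
    exact hasLiftingProperty_pullbackHom_of_trivial i p j h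

end SimplicialModelStructure

/-! ### The two model structures and their Quillen equivalence -/

theorem theorem1p2 (C : Type u) [SmallCategory C] :
    ∃ (_ : ModelCategory (GrpdOver C)) (_ : ModelCategory (Cᵒᵖ ⥤ Grpd.{u, u})),
      -- the model structure on `Grpd/C`
      (weakEquivalences (GrpdOver C) = fiberwiseEquivalences C ∧
        weakEquivalences (GrpdOver C) = sectionwise C grpdWeakEquivalences ∧
        fibrations (GrpdOver C) = sectionwise C grpdFibrations ∧
        cofibrations (GrpdOver C) = (trivialFibrations (GrpdOver C)).llp ∧
        IsStrongModelCategory (GrpdOver C) ∧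
        IsCofibrantlyGeneratedBy (GrpdOver C)
          (fiberedGeneratingCofibrations C) (fiberedGeneratingTrivialCofibrations C) ∧
        IsLeftProper (GrpdOver C) ∧
        IsSimplicialModelCategory (GrpdOver C)) ∧
      -- the model structure on presheaves of groupoids
      (weakEquivalences (Cᵒᵖ ⥤ Grpd.{u, u}) = objectwise C grpdWeakEquivalences ∧
        fibrations (Cᵒᵖ ⥤ Grpd.{u, u}) = objectwise C grpdFibrations ∧
        cofibrations (Cᵒᵖ ⥤ Grpd.{u, u}) = (trivialFibrations (Cᵒᵖ ⥤ Grpd.{u, u})).llp ∧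
        IsStrongModelCategory (Cᵒᵖ ⥤ Grpd.{u, u}) ∧
        IsCofibrantlyGeneratedBy (Cᵒᵖ ⥤ Grpd.{u, u})
          (presheafGeneratingCofibrations C) (presheafGeneratingTrivialCofibrations C) ∧
        IsLeftProper (Cᵒᵖ ⥤ Grpd.{u, u})) ∧
      -- the functor `p` is left adjoint to `Γ`, and this is a Quillen equivalence
      Nonempty (totalFunctor C ⊣ sectionsFunctor C) ∧
      ∀ adj : totalFunctor C ⊣ sectionsFunctor C, IsQuillenEquivalence adj := by
  obtain ⟨_, hW, hF, hC, hs, hg⟩ := exists_fiberedModelCategory (C := C)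
  obtain ⟨_, hW', hF', hC', hs', hg'⟩ := exists_presheafModelCategory (C := C)
  exact ⟨inferInstance, inferInstance,
    ⟨hW.trans sectionwise_grpdWeakEquivalences, hW, hF, hC, hs, hg,
      isLeftProper_fibered hW hF hC, isSimplicialModelCategory_fibered hW hF hC⟩,
    ⟨hW', hF', hC', hs', hg', isLeftProper_presheaf hW hF hC hW' hF' hC'⟩,
    ⟨totalAdjunction⟩, isQuillenEquivalence_total hW hF hC hW' hF' hC'⟩
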